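/- **Setup.** Let $N=\mathbb Z^n$, $M=\operatorname{Hom}(N,\mathbb Z)$; write $P^*=\{v\mid\langle m,v\rangle\ge-1\ \forall m\in P\}$. Let $\Delta\subset M_{\mathbb R}$ be a reflexive polytope and $Y=\mathbb P(\Delta)$, with fan $\Sigma$ over the proper faces of $\Delta^*$, rays $\Sigma(1)$ generated by the vertices of $\Delta^*$, and Cox ring $S=\mathbb C[x_r\mid r\in\Sigma(1)]$. Let $\Sigma(1)=J_1\sqcup\dots\sqcup J_c$ be a nef partition: all $J_j\neq\emptyset$, and each $E_j=\sum_{r\in J_j}D_r$ is Cartier and globally generated. Let $\Delta_j\subset M_{\mathbb R}$ be the polytope of sections of $E_j$, $m_j=\prod_{r\in J_j}x_r$, $I_0=\langle m_1,\dots,m_c\rangle$, and let $m_jx^u$ $(u\in\Delta_j\cap M)$ be the Cox monomial $\prod_{r\in J_j}x_r\cdot\prod_r x_r^{\langle u,r\rangle}$ of the section $u$. For coefficients $a=(a_u)$ put $$g_j=\sum_{u\in\Delta_j\cap M,\ m_jx^u\notin I_0}a_u\,m_jx^u,\qquad I=\langle t g_j+m_j\mid j=1,\dots,c\rangle\subset\mathbb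 C[t]\otimes S ;$$ this is the *canonical degeneration* $\mathfrak X$ attached to the nef partition and to $a$. Let $\nabla^*=\operatorname{conv}(\Delta_1\cup\dots\cup\Delta_c)$; the *Batyrev–Borisov dual partition* of the set of vertices of $\nabla^*$ is $J_j^\circ=\{\text{vertices of }\nabla^*\text{ in }\Delta_j\}$. Assume: 1. the special fiber $X_0=V(I_0)\subset Y$ is non-empty, i.e. some cone of $\Sigma$ has a ray in every $J_j$; 2. leaving out the monomials of $I_0$ does not shrink the Newton polytopes of general sections: for each $j$, $\Delta_j=\operatorname{conv}(\{0\}\cup\{u\in\Delta_j\cap M\mid m_jx^u\notin I_0\})$; and the same holds for the partition $(J_j^\circ)_j$ of the vertices of $\nabla^*$; 3. $a_u\neq0$ for all $u$ occurring in the $g_j$. **Tropical mirror of $\mathfrak X$.** Fix a monomial ordering $>$ on $\mathbb C[t]\otimes S$ that is local in $t$, and let $>_w$ be the weight ordering by $w$ refined by $>$. Let $C_{I_0}(I)\subset\mathbb R\oplus N_{\mathbb R}$ be the closure of the set of all $-(w_t,w_x)$ such that the lead ideal of $I$ with respect to $>_{(w_t,w_x)}$ is $I_0$, where $w_x=\sum_r\omega_r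 r$ is represented by a weight vector $\omega\in\mathbb R^{\Sigma(1)}$ on the Cox variables. Let $Q=\nabla_{I_0}(I)=C_{I_0}(I)\cap\{w_t=1\}$, and let $Y^\circ$ be the toric variety of the fan $\Sigma^\circ$ over the faces of $Q^*\subset M_{\mathbb R}$, with Cox ring $S^\circ=\mathbb C[y_r\mid r\in\Sigma^\circ(1)]$, where $\Sigma^\circ(1)$ is identified with the set of vertices of $Q^*$. Let $F_r^\circ=\{w\in Q\mid\langle r,w\rangle=-1\}$. Let $BF(I)\subset\mathbb R\oplus N_{\mathbb R}$ be the Bergman fan, the set of all $(\operatorname{val}t,\sum_r\operatorname{val}(x_r)\,r)$ for zeros $(t,x)$ of $I$ with all coordinates non-zero over the field of generalized Puiseux series with complex coefficients and real exponents, let $T=\{w\in\partial Q\mid(1,w)\in BF(I)\}$, and put $$I_0^\circ=\Big\langle\prod_{r\in A}y_r\ \Big|\ A\subset\Sigma^\circ(1),\ T\subset\bigcup_{r\in A}F_r^\circ\Big\rangle\subset S^\circ,\qquad X_0^\circ=V(I_0^\circ)\subset Y^\circ .$$ Let $\Xi\subset N$ be the set of lattice points of the union of those faces $F^*$ of $\Delta^*$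 whose dual face $F$ of $\Delta$ corresponds to a toric stratum of $Y$ contained in $X_0$. For $\alpha\in\Xi$ let $\varphi_\alpha:\mathcal I_{X_0^\circ}\to\mathcal O_{X_0^\circ}$ be given, on the affine chart $\operatorname{Spec}\mathbb C[\tau^\vee\cap N]$ of each cone $\tau\in\Sigma^\circ$, by $\chi^u\mapsto\chi^{u+\alpha}$ if $u+\alpha\in\tau^\vee$, and $\chi^u\mapsto0$ otherwise. For coefficients $b=(b_\alpha)$ the *first order tropical mirror* of $\mathfrak X$ is the closed subscheme of $Y^\circ\times\operatorname{Spec}\mathbb C[s]/\langle s^2\rangle$ whose ideal on each chart is generated by all $m+s\sum_{\alpha\in\Xi}b_\alpha\varphi_\alpha(m)$, $m$ a monomial in $\mathcal I_{X_0^\circ}$. **Theorem.** (i) $Q^*=\nabla^*$, $Q$ is reflexive (so $Y^\circ=\mathbb P(\nabla)$ with $\nabla=Q$), and $\Sigma^\circ(1)=J_1^\circ\sqcup\dots\sqcup J_c^\circ$ is a nef partition. (ii) Each $\varphi_\alpha$, $\alpha\in\Xi$, is a well-defined homomorphism of modules on each chart. (iii) For general coefficients $b$ (outside the zero set of a non-zero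 polynomial), the canonical degeneration $\mathfrak X^\circ\subset Y^\circ\times\operatorname{Spec}\mathbb C[s]$ attached to the nef partition $(J_j^\circ)_j$ and to $b$ is flat over $\operatorname{Spec}\mathbb C[s]$, and its restriction to $\operatorname{Spec}\mathbb C[s]/\langle s^2\rangle$ is the first order tropical mirror of $\mathfrak X$ with coefficients $b$. That is, the first order tropical mirror extends to a flat family over $\operatorname{Spec}\mathbb C[s]$, namely the canonical degeneration attached to the Batyrev–Borisov dual nef partition. -/

import Mathlib

open scoped Polynomial DualNumber Classical

noncomputable section

namespace TropMirror

/-! ### Lattices and polytopes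

The dual lattices `M` and `N` are both `ℤⁿ`, with the dot product as pairing. -/

abbrev Lat (n : ℕ) := Fin n → ℤ

abbrev Vec (n : ℕ) := Fin n → ℝ

def toVec {n : ℕ} (u : Lat n) : Vec n := fun i => (u i : ℝ)

/-- The dual polytope `P* = {v | ⟨m, v⟩ ≥ -1 for all m ∈ P}`. -/
def dual {n : ℕ} (P : Set (Vec n)) : Set (Vec n) := {v | ∀ m ∈ P, -1 ≤ m ⬝ᵥ v}

def IsLatticePolytope {n : ℕ} (P : Set (Vec n)) : Prop :=
  ∃ F : Finset (Lat n), P = convexHull ℝ (toVec '' (F : Set (Lat n)))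

/-- A reflexive polytope: it and its dual are integral and contain `0` in their interior. -/
structure IsReflexive {n : ℕ} (P : Set (Vec n)) : Prop where
  lattice : IsLatticePolytope P
  dual_lattice : IsLatticePolytope (dual P)
  zero_mem : (0 : Vec n) ∈ interior P
  zero_mem_dual : (0 : Vec n) ∈ interior (dual P)

/-- The lattice points that are vertices of `P`. For an integral polytope whose only interior
lattice point is `0`, these are the minimal generators of the rays of the fan over its faces. -/
def verts {n : ℕ} (P : Set (Vec n)) : Finset (Lat n) :=
  if h : {v : Lat n | toVec v ∈ P.extremePoints ℝ}.Finite then h.toFinset else ∅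

/-- A cone of the fan over the proper faces of `conv V` (where `0` is an interior point), given by
the set `τ` of its ray generators: `τ` is the set of elements of `V` on a face `⟨·, w⟩ = -1`,
where `⟨·, w⟩ ≥ -1` on `V`. The empty set is the cone `{0}`. -/
def IsCone {n : ℕ} (V τ : Finset (Lat n)) : Prop :=
  ∃ w : Vec n, (∀ r ∈ V, -1 ≤ toVec r ⬝ᵥ w) ∧ τ = V.filter (fun r => toVec r ⬝ᵥ w = -1)

/-! ### Divisors and nef partitions

`V` is the set of ray generators; a subset `D` of `V` stands for the divisor `∑_{r ∈ D} D_r`. -/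

/-- The torus invariant sections of `𝒪(∑_{r ∈ D} D_r)`, as characters. -/
def divSections {n : ℕ} (V D : Finset (Lat n)) : Set (Lat n) :=
  {u | ∀ r ∈ V, (if r ∈ D then -1 else 0) ≤ u ⬝ᵥ r}

/-- The polytope of sections of `∑_{r ∈ D} D_r`. -/
def sectionPolytope {n : ℕ} (V D : Finset (Lat n)) : Set (Vec n) :=
  convexHull ℝ (toVec '' divSections V D)

/-- `V = J₁ ∪ … ∪ J_c` is a nef partition: a partition such that each `E_j = ∑_{r ∈ J_j} D_r` is
Cartier (there are local equations) and globally generated (on each cone, some torus invariant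
section is a local generator). -/
structure IsNefPartition {n c : ℕ} (V : Finset (Lat n)) (J : Fin c → Finset (Lat n)) : Prop where
  nonempty : ∀ j, (J j).Nonempty
  disjoint : ∀ j k, j ≠ k → Disjoint (J j) (J k)
  union : Finset.univ.biUnion J = V
  cartier : ∀ j τ, IsCone V τ →
    ∃ u : Lat n, ∀ r ∈ τ, u ⬝ᵥ r = if r ∈ J j then -1 else 0
  generated : ∀ j τ, IsCone V τ →
    ∃ u ∈ divSections V (J j), ∀ r ∈ τ, u ⬝ᵥ r = if r ∈ J j then -1 else 0

/-- `∇* = conv (Δ₁ ∪ … ∪ Δ_c)`. -/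
def nablaDual {n c : ℕ} (V : Finset (Lat n)) (J : Fin c → Finset (Lat n)) : Set (Vec n) :=
  convexHull ℝ (⋃ j, sectionPolytope V (J j))

/-- The Batyrev–Borisov dual partition of the set `W` of vertices of `∇*`: `J_j°` consists of the
vertices that lie in `Δ_j`. -/
def dualPartition {n c : ℕ} (V : Finset (Lat n)) (J : Fin c → Finset (Lat n))
    (W : Finset (Lat n)) : Fin c → Finset (Lat n) :=
  fun j => W.filter (fun u => toVec u ∈ sectionPolytope V (J j))

/-! ### The canonical degeneration

The Cox ring is `MvPolynomial V ℂ`, and `ℂ[t] ⊗ S` is `MvPolynomial V ℂ[X]`, where `t = X`. -/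

/-- `∏_{r ∈ D} x_r`. -/
def divMonomial {n : ℕ} (V D : Finset (Lat n)) : MvPolynomial V ℂ :=
  ∏ r : V, if (r : Lat n) ∈ D then MvPolynomial.X r else 1

/-- The Cox monomial of the section `u` of `∑_{r ∈ D} D_r`: the exponent of `x_r` is the
coefficient of `D_r` plus `⟨u, r⟩`. -/
def sectionMonomial {n : ℕ} (V D : Finset (Lat n)) (u : Lat n) : MvPolynomial V ℂ :=
  ∏ r : V, MvPolynomial.X r ^ ((if (r : Lat n) ∈ D then 1 else 0) + u ⬝ᵥ (r : Lat n)).toNat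

/-- `I₀ = ⟨m_1, …, m_c⟩`. -/
def specialIdeal {n c : ℕ} (V : Finset (Lat n)) (J : Fin c → Finset (Lat n)) :
    Ideal (MvPolynomial V ℂ) :=
  Ideal.span (Set.range fun j => divMonomial V (J j))

/-- The sections of `𝒪(E_j)` whose monomial does not lie in `I₀`. -/
def freeSections {n c : ℕ} (V : Finset (Lat n)) (J : Fin c → Finset (Lat n)) (j : Fin c) :
    Set (Lat n) :=
  {u | u ∈ divSections V (J j) ∧ sectionMonomial V (J j) u ∉ specialIdeal V J}

/-- The section `g_j` of `𝒪(E_j)` with coefficients `a`, not involving monomials in `I₀`. No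
nonzero `u` is a section of two different `E_j`, so that one function `a` serves all `j`. -/
def freeSection {n c : ℕ} (V : Finset (Lat n)) (J : Fin c → Finset (Lat n)) (a : Lat n → ℂ)
    (j : Fin c) : MvPolynomial V ℂ :=
  ∑ᶠ u ∈ freeSections V J j, MvPolynomial.C (a u) * sectionMonomial V (J j) u

/-- `I = ⟨t g_j + m_j | j = 1, …, c⟩ ⊆ ℂ[t] ⊗ S`. -/
def degenerationIdeal {n c : ℕ} (V : Finset (Lat n)) (J : Fin c → Finset (Lat n))
    (a : Lat n → ℂ) : Ideal (MvPolynomial V ℂ[X]) :=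
  Ideal.span (Set.range fun j =>
    MvPolynomial.C Polynomial.X * MvPolynomial.map Polynomial.C (freeSection V J a j)
      + MvPolynomial.map Polynomial.C (divMonomial V (J j)))

/-- The general sections of the `𝒪(E_j)` keep their full Newton polytope `Δ_j` (whose point `0` is
the monomial `m_j`) when the other monomials of `I₀` are left out. -/
def HasFullNewtonPolytopes {n c : ℕ} (V : Finset (Lat n)) (J : Fin c → Finset (Lat n)) : Prop :=
  ∀ j, convexHull ℝ (insert 0 (toVec '' freeSections V J j)) = sectionPolytope V (J j)

/-! ### The Gröbner cone of special fiber weights -/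

/-- A monomial ordering on `ℂ[t] ⊗ ℂ[x_r | r ∈ σ]` that is local in `t`. The pair `(k, m)` stands
for the monomial `t^k x^m`. -/
structure LocalMonomialOrder (σ : Type) where
  lt : ℕ × (σ →₀ ℕ) → ℕ × (σ →₀ ℕ) → Prop
  strictTotal : IsStrictTotalOrder (ℕ × (σ →₀ ℕ)) lt
  add_right : ∀ p q r, lt p q → lt (p + r) (q + r)
  t_lt_one : lt (1, 0) (0, 0)

/-- The coefficient of `t^k x^m`, where `p = (k, m)`. -/
def tcoeff {σ : Type} (p : ℕ × (σ →₀ ℕ)) (f : MvPolynomial σ ℂ[X]) : ℂ :=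
  (MvPolynomial.coeff p.2 f).coeff p.1

def weight {σ : Type} [Fintype σ] (wt : ℝ) (ω : σ → ℝ) (p : ℕ × (σ →₀ ℕ)) : ℝ :=
  wt * p.1 + ∑ r, ω r * p.2 r

/-- The weight ordering refined by the given ordering. -/
def weightLT {σ : Type} [Fintype σ] (ord : LocalMonomialOrder σ) (wt : ℝ) (ω : σ → ℝ)
    (p q : ℕ × (σ →₀ ℕ)) : Prop :=
  weight wt ω p < weight wt ω q ∨ (weight wt ω p = weight wt ω q ∧ ord.lt p q)

/-- The ideal generated by the lead monomials of the elements of `I`. -/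
def leadIdeal {σ : Type} [Fintype σ] (ord : LocalMonomialOrder σ) (wt : ℝ) (ω : σ → ℝ)
    (I : Ideal (MvPolynomial σ ℂ[X])) : Ideal (MvPolynomial σ ℂ[X]) :=
  Ideal.span {g | ∃ f ∈ I, ∃ p, tcoeff p f ≠ 0 ∧
    (∀ q, tcoeff q f ≠ 0 → q ≠ p → weightLT ord wt ω q p) ∧
    g = MvPolynomial.monomial p.2 (Polynomial.X ^ p.1)}

/-- The Gröbner cone `C_{I₀}(I) ⊆ ℝ ⊕ N_ℝ`: the closure of the set of all `-(w_t, w_x)` with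
`L_{>_{(w_t, φ(w_x))}}(I) = I₀`. Under the presentation of the class group, a weight vector `ω` on
the Cox variables represents `φ(w_x)` if and only if `∑_r ω_r r = w_x`. -/
def groebnerCone {n : ℕ} (V : Finset (Lat n)) (ord : LocalMonomialOrder V)
    (I₀ : Ideal (MvPolynomial V ℂ)) (I : Ideal (MvPolynomial V ℂ[X])) : Set (ℝ × Vec n) :=
  closure {p | ∃ ω : V → ℝ, ∑ r : V, ω r • toVec (r : Lat n) = -p.2 ∧
    leadIdeal ord (-p.1) ω I = I₀.map (MvPolynomial.map Polynomial.C)}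

/-- The polytope of special fiber weights `∇_{I₀}(I) = C_{I₀}(I) ∩ {w_t = 1}`. -/
def specialFiberPolytope {n : ℕ} (V : Finset (Lat n)) (ord : LocalMonomialOrder V)
    (I₀ : Ideal (MvPolynomial V ℂ)) (I : Ideal (MvPolynomial V ℂ[X])) : Set (Vec n) :=
  {w | ((1, w) : ℝ × Vec n) ∈ groebnerCone V ord I₀ I}

/-! ### Tropical geometry -/

/-- The field of generalized Puiseux series with complex coefficients and real exponents. -/
abbrev PuiseuxField := HahnSeries ℝ ℂ

/-- Evaluation of an element of `ℂ[t] ⊗ S` at a point over the field of Puiseux series. -/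
def evalAt {σ : Type} (t : PuiseuxField) (x : σ → PuiseuxField) :
    MvPolynomial σ ℂ[X] →+* PuiseuxField :=
  MvPolynomial.eval₂Hom (Polynomial.eval₂RingHom (HahnSeries.C : ℂ →+* PuiseuxField) t) x

/-- The Bergman fan `BF(I)`: the image under the valuation of the zeros of `I` (with `t` considered
as a variable) in the torus over the field of Puiseux series. In the Cox setup, it lies in
`ℝ ⊕ N_ℝ`, where the weight vector `ω` on the Cox variables is identified with `∑_r ω_r r`. -/
def bergmanFan {n : ℕ} (V : Finset (Lat n)) (I : Ideal (MvPolynomial V ℂ[X])) :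
    Set (ℝ × Vec n) :=
  {p | ∃ (t : PuiseuxField) (x : V → PuiseuxField), t ≠ 0 ∧ (∀ r, x r ≠ 0) ∧
    (∀ f ∈ I, evalAt t x f = 0) ∧
    t.order = p.1 ∧ ∑ r : V, (x r).order • toVec (r : Lat n) = p.2}

/-- The support of the special fiber tropical variety `T_{I₀}(I) = BF(I) ∩ ∂C_{I₀}(I) ∩ {w_t = 1}`,
a subset of the boundary of `Q = ∇_{I₀}(I)`. -/
def tropSupport {n : ℕ} (V : Finset (Lat n)) (I : Ideal (MvPolynomial V ℂ[X]))
    (Q : Set (Vec n)) : Set (Vec n) :=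
  {w | w ∈ frontier Q ∧ ((1, w) : ℝ × Vec n) ∈ bergmanFan V I}

/-! ### The mirror special fiber and the co-complex of deformations -/

/-- The monomial ideal `I₀°` in the Cox ring of the fan with rays `W`, the vertices of `Q*`: it is
generated by the products of variables whose facets of `Q` together cover `T`. -/
def mirrorSpecialIdeal {n : ℕ} (W : Finset (Lat n)) (Q T : Set (Vec n)) :
    Ideal (MvPolynomial W ℂ) :=
  Ideal.span {g | ∃ A : Finset W,
    T ⊆ (⋃ r ∈ A, {w | w ∈ Q ∧ toVec (r : Lat n) ⬝ᵥ w = -1}) ∧ g = ∏ r ∈ A, MvPolynomial.X r}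

/-- The set `Ξ` of lattice points of the support of `Strata_Δ(I₀)*`: the lattice points of those
faces `conv τ` of `Δ*` for which the stratum `{x_r = 0 for r ∈ τ}` lies in the zero locus
of `I₀`. -/
def deformationPoints {n : ℕ} (V : Finset (Lat n)) (I₀ : Ideal (MvPolynomial V ℂ)) :
    Set (Lat n) :=
  {α | ∃ τ, IsCone V τ ∧ I₀ ≤ Ideal.span (MvPolynomial.X '' {r : V | (r : Lat n) ∈ τ}) ∧
    toVec α ∈ convexHull ℝ (toVec '' (τ : Set (Lat n)))}

/-! ### Closed subschemes of `Y × Spec B` on affine charts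

The toric variety `Y` of the fan over the faces of `conv V` is covered by the affine charts
`Spec ℂ[τ^∨ ∩ M]`, one for each cone `τ`. A closed subscheme of `Y × Spec B` is given by its ideals
in the rings `B[τ^∨ ∩ M]`. -/

/-- The monoid `τ^∨ ∩ M`. -/
def dualMonoid {n : ℕ} (τ : Finset (Lat n)) : AddSubmonoid (Lat n) where
  carrier := {u | ∀ r ∈ τ, 0 ≤ u ⬝ᵥ r}
  zero_mem' := by
    intro r _
    simp
  add_mem' := by
    intro u v hu hv r hr
    rw [add_dotProduct]
    exact add_nonneg (hu r hr) (hv r hr)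

/-- The coordinate ring `B[τ^∨ ∩ M]` of the chart. -/
abbrev ChartRing {n : ℕ} (B : Type) [CommRing B] (τ : Finset (Lat n)) :=
  AddMonoidAlgebra B (dualMonoid τ)

/-- The exponents of the Laurent monomials in the localization of the Cox ring at
`∏_{r ∉ τ} x_r`. -/
def locMonoid {n : ℕ} (V τ : Finset (Lat n)) : AddSubmonoid (V → ℤ) where
  carrier := {a | ∀ r : V, (r : Lat n) ∈ τ → 0 ≤ a r}
  zero_mem' := by
    intro r _
    simp
  add_mem' := by
    intro a b ha hb r hr
    exact add_nonneg (ha r hr) (hb r hr)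

/-- The map from the Cox ring over `B` to its localization at `∏_{r ∉ τ} x_r`. -/
def coxToLoc {n : ℕ} (B : Type) [CommRing B] (V τ : Finset (Lat n)) :
    MvPolynomial V B →+* AddMonoidAlgebra B (locMonoid V τ) :=
  MvPolynomial.eval₂Hom (algebraMap B (AddMonoidAlgebra B (locMonoid V τ))) fun r =>
    AddMonoidAlgebra.single
      (⟨Pi.single r 1, fun s _ => by
        by_cases h : s = r
        · subst h; simp
        · simp [h]⟩ : locMonoid V τ) 1

/-- The map `u ↦ (⟨u, r⟩)_r` from characters to exponents of Laurent monomials of degree `0`. -/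
def degZero {n : ℕ} (V τ : Finset (Lat n)) : dualMonoid τ →+ locMonoid V τ where
  toFun u := ⟨fun r => (u : Lat n) ⬝ᵥ (r : Lat n), fun r hr => u.2 r hr⟩
  map_zero' := by
    ext r
    simp
  map_add' u v := by
    ext r
    simp [add_dotProduct]

/-- The identification of the chart ring with the degree `0` part of the localized Cox ring. -/
def chartToLoc {n : ℕ} (B : Type) [CommRing B] (V τ : Finset (Lat n)) :
    ChartRing B τ →+* AddMonoidAlgebra B (locMonoid V τ) :=
  AddMonoidAlgebra.mapDomainRingHom B (degZero V τ)

/-- The ideal on the chart `τ` of the closed subscheme defined by an ideal of the Cox ring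
over `B`: the degree `0` part of the localized ideal. -/
def chartIdeal {n : ℕ} {B : Type} [CommRing B] (V τ : Finset (Lat n))
    (I : Ideal (MvPolynomial V B)) : Ideal (ChartRing B τ) :=
  (I.map (coxToLoc B V τ)).comap (chartToLoc B V τ)

/-- Restriction of a family over `Spec ℂ[s]` to `Spec ℂ[s]/⟨s²⟩`, on coordinate rings of charts. -/
def toFirstOrder {n : ℕ} (τ : Finset (Lat n)) : ChartRing ℂ[X] τ →+* ChartRing ℂ[ε] τ :=
  AddMonoidAlgebra.mapRingHom (dualMonoid τ)
    ((Polynomial.aeval (ε : ℂ[ε])).toRingHom : ℂ[X] →+* ℂ[ε])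

/-! ### The first order tropical mirror -/

/-- The value on the monomial `χ^u` of the homomorphism `φ_α` of degree `α`: it is `χ^{u+α}`
if this is regular on the chart, and `0` otherwise. -/
def shiftMonomial {n : ℕ} (B : Type) [CommRing B] (τ : Finset (Lat n)) (α : Lat n)
    (u : dualMonoid τ) : ChartRing B τ :=
  if h : (u : Lat n) + α ∈ dualMonoid τ then AddMonoidAlgebra.single ⟨(u : Lat n) + α, h⟩ 1 else 0

/-- On each chart, `φ_α` is a homomorphism of modules from the ideal of the subscheme defined by
`I₀` to its coordinate ring. -/
def IsDeformation {n : ℕ} (V : Finset (Lat n)) (I₀ : Ideal (MvPolynomial V ℂ))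
    (α : Lat n) : Prop :=
  ∀ τ, IsCone V τ → ∃ φ : chartIdeal V τ I₀ →ₗ[ChartRing ℂ τ] (ChartRing ℂ τ ⧸ chartIdeal V τ I₀),
    ∀ (u : dualMonoid τ) (h : AddMonoidAlgebra.single u (1 : ℂ) ∈ chartIdeal V τ I₀),
      φ ⟨AddMonoidAlgebra.single u 1, h⟩ =
        Ideal.Quotient.mk (chartIdeal V τ I₀) (shiftMonomial ℂ τ α u)

/-- The first order family over `Spec ℂ[s]/⟨s²⟩` on the chart `τ`: the ideal generated by all
`m + s ∑_{α ∈ Ξ} c_α φ_α(m)`, where `m` runs over the monomials in the ideal of the subscheme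
defined by `I₀`. -/
def firstOrderIdeal {n : ℕ} (V : Finset (Lat n)) (I₀ : Ideal (MvPolynomial V ℂ))
    (Ξ : Set (Lat n)) (c : Lat n → ℂ) (τ : Finset (Lat n)) : Ideal (ChartRing ℂ[ε] τ) :=
  Ideal.span {f | ∃ u : dualMonoid τ, AddMonoidAlgebra.single u (1 : ℂ) ∈ chartIdeal V τ I₀ ∧
    f = AddMonoidAlgebra.single u 1 +
      ∑ᶠ α ∈ Ξ, algebraMap ℂ[ε] (ChartRing ℂ[ε] τ) (c α • ε) * shiftMonomial ℂ[ε] τ α u}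

end TropMirror

end
open TropMirror

open scoped Polynomial DualNumber Classical

noncomputable section

namespace TropMirror

/-! ### Convex geometry -/

section Convex
variable {n : ℕ}

/-! Everything rests on Batyrev–Borisov duality. Put ∇_j = conv(0, J_j). Nefness provides on every
cone a section of E_k that is a local generator, and pairing with it reads off the mass of a vector
along J_k (`IsNefFan.exists_decomposition`). Hence ∇_j is cut out by ⟨Δ_k, ·⟩ ≥ -δ_kj, and the dual
of ∇* is the Minkowski sum ∇ = ∇_1 + … + ∇_c, a lattice polytope. Reflexivity and nefness of the
dual partition follow.

The polytope Q is ∇ (`IsNefFan.specialFiberPolytope_eq`). If the lead ideal is I₀, the lead term of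
t g_j + m_j has to be m_j, because no other term lies in I₀; so ⟨u, w⟩ ≥ -1 for the free sections u,
which together with 0 span Δ_j. Conversely the m_j are coprime, so for weights that make them the
lead terms the generators form a standard basis. Points tw with w in ∇ and t < 1 are limits of such
weights, and the closure supplies the rest.

X₀° is the special fiber of the dual degeneration (`IsNefFan.mem_chartIdeal_iff`). At a tropical
point the minimum in the j-th equation is attained by a section other than m_j, so the facets
belonging to J_j° cover T. For an exponent outside the expected ideal, a point of T that avoids the
unwanted facets is the valuation of an explicit zero, found by a fixed point argument in power
series.

Lattice points of Ξ are free sections of the dual partition, and a section that is tight on suitable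
rays of one common cone lies in Ξ. On a chart, multiples of the equations of 𝔛° and the generators m
+ s ∑ b_α φ_α(m) therefore differ only by s times monomials of I₀°. Those lie in both ideals, so the
ideals agree (`IsGenerators.firstOrder_eq`).

Flatness over the principal ideal domain ℂ[s] means absence of torsion. In the universal family,
with indeterminate coefficients b, coprimality of the m_j makes s a nonzerodivisor. The equations
can be solved for coefficients, so the ideal is the kernel of a map to a domain, and it contains no
nonzero element of ℂ[b][s]. Two applications of generic freeness carry this over to the fiber at a
general b (`exists_generic_torsionFree`). -/

theorem toVec_injective : Function.Injective (toVec : Lat n → Vec n) := by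
  intro u v h
  funext i
  have := congrFun h i
  simpa [toVec] using this

theorem toVec_dotProduct (u v : Lat n) : toVec u ⬝ᵥ toVec v = ((u ⬝ᵥ v : ℤ) : ℝ) := by
  simp [dotProduct, toVec]

@[simp] theorem toVec_zero : toVec (0 : Lat n) = 0 := by
  funext i; simp [toVec]

theorem toVec_sum {ι : Type*} (s : Finset ι) (f : ι → Lat n) :
    toVec (∑ i ∈ s, f i) = ∑ i ∈ s, toVec (f i) := by
  funext i; simp [toVec]

theorem convex_le_dotProduct (w : Vec n) (c : ℝ) : Convex ℝ {x : Vec n | c ≤ x ⬝ᵥ w} := by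
  intro x hx y hy a b ha hb hab
  change c ≤ (a • x + b • y) ⬝ᵥ w
  rw [add_dotProduct, smul_dotProduct, smul_dotProduct, smul_eq_mul, smul_eq_mul]
  have h1 := mul_le_mul_of_nonneg_left hx ha
  have h2 := mul_le_mul_of_nonneg_left hy hb
  calc c = a * c + b * c := by rw [← add_mul, hab, one_mul]
    _ ≤ _ := add_le_add h1 h2

theorem le_dotProduct_of_mem_convexHull {S : Set (Vec n)} {w : Vec n} {c : ℝ}
    (h : ∀ s ∈ S, c ≤ s ⬝ᵥ w) {x : Vec n} (hx : x ∈ convexHull ℝ S) : c ≤ x ⬝ᵥ w :=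
  convexHull_min h (convex_le_dotProduct w c) hx

/-- A point of a convex hull on a face is in the convex hull of the generators on that face. -/
theorem mem_convexHull_face {S : Set (Vec n)} {w : Vec n} {c : ℝ}
    (h : ∀ s ∈ S, c ≤ s ⬝ᵥ w) {x : Vec n} (hx : x ∈ convexHull ℝ S) (hc : x ⬝ᵥ w = c) :
    x ∈ convexHull ℝ {s ∈ S | s ⬝ᵥ w = c} := by
  rw [mem_convexHull_iff_exists_fintype] at hx
  obtain ⟨ι, _, a, z, ha, ha1, hz, rfl⟩ := hx
  have hzero : ∀ i, a i * (z i ⬝ᵥ w - c) = 0 := by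
    have hs : ∑ i, a i * (z i ⬝ᵥ w - c) = 0 := by
      simp only [sum_dotProduct, smul_dotProduct, smul_eq_mul] at hc
      simp only [mul_sub, Finset.sum_sub_distrib, ← Finset.sum_mul, ha1, hc]
      ring
    intro i
    exact (Finset.sum_eq_zero_iff_of_nonneg (fun i _ =>
      mul_nonneg (ha i) (sub_nonneg.2 (h _ (hz i))))).1 hs i (Finset.mem_univ i)
  have hsum : ∑ i, a i • z i = ∑ i ∈ Finset.univ.filter (fun i => a i ≠ 0), a i • z i := by
    rw [Finset.sum_filter]
    refine Finset.sum_congr rfl fun i _ => ?_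
    by_cases h0 : a i = 0 <;> simp [h0]
  rw [hsum]
  refine (convex_convexHull ℝ _).sum_mem (fun i _ => ha i) ?_ ?_
  · rw [← ha1, Finset.sum_filter]
    refine Finset.sum_congr rfl fun i _ => ?_
    by_cases h0 : a i = 0 <;> simp [h0]
  · intro i hi
    have hi' : a i ≠ 0 := (Finset.mem_filter.1 hi).2
    refine subset_convexHull ℝ _ ⟨hz i, ?_⟩
    have := (mul_eq_zero.1 (hzero i)).resolve_left hi'
    linarith

theorem exists_mem_face {S : Set (Vec n)} {w : Vec n} {c : ℝ}
    (h : ∀ s ∈ S, c ≤ s ⬝ᵥ w) {x : Vec n} (hx : x ∈ convexHull ℝ S) (hc : x ⬝ᵥ w = c) :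
    ∃ s ∈ S, s ⬝ᵥ w = c := by
  obtain ⟨s, hs⟩ := convexHull_nonempty_iff.1 ⟨x, mem_convexHull_face h hx hc⟩
  exact ⟨s, hs⟩

/-- The same for finitely many faces. -/
theorem exists_mem_faces {S : Set (Vec n)} {ι : Type*} (s : Finset ι) (w : ι → Vec n) (c : ι → ℝ)
    (h : ∀ i ∈ s, ∀ p ∈ S, c i ≤ p ⬝ᵥ w i) {x : Vec n} (hx : x ∈ convexHull ℝ S)
    (hc : ∀ i ∈ s, x ⬝ᵥ w i = c i) : ∃ p ∈ S, ∀ i ∈ s, p ⬝ᵥ w i = c i := by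
  -- Add up the functionals: a point at which the sum is tight is tight for every summand, so a
  -- single face suffices.
  have h1 : ∀ p ∈ S, ∑ i ∈ s, c i ≤ p ⬝ᵥ ∑ i ∈ s, w i := by
    intro p hp
    rw [dotProduct_sum]
    exact Finset.sum_le_sum fun i hi => h i hi p hp
  have h2 : x ⬝ᵥ ∑ i ∈ s, w i = ∑ i ∈ s, c i := by
    rw [dotProduct_sum]
    exact Finset.sum_congr rfl hc
  obtain ⟨p, hp, hp2⟩ := exists_mem_face h1 hx h2
  refine ⟨p, hp, fun i hi => ?_⟩
  rw [dotProduct_sum, eq_comm] at hp2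
  exact ((Finset.sum_eq_sum_iff_of_le fun i hi => h i hi p hp).1 hp2 i hi).symm

theorem mem_convexHull_toVec {V : Finset (Lat n)} {x : Vec n} :
    x ∈ convexHull ℝ (toVec '' (V : Set (Lat n))) ↔
      ∃ a : Lat n → ℝ, (∀ r, 0 ≤ a r) ∧ ∑ r ∈ V, a r = 1 ∧ ∑ r ∈ V, a r • toVec r = x := by
  constructor
  · intro hx
    have hx' : x ∈ convexHull ℝ ((V.image toVec : Finset (Vec n)) : Set (Vec n)) := by
      rwa [Finset.coe_image]
    obtain ⟨w, h0, h1, h2⟩ := Finset.mem_convexHull'.1 hx'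
    rw [Finset.sum_image (fun _ _ _ _ h => toVec_injective h)] at h1 h2
    refine ⟨fun r => if r ∈ V then w (toVec r) else 0, fun r => ?_, ?_, ?_⟩
    · dsimp only
      split_ifs with hr
      · exact h0 _ (Finset.mem_image_of_mem _ hr)
      · exact le_rfl
    · rw [← h1]; exact Finset.sum_congr rfl fun r hr => by simp [hr]
    · rw [← h2]; exact Finset.sum_congr rfl fun r hr => by simp [hr]
  · rintro ⟨a, h0, h1, rfl⟩
    exact (convex_convexHull ℝ _).sum_mem (fun i _ => h0 i) h1
      fun i hi => subset_convexHull ℝ _ ⟨i, hi, rfl⟩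

theorem exists_dotProduct (f : StrongDual ℝ (Vec n)) : ∃ w : Vec n, ∀ x, f x = x ⬝ᵥ w := by
  refine ⟨fun i => f (Pi.single i 1), fun x => ?_⟩
  conv_lhs => rw [← Finset.univ_sum_single x]
  rw [map_sum]
  refine Finset.sum_congr rfl fun i _ => ?_
  have : (Pi.single i (x i) : Vec n) = x i • Pi.single i (1 : ℝ) := by
    rw [← Pi.single_smul]; simp
  rw [this, map_smul, smul_eq_mul]

theorem zero_mem_interior_exists_smul {P : Set (Vec n)} (h : (0 : Vec n) ∈ interior P) (w : Vec n) :
    ∃ δ : ℝ, 0 < δ ∧ δ • w ∈ P := by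
  have hc : Filter.Tendsto (fun δ : ℝ => δ • w) (nhds 0) (nhds 0) := by
    have : Continuous fun δ : ℝ => δ • w := by fun_prop
    simpa using this.tendsto 0
  have h1 := hc.eventually (mem_interior_iff_mem_nhds.1 h)
  have h2 := h1.filter_mono (nhdsWithin_le_nhds (s := Set.Ioi (0 : ℝ)))
  obtain ⟨δ, hδ, hδ'⟩ := (h2.and self_mem_nhdsWithin).exists
  exact ⟨δ, hδ', hδ⟩

theorem exists_pos_combination {V : Finset (Lat n)}
    (h : (0 : Vec n) ∈ interior (convexHull ℝ (toVec '' (V : Set (Lat n))))) (w : Vec n) :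
    ∃ e : Lat n → ℝ, (∀ r, 0 < e r) ∧ ∑ r ∈ V, e r • toVec r = w := by
  have key : ∀ w : Vec n, ∃ e : Lat n → ℝ, (∀ r, 0 ≤ e r) ∧ ∑ r ∈ V, e r • toVec r = w := by
    intro w
    obtain ⟨δ, hδ, hw⟩ := zero_mem_interior_exists_smul h w
    obtain ⟨a, h0, -, h2⟩ := mem_convexHull_toVec.1 hw
    refine ⟨fun r => δ⁻¹ * a r, fun r => mul_nonneg (inv_nonneg.2 hδ.le) (h0 r), ?_⟩
    simp only [mul_smul, ← Finset.smul_sum, h2]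
    rw [smul_smul, inv_mul_cancel₀ hδ.ne', one_smul]
  -- Subtracting the sum of all rays leaves room to add 1 to each coefficient, which makes them
  -- strictly positive.
  obtain ⟨e, he, hw⟩ := key (w - ∑ r ∈ V, toVec r)
  refine ⟨fun r => e r + 1, fun r => by linarith [he r], ?_⟩
  simp [add_smul, Finset.sum_add_distrib, hw]

/-- Characters are determined by their values on the rays. -/
theorem eq_of_dotProduct_eq {V : Finset (Lat n)}
    (h : (0 : Vec n) ∈ interior (convexHull ℝ (toVec '' (V : Set (Lat n))))) {u v : Lat n}
    (huv : ∀ r ∈ V, u ⬝ᵥ r = v ⬝ᵥ r) : u = v := by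
  apply toVec_injective
  rw [← sub_eq_zero, ← dotProduct_self_eq_zero]
  obtain ⟨e, -, he⟩ := exists_pos_combination h (toVec u - toVec v)
  conv_lhs => rw [← he]
  rw [he, ← he, dotProduct_sum]
  rw [he]
  refine Finset.sum_eq_zero fun r hr => ?_
  rw [dotProduct_smul, sub_dotProduct, toVec_dotProduct, toVec_dotProduct, huv r hr, sub_self,
    smul_zero]

theorem eq_zero_of_dotProduct_nonneg {V : Finset (Lat n)}
    (h : (0 : Vec n) ∈ interior (convexHull ℝ (toVec '' (V : Set (Lat n))))) {u : Vec n}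
    (hu : ∀ r ∈ V, 0 ≤ u ⬝ᵥ toVec r) : u = 0 := by
  obtain ⟨e, he0, he⟩ := exists_pos_combination h (-u)
  have h1 : 0 ≤ u ⬝ᵥ (-u) := by
    rw [← he, dotProduct_sum]
    refine Finset.sum_nonneg fun r hr => ?_
    rw [dotProduct_smul]
    exact mul_nonneg (he0 r).le (hu r hr)
  rw [← dotProduct_self_eq_zero]
  have h2 : 0 ≤ u ⬝ᵥ u := Finset.sum_nonneg fun i _ => mul_self_nonneg (u i)
  rw [dotProduct_neg] at h1
  linarith

/-- Completeness of the fan over the faces of `conv V`. -/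
theorem exists_cone {V : Finset (Lat n)}
    (h : (0 : Vec n) ∈ interior (convexHull ℝ (toVec '' (V : Set (Lat n))))) (w : Vec n) :
    ∃ τ, IsCone V τ ∧ ∃ a : Lat n → ℝ, (∀ r, 0 ≤ a r) ∧ ∑ r ∈ τ, a r • toVec r = w := by
  by_cases hw : w = 0
  · refine ⟨∅, ⟨0, fun r _ => by simp, ?_⟩, 0, fun r => le_rfl, by simp [hw]⟩
    rw [eq_comm, Finset.filter_eq_empty_iff]
    intro r _
    simp
  set P := convexHull ℝ (toVec '' (V : Set (Lat n))) with hP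
  have hcomp : IsCompact P := (V.finite_toSet.image toVec).isCompact_convexHull (𝕜 := ℝ)
  have hconv : Convex ℝ P := convex_convexHull ℝ _
  obtain ⟨δ, hδ, hδw⟩ := zero_mem_interior_exists_smul h w
  -- Leave P along the ray through w. At the last point μw a supporting hyperplane, scaled to the
  -- value -1, cuts out the face whose cone contains w.
  set K : Set ℝ := {t : ℝ | 0 ≤ t ∧ t • w ∈ P} with hK
  have hKne : K.Nonempty := ⟨δ, hδ.le, hδw⟩
  have hKclosed : IsClosed K := by
    refine IsClosed.inter isClosed_Ici ?_
    exact hcomp.isClosed.preimage (by fun_prop)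
  have hKbdd : BddAbove K := by
    obtain ⟨C, hC⟩ := hcomp.isBounded.exists_norm_le
    refine ⟨C / ‖w‖, fun t ht => ?_⟩
    rw [le_div_iff₀ (norm_pos_iff.2 hw)]
    have := hC _ ht.2
    rwa [norm_smul, Real.norm_of_nonneg ht.1] at this
  set μ := sSup K with hμ
  have hμK : μ ∈ K := hKclosed.csSup_mem hKne hKbdd
  have hμpos : 0 < μ := hδ.trans_le (le_csSup hKbdd ⟨hδ.le, hδw⟩)
  have hnot : μ • w ∉ interior P := by
    intro hin
    have hc : Filter.Tendsto (fun t : ℝ => t • w) (nhds μ) (nhds (μ • w)) := by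
      have : Continuous fun δ : ℝ => δ • w := by fun_prop
      exact this.tendsto μ
    have h1 := hc.eventually (mem_interior_iff_mem_nhds.1 hin)
    have h2 := h1.filter_mono (nhdsWithin_le_nhds (s := Set.Ioi μ))
    obtain ⟨t, ht, ht'⟩ := (h2.and self_mem_nhdsWithin).exists
    have : t ≤ μ := le_csSup hKbdd ⟨hμpos.le.trans (le_of_lt ht'), ht⟩
    exact absurd ht' (not_lt.2 this)
  obtain ⟨f, hf⟩ := geometric_hahn_banach_open_point hconv.interior isOpen_interior hnot
  obtain ⟨m, hm⟩ := exists_dotProduct f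
  have hfx : 0 < f (μ • w) := by simpa using hf 0 h
  have hle : ∀ p ∈ P, f p ≤ f (μ • w) := by
    have hcl : closure (interior P) = P := by
      rw [hconv.closure_interior_eq_closure_of_nonempty_interior ⟨0, h⟩, hcomp.isClosed.closure_eq]
    intro p hp
    rw [← hcl] at hp
    exact closure_minimal (fun q hq => (hf q hq).le) (isClosed_le f.continuous continuous_const) hp
  set m' : Vec n := (-(f (μ • w))⁻¹) • m with hm'
  have hm'v : ∀ p, p ⬝ᵥ m' = -(f (μ • w))⁻¹ * f p := by
    intro p
    rw [hm', dotProduct_smul, smul_eq_mul, hm p]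
  have hge : ∀ p ∈ P, -1 ≤ p ⬝ᵥ m' := by
    intro p hp
    rw [hm'v, neg_mul, neg_le_neg_iff, inv_mul_le_iff₀ hfx, mul_one]
    exact hle p hp
  have hx : (μ • w) ⬝ᵥ m' = -1 := by
    rw [hm'v, neg_mul, inv_mul_cancel₀ hfx.ne']
  refine ⟨V.filter (fun r => toVec r ⬝ᵥ m' = -1),
    ⟨m', fun r hr => hge _ (subset_convexHull ℝ _ ⟨r, hr, rfl⟩), rfl⟩, ?_⟩
  have hface := mem_convexHull_face (c := -1) (w := m')
    (fun s hs => hge s (subset_convexHull ℝ _ hs)) hμK.2 hx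
  have hset : {s ∈ toVec '' (V : Set (Lat n)) | s ⬝ᵥ m' = -1} =
      toVec '' ((V.filter (fun r => toVec r ⬝ᵥ m' = -1) : Finset (Lat n)) : Set (Lat n)) := by
    ext s
    constructor
    · rintro ⟨⟨r, hr, rfl⟩, hs⟩
      exact ⟨r, by simpa using ⟨hr, hs⟩, rfl⟩
    · rintro ⟨r, hr, rfl⟩
      have hr' : r ∈ V ∧ toVec r ⬝ᵥ m' = -1 := by simpa using hr
      exact ⟨⟨r, hr'.1, rfl⟩, hr'.2⟩
  rw [hset] at hface
  obtain ⟨a, h0, -, h2⟩ := mem_convexHull_toVec.1 hface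
  refine ⟨fun r => μ⁻¹ * a r, fun r => mul_nonneg (inv_nonneg.2 hμpos.le) (h0 r), ?_⟩
  simp only [mul_smul, ← Finset.smul_sum, h2]
  rw [smul_smul, inv_mul_cancel₀ hμpos.ne', one_smul]

/-! ### Duality -/

theorem dual_convexHull (S : Set (Vec n)) : dual (convexHull ℝ S) = dual S := by
  ext v
  exact ⟨fun h m hm => h m (subset_convexHull ℝ _ hm), fun h m hm =>
    le_dotProduct_of_mem_convexHull h hm⟩

/-- The bipolar theorem. Since 0 ∈ P, the constant of a separating functional is positive and can be
scaled to 1. -/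
theorem dual_dual {P : Set (Vec n)} (hc : Convex ℝ P) (hcl : IsClosed P) (h0 : 0 ∈ P) :
    dual (dual P) = P := by
  apply Set.Subset.antisymm
  · intro x hx
    by_contra hxP
    obtain ⟨f, u, h1, h2⟩ := geometric_hahn_banach_closed_point hc hcl hxP
    obtain ⟨m, hm⟩ := exists_dotProduct f
    have hu : 0 < u := by simpa using h1 0 h0
    have hmem : (-u⁻¹) • m ∈ dual P := by
      intro p hp
      rw [dotProduct_smul, smul_eq_mul, ← hm, neg_mul, neg_le_neg_iff, inv_mul_le_iff₀ hu, mul_one]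
      exact (h1 p hp).le
    have := hx _ hmem
    rw [dotProduct_comm, dotProduct_smul, smul_eq_mul, ← hm, neg_mul, neg_le_neg_iff,
      inv_mul_le_iff₀ hu, mul_one] at this
    linarith
  · intro x hx m hm
    rw [dotProduct_comm]
    exact hm x hx

theorem zero_mem_interior_dual {P : Set (Vec n)} (hP : Bornology.IsBounded P) :
    (0 : Vec n) ∈ interior (dual P) := by
  obtain ⟨C, hC0, hC⟩ := hP.exists_pos_norm_le
  rw [mem_interior_iff_mem_nhds, Metric.mem_nhds_iff]
  -- In the sup norm |⟨m, v⟩| ≤ n C ‖v‖; using n + 1 keeps the radius positive for n = 0.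
  refine ⟨1 / (C * (n + 1)), by positivity, fun v hv m hm => ?_⟩
  rw [mem_ball_zero_iff] at hv
  have h1 : |m ⬝ᵥ v| ≤ ∑ _i : Fin n, C * (1 / (C * (n + 1))) := by
    refine (Finset.abs_sum_le_sum_abs _ _).trans (Finset.sum_le_sum fun i _ => ?_)
    rw [abs_mul]
    have a1 : |m i| ≤ C := (norm_le_pi_norm m i).trans (hC m hm)
    have a2 : |v i| ≤ 1 / (C * (n + 1)) := (norm_le_pi_norm v i).trans hv.le
    exact mul_le_mul a1 a2 (abs_nonneg _) hC0.le
  have h2 : ∑ _i : Fin n, C * (1 / (C * (n + 1))) ≤ 1 := by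
    simp only [Finset.sum_const, Finset.card_univ, Fintype.card_fin, nsmul_eq_mul]
    have : (n : ℝ) * (C * (1 / (C * (n + 1)))) = n / (n + 1) := by field_simp
    rw [this, div_le_one (by positivity)]
    linarith
  linarith [neg_le_of_abs_le (h1.trans h2)]

theorem isBounded_dual {P : Set (Vec n)} (hP : (0 : Vec n) ∈ interior P) :
    Bornology.IsBounded (dual P) := by
  rw [mem_interior_iff_mem_nhds, Metric.mem_nhds_iff] at hP
  obtain ⟨δ, hδ, hb⟩ := hP
  rw [isBounded_iff_forall_norm_le]
  refine ⟨2 / δ, fun v hv => ?_⟩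
  rw [pi_norm_le_iff_of_nonneg (by positivity)]
  intro i
  have key : ∀ s : ℝ, |s| = δ / 2 → -1 ≤ s * v i := by
    intro s hs
    have hmem : (Pi.single i s : Vec n) ∈ P := by
      apply hb
      rw [mem_ball_zero_iff]
      refine lt_of_le_of_lt ((pi_norm_le_iff_of_nonneg (by positivity : 0 ≤ δ / 2)).2 ?_)
        (by linarith : δ / 2 < δ)
      intro k
      by_cases hk : k = i
      · subst hk; simp [hs]
      · simp [hk]; positivity
    have := hv _ hmem
    rwa [single_dotProduct] at this
  have k1 := key (δ / 2) (abs_of_pos (by positivity))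
  have k2 := key (-(δ / 2)) (by rw [abs_neg]; exact abs_of_pos (by positivity))
  rw [Real.norm_eq_abs, abs_le]
  constructor
  · rw [neg_le, ← sub_nonneg]
    have : 2 / δ - -v i = (2 / δ) * (1 + δ / 2 * v i) := by field_simp; ring
    rw [this]; apply mul_nonneg (by positivity); linarith
  · rw [← sub_nonneg]
    have : 2 / δ - v i = (2 / δ) * (1 + -(δ / 2) * v i) := by field_simp; ring
    rw [this]; apply mul_nonneg (by positivity); linarith

/-! ### Lattice polytopes -/

theorem IsLatticePolytope.isCompact {P : Set (Vec n)} (h : IsLatticePolytope P) : IsCompact P := by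
  obtain ⟨F, rfl⟩ := h
  exact (F.finite_toSet.image toVec).isCompact_convexHull (𝕜 := ℝ)

theorem IsLatticePolytope.convex {P : Set (Vec n)} (h : IsLatticePolytope P) : Convex ℝ P := by
  obtain ⟨F, rfl⟩ := h
  exact convex_convexHull ℝ _

theorem extremePoints_lattice {S : Set (Lat n)} {x : Vec n}
    (hx : x ∈ (convexHull ℝ (toVec '' S)).extremePoints ℝ) : ∃ u ∈ S, toVec u = x := by
  obtain ⟨u, hu, h⟩ := extremePoints_convexHull_subset hx
  exact ⟨u, hu, h⟩

theorem mem_verts {P : Set (Vec n)} (h : IsLatticePolytope P) {v : Lat n} :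
    v ∈ verts P ↔ toVec v ∈ P.extremePoints ℝ := by
  obtain ⟨F, rfl⟩ := h
  have hfin : {v : Lat n | toVec v ∈
      (convexHull ℝ (toVec '' (F : Set (Lat n)))).extremePoints ℝ}.Finite := by
    refine F.finite_toSet.subset fun v hv => ?_
    obtain ⟨u, hu, huv⟩ := extremePoints_lattice hv
    rwa [← toVec_injective huv]
  rw [verts, dif_pos hfin]
  simp

/-- Krein–Milman; a lattice polytope has finitely many extreme points, so no closure is needed. -/
theorem convexHull_of_extremePoints_lattice {P : Set (Vec n)} (h : IsLatticePolytope P)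
    {S : Set (Vec n)} (hS : P.extremePoints ℝ ⊆ S) (hSP : S ⊆ P) : convexHull ℝ S = P := by
  apply Set.Subset.antisymm (convexHull_min hSP h.convex)
  have h1 := closure_convexHull_extremePoints h.isCompact h.convex
  have hfin : (P.extremePoints ℝ).Finite := by
    obtain ⟨F, rfl⟩ := h
    refine (F.finite_toSet.image toVec).subset fun v hv => ?_
    obtain ⟨u, hu, huv⟩ := extremePoints_lattice hv
    exact ⟨u, hu, huv⟩
  rw [(hfin.isCompact_convexHull (𝕜 := ℝ)).isClosed.closure_eq] at h1
  rw [← h1]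
  exact convexHull_mono hS

theorem convexHull_verts {P : Set (Vec n)} (h : IsLatticePolytope P) :
    convexHull ℝ (toVec '' (verts P : Set (Lat n))) = P := by
  refine convexHull_of_extremePoints_lattice h ?_ ?_
  · intro x hx
    obtain ⟨F, rfl⟩ := id h
    obtain ⟨u, -, rfl⟩ := extremePoints_lattice hx
    exact ⟨u, (mem_verts h).2 hx, rfl⟩
  · rintro x ⟨u, hu, rfl⟩
    exact ((mem_verts h).1 hu).1

theorem finite_lattice_of_isBounded {P : Set (Vec n)} (h : Bornology.IsBounded P) :
    {u : Lat n | toVec u ∈ P}.Finite := by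
  obtain ⟨C, hC⟩ := h.exists_norm_le
  refine (Set.finite_Icc (fun _ : Fin n => -⌈C⌉) (fun _ => ⌈C⌉)).subset fun u hu => ?_
  have hle : ∀ i, |(u i : ℝ)| ≤ C := fun i => (norm_le_pi_norm (toVec u) i).trans (hC _ hu)
  constructor
  · intro i
    have := neg_le_of_abs_le (hle i)
    have h2 := Int.le_ceil C
    have : -(⌈C⌉ : ℝ) ≤ (u i : ℝ) := by linarith
    exact_mod_cast this
  · intro i
    have := le_of_abs_le (hle i)
    have h2 := Int.le_ceil C
    have : (u i : ℝ) ≤ (⌈C⌉ : ℝ) := by linarith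
    exact_mod_cast this

end Convex

/-! ### Nef partitions and Batyrev-Borisov duality -/

section BB
variable {n c : ℕ} {V : Finset (Lat n)} {J : Fin c → Finset (Lat n)}

/-- `∇_j = conv ({0} ∪ J_j)`. -/
def nablaPart (J : Fin c → Finset (Lat n)) (j : Fin c) : Set (Vec n) :=
  convexHull ℝ (toVec '' ((insert 0 (J j) : Finset (Lat n)) : Set (Lat n)))

/-- The hypotheses on the fan over the faces of `conv V` and the partition `J` used throughout. -/
structure IsNefFan (V : Finset (Lat n)) (J : Fin c → Finset (Lat n)) : Prop where
  interior : (0 : Vec n) ∈ interior (convexHull ℝ (toVec '' (V : Set (Lat n))))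
  nef : IsNefPartition V J

theorem le_of_mem_sectionPolytope {D : Finset (Lat n)} {x : Vec n} (hx : x ∈ sectionPolytope V D)
    {r : Lat n} (hr : r ∈ V) : (if r ∈ D then -1 else 0 : ℝ) ≤ x ⬝ᵥ toVec r := by
  refine le_dotProduct_of_mem_convexHull ?_ hx
  rintro _ ⟨u, hu, rfl⟩
  rw [toVec_dotProduct]
  have := hu r hr
  have h2 : (((if r ∈ D then -1 else 0 : ℤ)) : ℝ) ≤ ((u ⬝ᵥ r : ℤ) : ℝ) := by exact_mod_cast this
  refine le_trans (le_of_eq ?_) h2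
  split_ifs <;> simp

theorem toVec_mem_sectionPolytope {D : Finset (Lat n)} {u : Lat n} (hu : u ∈ divSections V D) :
    toVec u ∈ sectionPolytope V D :=
  subset_convexHull ℝ _ ⟨u, hu, rfl⟩

theorem mem_divSections_of_toVec_mem {D : Finset (Lat n)} {u : Lat n}
    (hu : toVec u ∈ sectionPolytope V D) : u ∈ divSections V D := by
  intro r hr
  have := le_of_mem_sectionPolytope hu hr
  rw [toVec_dotProduct] at this
  have h2 : (((if r ∈ D then -1 else 0 : ℤ)) : ℝ) ≤ ((u ⬝ᵥ r : ℤ) : ℝ) := by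
    refine le_trans (le_of_eq ?_) this
    split_ifs <;> simp
  exact_mod_cast h2

theorem zero_mem_divSections (D : Finset (Lat n)) : (0 : Lat n) ∈ divSections V D := by
  intro r _
  rw [zero_dotProduct]
  split_ifs <;> simp

theorem IsNefPartition.mem_part_iff (hJ : IsNefPartition V J) {r : Lat n} {j k : Fin c}
    (hr : r ∈ J j) : r ∈ J k ↔ j = k := by
  constructor
  · intro hk
    by_contra hne
    exact Finset.disjoint_left.1 (hJ.disjoint j k hne) hr hk
  · rintro rfl; exact hr

theorem IsNefPartition.subset (hJ : IsNefPartition V J) (j : Fin c) : J j ⊆ V := by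
  rw [← hJ.union]
  exact Finset.subset_biUnion_of_mem J (Finset.mem_univ j)

theorem IsNefPartition.exists_part (hJ : IsNefPartition V J) {r : Lat n} (hr : r ∈ V) :
    ∃ j, r ∈ J j := by
  rw [← hJ.union] at hr
  simpa using hr

theorem IsNefPartition.sum_eq {M : Type*} [AddCommMonoid M] (hJ : IsNefPartition V J)
    (f : Lat n → M) : ∑ r ∈ V, f r = ∑ j, ∑ r ∈ J j, f r := by
  conv_lhs => rw [← hJ.union]
  exact Finset.sum_biUnion fun j _ k _ hjk => hJ.disjoint j k hjk

theorem zero_mem_nablaPart (j : Fin c) : (0 : Vec n) ∈ nablaPart J j :=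
  subset_convexHull ℝ _ ⟨0, by simp, toVec_zero⟩

theorem toVec_mem_nablaPart {j : Fin c} {r : Lat n} (hr : r ∈ J j) : toVec r ∈ nablaPart J j :=
  subset_convexHull ℝ _ ⟨r, by simp [hr], rfl⟩

/-- These inequalities between Δ_k and ∇_j are the symmetric core of the duality. -/
theorem pairing (hJ : IsNefPartition V J) {j k : Fin c} {x y : Vec n}
    (hx : x ∈ sectionPolytope V (J k)) (hy : y ∈ nablaPart J j) :
    (if k = j then -1 else 0 : ℝ) ≤ x ⬝ᵥ y := by
  rw [dotProduct_comm]
  refine le_dotProduct_of_mem_convexHull ?_ hy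
  rintro _ ⟨r, hr, rfl⟩
  rw [Finset.mem_coe, Finset.mem_insert] at hr
  rcases hr with rfl | hr
  · rw [toVec_zero, zero_dotProduct]
    split_ifs <;> simp
  · rw [dotProduct_comm]
    have := le_of_mem_sectionPolytope hx (hJ.subset j hr)
    simpa only [hJ.mem_part_iff hr, eq_comm (a := j)] using this

theorem pairing_int (hJ : IsNefPartition V J) {j k : Fin c} {u r : Lat n}
    (hu : u ∈ divSections V (J k)) (hr : toVec r ∈ nablaPart J j) :
    (if k = j then -1 else 0 : ℤ) ≤ u ⬝ᵥ r := by
  have := pairing hJ (toVec_mem_sectionPolytope hu) hr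
  rw [toVec_dotProduct] at this
  have h2 : (((if k = j then -1 else 0 : ℤ)) : ℝ) ≤ ((u ⬝ᵥ r : ℤ) : ℝ) := by
    refine le_trans (le_of_eq ?_) this
    split_ifs <;> simp
  exact_mod_cast h2

/-- Every vector decomposes along a cone on which all `E_k` have local generators. -/
theorem IsNefFan.exists_decomposition (h : IsNefFan V J) (w : Vec n) :
    ∃ τ, IsCone V τ ∧ ∃ e : Lat n → ℝ, (∀ r, 0 ≤ e r) ∧ (∀ r, r ∉ τ → e r = 0) ∧
      ∑ k, ∑ r ∈ J k, e r • toVec r = w ∧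
      ∀ k, ∃ u ∈ divSections V (J k), (∀ r ∈ τ, u ⬝ᵥ r = if r ∈ J k then -1 else 0) ∧
        toVec u ⬝ᵥ w = -∑ r ∈ J k, e r := by
  obtain ⟨τ, hτ, a, ha, hw⟩ := exists_cone h.interior w
  have hτV : τ ⊆ V := by
    obtain ⟨m, -, rfl⟩ := hτ
    exact Finset.filter_subset _ _
  refine ⟨τ, hτ, fun r => if r ∈ τ then a r else 0, fun r => ?_, fun r hr => by simp [hr], ?_, ?_⟩
  · dsimp only
    split_ifs
    · exact ha r
    · exact le_rfl
  · rw [← h.nef.sum_eq (fun r => (if r ∈ τ then a r else 0) • toVec r), ← hw]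
    rw [← Finset.sum_subset hτV]
    · exact Finset.sum_congr rfl fun r hr => by simp [hr]
    · intro r _ hr
      simp [hr]
  · intro k
    -- A local generator is -1 on the rays of τ in J_k and 0 on the others, so its value at w is
    -- minus the mass of w along J_k.
    obtain ⟨u, hu, hur⟩ := h.nef.generated k τ hτ
    refine ⟨u, hu, hur, ?_⟩
    rw [← hw, dotProduct_sum]
    have h1 : ∀ r ∈ τ, toVec u ⬝ᵥ a r • toVec r = if r ∈ J k then -a r else 0 := by
      intro r hr
      rw [dotProduct_smul, toVec_dotProduct, hur r hr]
      split_ifs <;> simp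
    rw [Finset.sum_congr rfl h1, ← Finset.sum_filter, Finset.sum_neg_distrib, ← Finset.sum_filter]
    congr 1
    refine Finset.sum_congr ?_ fun _ _ => rfl
    ext r
    simp [and_comm]

theorem sum_mem_nablaPart {k : Fin c} {e : Lat n → ℝ} (he : ∀ r, 0 ≤ e r)
    (h1 : ∑ r ∈ J k, e r ≤ 1) : ∑ r ∈ J k, e r • toVec r ∈ nablaPart J k := by
  have h := (convex_convexHull ℝ (toVec '' ((insert 0 (J k) : Finset (Lat n)) : Set (Lat n)))).sum_mem
    (t := (Finset.univ : Finset (Option (J k))))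
    (w := fun o => o.elim (1 - ∑ r ∈ J k, e r) fun r => e r)
    (z := fun o => o.elim 0 fun r => toVec (r : Lat n)) ?_ ?_ ?_
  · rw [Fintype.sum_option] at h
    simp only [Option.elim, smul_zero, zero_add] at h
    rw [Finset.sum_coe_sort (J k) (fun r => e r • toVec r)] at h
    exact h
  · rintro (_ | r) _
    · simpa using h1
    · exact he r
  · rw [Fintype.sum_option]
    simp only [Option.elim]
    rw [Finset.sum_coe_sort (J k) (fun r => e r)]
    ring
  · rintro (_ | r) _
    · exact zero_mem_nablaPart k
    · exact toVec_mem_nablaPart r.2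

/-- The converse of `pairing`. Tested on local generators, the inequalities bound the mass of w
along J_j by 1 and force it to vanish along every other part. -/
theorem IsNefFan.mem_nablaPart (h : IsNefFan V J) {j : Fin c} {w : Vec n}
    (hw : ∀ k, ∀ u ∈ divSections V (J k), (if k = j then -1 else 0 : ℝ) ≤ toVec u ⬝ᵥ w) :
    w ∈ nablaPart J j := by
  obtain ⟨τ, -, e, he0, -, hew, hu⟩ := h.exists_decomposition w
  have hle : ∀ k, ∑ r ∈ J k, e r ≤ if k = j then 1 else 0 := by
    intro k
    obtain ⟨u, hu, -, huw⟩ := hu k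
    have := hw k u hu
    rw [huw] at this
    split_ifs at this ⊢ <;> linarith
  rw [← hew, Finset.sum_eq_single j]
  · exact sum_mem_nablaPart he0 (by simpa using hle j)
  · intro k _ hk
    have h0 : ∑ r ∈ J k, e r = 0 := le_antisymm (by simpa [hk] using hle k)
      (Finset.sum_nonneg fun r _ => he0 r)
    refine Finset.sum_eq_zero fun r hr => ?_
    rw [(Finset.sum_eq_zero_iff_of_nonneg fun r _ => he0 r).1 h0 r hr, zero_smul]
  · simp

theorem zero_mem_sectionPolytope (D : Finset (Lat n)) : (0 : Vec n) ∈ sectionPolytope V D := by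
  rw [← toVec_zero]
  exact toVec_mem_sectionPolytope (zero_mem_divSections D)

theorem sectionPolytope_subset_nablaDual (j : Fin c) :
    sectionPolytope V (J j) ⊆ nablaDual V J :=
  (Set.subset_iUnion (fun j => sectionPolytope V (J j)) j).trans (subset_convexHull ℝ _)

theorem mem_dual_nablaDual {w : Vec n} : w ∈ dual (nablaDual V J) ↔
    ∀ k, ∀ u ∈ divSections V (J k), -1 ≤ toVec u ⬝ᵥ w := by
  constructor
  · intro hw k u hu
    exact hw _ (sectionPolytope_subset_nablaDual k (toVec_mem_sectionPolytope hu))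
  · intro hw
    rw [nablaDual, dual_convexHull]
    intro m hm
    obtain ⟨k, hk⟩ := Set.mem_iUnion.1 hm
    refine le_dotProduct_of_mem_convexHull ?_ hk
    rintro _ ⟨u, hu, rfl⟩
    exact hw k u hu

/-- `∇ = ∇_1 + … + ∇_c`. -/
theorem IsNefFan.mem_dual_nablaDual_iff (h : IsNefFan V J) {w : Vec n} :
    w ∈ dual (nablaDual V J) ↔ ∃ v : Fin c → Vec n, (∀ k, v k ∈ nablaPart J k) ∧ ∑ k, v k = w := by
  rw [mem_dual_nablaDual]
  constructor
  · intro hw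
    obtain ⟨τ, -, e, he0, -, hew, hu⟩ := h.exists_decomposition w
    refine ⟨fun k => ∑ r ∈ J k, e r • toVec r, fun k => sum_mem_nablaPart he0 ?_, hew⟩
    obtain ⟨u, hu, -, huw⟩ := hu k
    have := hw k u hu
    rw [huw] at this
    linarith
  · rintro ⟨v, hv, rfl⟩ k u hu
    rw [dotProduct_sum]
    calc (-1 : ℝ) = ∑ j, if k = j then -1 else 0 := by simp
      _ ≤ _ := Finset.sum_le_sum fun j _ => pairing h.nef (toVec_mem_sectionPolytope hu) (hv j)

/-- If a point of `Δ_j` takes the value `-1` on `∑ v_k`, then its values on the `v_k` are known. -/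
theorem values_of_eq_neg_one (hJ : IsNefPartition V J) {v : Fin c → Vec n}
    (hv : ∀ k, v k ∈ nablaPart J k) {j : Fin c} {x : Vec n} (hx : x ∈ sectionPolytope V (J j))
    (h1 : x ⬝ᵥ ∑ k, v k = -1) (k : Fin c) : x ⬝ᵥ v k = if j = k then -1 else 0 := by
  have h2 : ∑ k, (if j = k then -1 else 0 : ℝ) = ∑ k, x ⬝ᵥ v k := by
    rw [← dotProduct_sum, h1]; simp
  exact ((Finset.sum_eq_sum_iff_of_le fun k _ => pairing hJ hx (hv k)).1 h2 k
    (Finset.mem_univ k)).symm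

/-- The lattice points generating `∇`. -/
def nablaGenerators (J : Fin c → Finset (Lat n)) : Finset (Lat n) :=
  (Fintype.piFinset fun j => insert 0 (J j)).image fun v => ∑ j, v j

open scoped Pointwise in
-- Convex hulls commute with Minkowski sums. This exhibits ∇ as a lattice polytope, which is what
-- reflexivity needs.
theorem IsNefFan.dual_nablaDual_eq (h : IsNefFan V J) :
    dual (nablaDual V J) = convexHull ℝ (toVec '' (nablaGenerators J : Set (Lat n))) := by
  have h1 : toVec '' (nablaGenerators J : Set (Lat n)) =
      ∑ j, toVec '' ((insert 0 (J j) : Finset (Lat n)) : Set (Lat n)) := by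
    ext x
    rw [Set.mem_fintype_sum]
    constructor
    · rintro ⟨u, hu, rfl⟩
      rw [nablaGenerators, Finset.mem_coe, Finset.mem_image] at hu
      obtain ⟨v, hv, rfl⟩ := hu
      rw [Fintype.mem_piFinset] at hv
      exact ⟨fun j => toVec (v j), fun j => ⟨v j, hv j, rfl⟩, (toVec_sum _ _).symm⟩
    · rintro ⟨g, hg, rfl⟩
      choose v hv hvg using hg
      refine ⟨∑ j, v j, ?_, ?_⟩
      · rw [nablaGenerators, Finset.mem_coe, Finset.mem_image]
        exact ⟨v, Fintype.mem_piFinset.2 hv, rfl⟩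
      · rw [toVec_sum]
        exact Finset.sum_congr rfl fun j _ => hvg j
  ext w
  rw [h.mem_dual_nablaDual_iff, h1, convexHull_sum, Set.mem_fintype_sum]
  constructor
  · rintro ⟨v, hv, hw⟩
    exact ⟨v, hv, hw⟩
  · rintro ⟨v, hv, hw⟩
    exact ⟨v, hv, hw⟩

theorem finite_divSections
    (h : (0 : Vec n) ∈ interior (convexHull ℝ (toVec '' (V : Set (Lat n))))) (D : Finset (Lat n)) :
    (divSections V D).Finite := by
  refine (finite_lattice_of_isBounded (isBounded_dual h)).subset fun u hu => ?_
  change toVec u ∈ dual _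
  rw [dual_convexHull]
  rintro _ ⟨r, hr, rfl⟩
  rw [dotProduct_comm, toVec_dotProduct]
  have := hu r hr
  have h2 : (-1 : ℤ) ≤ u ⬝ᵥ r := le_trans (by split_ifs <;> simp) this
  exact_mod_cast h2

theorem isLatticePolytope_sectionPolytope
    (h : (0 : Vec n) ∈ interior (convexHull ℝ (toVec '' (V : Set (Lat n))))) (D : Finset (Lat n)) :
    IsLatticePolytope (sectionPolytope V D) :=
  ⟨(finite_divSections h D).toFinset, by rw [Set.Finite.coe_toFinset, sectionPolytope]⟩

theorem IsNefFan.isLatticePolytope_nablaDual (h : IsNefFan V J) :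
    IsLatticePolytope (nablaDual V J) := by
  refine ⟨Finset.univ.biUnion fun j => (finite_divSections h.interior (J j)).toFinset, ?_⟩
  apply Set.Subset.antisymm
  · refine convexHull_min (Set.iUnion_subset fun j => convexHull_mono ?_) (convex_convexHull ℝ _)
    apply Set.image_mono
    intro u hu
    simp only [Finset.coe_biUnion, Set.mem_iUnion]
    exact ⟨j, by simp, by simpa using hu⟩
  · refine convexHull_mono ?_
    rintro _ ⟨u, hu, rfl⟩
    simp only [Finset.coe_biUnion, Set.mem_iUnion] at hu
    obtain ⟨j, -, hj⟩ := hu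
    exact Set.mem_iUnion.2 ⟨j, toVec_mem_sectionPolytope (by simpa using hj)⟩

theorem IsNefFan.isLatticePolytope_dual_nablaDual (h : IsNefFan V J) :
    IsLatticePolytope (dual (nablaDual V J)) :=
  ⟨nablaGenerators J, h.dual_nablaDual_eq⟩

theorem zero_mem_nablaDual (j : Fin c) : (0 : Vec n) ∈ nablaDual V J :=
  sectionPolytope_subset_nablaDual j (zero_mem_sectionPolytope _)

theorem IsNefFan.dual_dual_nablaDual (h : IsNefFan V J) (j : Fin c) :
    dual (dual (nablaDual V J)) = nablaDual V J :=
  dual_dual h.isLatticePolytope_nablaDual.convex h.isLatticePolytope_nablaDual.isCompact.isClosed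
    (zero_mem_nablaDual j)

theorem IsNefFan.isReflexive (h : IsNefFan V J) (j : Fin c) :
    IsReflexive (dual (nablaDual V J)) where
  lattice := h.isLatticePolytope_dual_nablaDual
  dual_lattice := by
    rw [h.dual_dual_nablaDual j]
    exact h.isLatticePolytope_nablaDual
  zero_mem := zero_mem_interior_dual h.isLatticePolytope_nablaDual.isCompact.isBounded
  zero_mem_dual := zero_mem_interior_dual h.isLatticePolytope_dual_nablaDual.isCompact.isBounded

theorem IsNefFan.interior_verts (h : IsNefFan V J) (j : Fin c) :
    (0 : Vec n) ∈ _root_.interior (convexHull ℝ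
      (toVec '' (verts (nablaDual V J) : Set (Lat n)))) := by
  rw [convexHull_verts h.isLatticePolytope_nablaDual, ← h.dual_dual_nablaDual j]
  exact (h.isReflexive j).zero_mem_dual

/-- A nonzero vertex of Δ_j is negative on some ray r; then its value there is -1 and r ∈ J_j. No
other Δ_k reaches -1 on r, so the face of ∇* where r takes the value -1 lies in Δ_j, and vertices of
Δ_j on it are vertices of ∇*. -/
theorem IsNefFan.extremePoints_subset (h : IsNefFan V J) {j : Fin c} {x : Vec n}
    (hx : x ∈ (sectionPolytope V (J j)).extremePoints ℝ) (h0 : x ≠ 0) :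
    x ∈ (nablaDual V J).extremePoints ℝ := by
  obtain ⟨u, hu, rfl⟩ := extremePoints_lattice hx
  have hex : ∃ r ∈ V, u ⬝ᵥ r < 0 := by
    by_contra hcon
    push Not at hcon
    apply h0
    refine eq_zero_of_dotProduct_nonneg h.interior fun r hr => ?_
    rw [toVec_dotProduct]
    exact_mod_cast hcon r hr
  obtain ⟨r, hr, hur⟩ := hex
  have hur' := hu r hr
  have hrJ : r ∈ J j := by
    by_contra hrJ
    rw [if_neg hrJ] at hur'
    omega
  rw [if_pos hrJ] at hur'
  have hval : toVec u ⬝ᵥ toVec r = -1 := by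
    rw [toVec_dotProduct, show u ⬝ᵥ r = -1 by omega]; simp
  have hge : ∀ s ∈ ⋃ j, sectionPolytope V (J j), -1 ≤ s ⬝ᵥ toVec r := by
    intro s hs
    obtain ⟨k, hk⟩ := Set.mem_iUnion.1 hs
    exact le_trans (by split_ifs <;> simp) (le_of_mem_sectionPolytope hk hr)
  have hface : ∀ y ∈ nablaDual V J, y ⬝ᵥ toVec r = -1 → y ∈ sectionPolytope V (J j) := by
    intro y hy hyr
    have := mem_convexHull_face hge hy hyr
    refine convexHull_min ?_ (convex_convexHull ℝ _) this
    rintro s ⟨hs, hsr⟩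
    obtain ⟨k, hk⟩ := Set.mem_iUnion.1 hs
    have h2 := le_of_mem_sectionPolytope hk hr
    simp only [hsr, h.nef.mem_part_iff hrJ] at h2
    by_cases hjk : j = k
    · exact hjk ▸ hk
    · rw [if_neg hjk] at h2; norm_num at h2
  rw [mem_extremePoints] at hx ⊢
  refine ⟨sectionPolytope_subset_nablaDual j hx.1, fun y hy z hz hyz => ?_⟩
  have hy1 := le_dotProduct_of_mem_convexHull hge hy
  have hz1 := le_dotProduct_of_mem_convexHull hge hz
  obtain ⟨a, b, ha, hb, hab, hyz'⟩ := id hyz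
  have hsum : a * (y ⬝ᵥ toVec r) + b * (z ⬝ᵥ toVec r) = -1 := by
    rw [← hval, ← hyz', add_dotProduct, smul_dotProduct, smul_dotProduct, smul_eq_mul, smul_eq_mul]
  have hy2 : y ⬝ᵥ toVec r = -1 := by nlinarith
  have hz2 : z ⬝ᵥ toVec r = -1 := by nlinarith
  exact hx.2 y (hface y hy hy2) z (hface z hz hz2) hyz

theorem zero_not_mem_extremePoints (hn : 0 < n) {P : Set (Vec n)} (h : (0 : Vec n) ∈ interior P) :
    (0 : Vec n) ∉ P.extremePoints ℝ := by
  intro hx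
  set w : Vec n := fun _ => 1
  have hw : w ≠ 0 := fun hw => by simpa [w] using congrFun hw ⟨0, hn⟩
  obtain ⟨a, ha, haw⟩ := zero_mem_interior_exists_smul h w
  obtain ⟨b, hb, hbw⟩ := zero_mem_interior_exists_smul h (-w)
  rw [mem_extremePoints] at hx
  have := (hx.2 _ haw _ hbw ⟨b / (a + b), a / (a + b), by positivity, by positivity, by
    field_simp; ring, by
    rw [smul_neg, smul_smul, smul_neg, smul_smul, ← sub_eq_add_neg, ← sub_smul]
    rw [show b / (a + b) * a - a / (a + b) * b = 0 by ring, zero_smul]⟩).1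
  rw [smul_eq_zero] at this
  exact this.elim ha.ne' hw

end BB

/-! ### The dual partition and its nefness -/

section Dual
variable {n c : ℕ} {V : Finset (Lat n)} {J : Fin c → Finset (Lat n)}

/-- The rays of the mirror. -/
abbrev dualRays (V : Finset (Lat n)) (J : Fin c → Finset (Lat n)) : Finset (Lat n) :=
  verts (nablaDual V J)

/-- The mirror nef partition. -/
abbrev dualParts (V : Finset (Lat n)) (J : Fin c → Finset (Lat n)) : Fin c → Finset (Lat n) :=
  dualPartition V J (dualRays V J)

theorem IsNefFan.mem_dualParts (h : IsNefFan V J) {j : Fin c} {u : Lat n} :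
    u ∈ dualParts V J j ↔ toVec u ∈ (nablaDual V J).extremePoints ℝ ∧ u ∈ divSections V (J j) := by
  rw [dualParts, dualPartition, Finset.mem_filter, dualRays, mem_verts h.isLatticePolytope_nablaDual]
  exact and_congr_right fun _ => ⟨mem_divSections_of_toVec_mem, toVec_mem_sectionPolytope⟩

theorem dualParts_subset (j : Fin c) : dualParts V J j ⊆ dualRays V J :=
  Finset.filter_subset _ _

theorem IsNefFan.zero_not_mem_dualRays (h : IsNefFan V J) (hn : 0 < n) (j : Fin c) :
    (0 : Lat n) ∉ dualRays V J := by
  rw [mem_verts h.isLatticePolytope_nablaDual, toVec_zero]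
  have := h.interior_verts j
  rw [convexHull_verts h.isLatticePolytope_nablaDual] at this
  exact zero_not_mem_extremePoints hn this

/-- `Δ_j` is the convex hull of `0` and the mirror rays `J_j°`. -/
theorem IsNefFan.sectionPolytope_eq (h : IsNefFan V J) (j : Fin c) :
    sectionPolytope V (J j) = nablaPart (dualParts V J) j := by
  symm
  refine convexHull_of_extremePoints_lattice (isLatticePolytope_sectionPolytope h.interior _) ?_ ?_
  · intro x hx
    by_cases h0 : x = 0
    · exact ⟨0, by simp, by rw [toVec_zero, h0]⟩
    · have h1 := h.extremePoints_subset hx h0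
      obtain ⟨u, hu, rfl⟩ := extremePoints_lattice hx
      exact ⟨u, by simpa using Or.inr (h.mem_dualParts.2 ⟨h1, hu⟩), rfl⟩
  · rintro _ ⟨u, hu, rfl⟩
    rw [Finset.mem_coe, Finset.mem_insert] at hu
    rcases hu with rfl | hu
    · exact toVec_mem_sectionPolytope (zero_mem_divSections _)
    · exact toVec_mem_sectionPolytope (h.mem_dualParts.1 hu).2

/-- A common point of Δ_j and Δ_k is nonnegative on all rays, hence 0, and 0 is interior to ∇*, not
a vertex. -/
theorem IsNefFan.dualParts_disjoint (h : IsNefFan V J) (hn : 0 < n) {j k : Fin c} (hjk : j ≠ k) :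
    Disjoint (dualParts V J j) (dualParts V J k) := by
  rw [Finset.disjoint_left]
  intro u hj hk
  have h0 : toVec u = 0 := by
    refine eq_zero_of_dotProduct_nonneg h.interior fun r hr => ?_
    rw [toVec_dotProduct]
    have h1 := (h.mem_dualParts.1 hj).2 r hr
    have h2 := (h.mem_dualParts.1 hk).2 r hr
    by_cases hrj : r ∈ J j
    · simp only [h.nef.mem_part_iff hrj, if_neg hjk] at h2
      exact_mod_cast h2
    · rw [if_neg hrj] at h1
      exact_mod_cast h1
  have := (mem_verts h.isLatticePolytope_nablaDual).2 (h.mem_dualParts.1 hj).1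
  rw [toVec_injective (h0.trans toVec_zero.symm)] at this
  exact h.zero_not_mem_dualRays hn j this

theorem IsNefFan.dualParts_union (h : IsNefFan V J) :
    Finset.univ.biUnion (dualParts V J) = dualRays V J := by
  apply Finset.Subset.antisymm
  · exact Finset.biUnion_subset.2 fun j _ => dualParts_subset j
  · intro u hu
    have hu' := (mem_verts h.isLatticePolytope_nablaDual).1 hu
    obtain ⟨j, hj⟩ := Set.mem_iUnion.1 (extremePoints_convexHull_subset hu')
    exact Finset.mem_biUnion.2 ⟨j, Finset.mem_univ j,
      h.mem_dualParts.2 ⟨hu', mem_divSections_of_toVec_mem hj⟩⟩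

theorem IsNefFan.exists_dualPart (h : IsNefFan V J) {r : Lat n} (hr : r ∈ dualRays V J) :
    ∃ j, r ∈ dualParts V J j := by
  rw [← h.dualParts_union] at hr
  simpa using hr

theorem IsNefFan.mem_dualPart_iff (h : IsNefFan V J) (hn : 0 < n) {r : Lat n} {j k : Fin c}
    (hr : r ∈ dualParts V J j) : r ∈ dualParts V J k ↔ j = k := by
  constructor
  · intro hk
    by_contra hne
    exact Finset.disjoint_left.1 (h.dualParts_disjoint hn hne) hr hk
  · rintro rfl; exact hr

/-- Functionals that are at least `-1` on the mirror rays are the points of `∇`. -/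
theorem IsNefFan.mem_dual_of_le (h : IsNefFan V J) {w : Vec n}
    (hw : ∀ r ∈ dualRays V J, -1 ≤ toVec r ⬝ᵥ w) : w ∈ dual (nablaDual V J) := by
  rw [← convexHull_verts h.isLatticePolytope_nablaDual, dual_convexHull]
  rintro _ ⟨r, hr, rfl⟩
  exact hw r hr

theorem IsNefFan.le_of_mem_dual (h : IsNefFan V J) {w : Vec n} (hw : w ∈ dual (nablaDual V J))
    {r : Lat n} (hr : r ∈ dualRays V J) : -1 ≤ toVec r ⬝ᵥ w :=
  hw _ ((mem_verts h.isLatticePolytope_nablaDual).1 hr).1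

/-- Points of `∇_j` are sections of the mirror divisor `E_j°`. -/
theorem IsNefFan.nablaPart_pairing (h : IsNefFan V J) (hn : 0 < n) {j : Fin c} {v : Lat n}
    (hv : toVec v ∈ nablaPart J j) : v ∈ divSections (dualRays V J) (dualParts V J j) := by
  intro r hr
  obtain ⟨k, hk⟩ := h.exists_dualPart hr
  simp only [h.mem_dualPart_iff hn hk]
  rw [dotProduct_comm]
  exact pairing_int h.nef (h.mem_dualParts.1 hk).2 hv

/-- A cone of the dual fan is given by some w ∈ ∇. In a decomposition w = ∑ v_k the part v_j is a
real local equation of E_j°, and passing to a generator of ∇_j on the same faces makes it integral.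
The parts are non-empty because X₀ is: on a cone meeting J_j the local generator of E_j is nonzero,
so Δ_j ≠ {0}. -/
theorem IsNefFan.isNefPartition_dual (h : IsNefFan V J) (hn : 0 < n)
    (hX : ∃ τ, IsCone V τ ∧ ∀ j, (τ ∩ J j).Nonempty) :
    IsNefPartition (dualRays V J) (dualParts V J) := by
  have hgen : ∀ j τ, IsCone (dualRays V J) τ →
      ∃ u ∈ divSections (dualRays V J) (dualParts V J j),
        ∀ r ∈ τ, u ⬝ᵥ r = if r ∈ dualParts V J j then -1 else 0 := by
    rintro j τ ⟨w, hw, hτ⟩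
    obtain ⟨v, hv, hvw⟩ := h.mem_dual_nablaDual_iff.1 (h.mem_dual_of_le hw)
    have hval : ∀ r ∈ τ, v j ⬝ᵥ toVec r = if r ∈ dualParts V J j then -1 else 0 := by
      intro r hr
      rw [hτ, Finset.mem_filter] at hr
      obtain ⟨k, hk⟩ := h.exists_dualPart hr.1
      simp only [h.mem_dualPart_iff hn hk]
      rw [dotProduct_comm]
      refine values_of_eq_neg_one h.nef hv
        (toVec_mem_sectionPolytope (h.mem_dualParts.1 hk).2) ?_ j
      rw [hvw]; exact hr.2
    obtain ⟨p, hp, hpv⟩ := exists_mem_faces τ (fun r => toVec r)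
      (fun r => if r ∈ dualParts V J j then -1 else 0) (by
        intro r hr p hp
        rw [hτ, Finset.mem_filter] at hr
        obtain ⟨k, hk⟩ := h.exists_dualPart hr.1
        simp only [h.mem_dualPart_iff hn hk]
        rw [dotProduct_comm]
        exact pairing h.nef (toVec_mem_sectionPolytope (h.mem_dualParts.1 hk).2)
          (subset_convexHull ℝ _ hp)) (hv j) hval
    obtain ⟨u, hu, rfl⟩ := hp
    refine ⟨u, h.nablaPart_pairing hn (subset_convexHull ℝ _ ⟨u, hu, rfl⟩), fun r hr => ?_⟩
    have := hpv r hr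
    rw [toVec_dotProduct] at this
    split_ifs at this ⊢ <;> exact_mod_cast this
  refine ⟨fun j => ?_, fun j k hjk => h.dualParts_disjoint hn hjk, h.dualParts_union,
    fun j τ hτ => (hgen j τ hτ).imp fun u hu => hu.2, hgen⟩
  obtain ⟨τ, hτ, hmeet⟩ := hX
  obtain ⟨u, hu, hur⟩ := h.nef.generated j τ hτ
  obtain ⟨r, hr⟩ := hmeet j
  rw [Finset.mem_inter] at hr
  by_contra hne
  rw [Finset.not_nonempty_iff_eq_empty] at hne
  have hu' := toVec_mem_sectionPolytope hu
  rw [h.sectionPolytope_eq, nablaPart, hne] at hu'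
  simp only [insert_empty_eq, Finset.coe_singleton, Set.image_singleton, convexHull_singleton,
    Set.mem_singleton_iff] at hu'
  have hu0 : u = 0 := toVec_injective hu'
  have := hur r hr.1
  rw [if_pos hr.2, hu0, zero_dotProduct] at this
  omega

theorem IsNefFan.dual (h : IsNefFan V J) (hn : 0 < n)
    (hX : ∃ τ, IsCone V τ ∧ ∀ j, (τ ∩ J j).Nonempty) (j : Fin c) :
    IsNefFan (dualRays V J) (dualParts V J) :=
  ⟨h.interior_verts j, h.isNefPartition_dual hn hX⟩

/-- `Δ_j` has a vertex in `J_j°` at which the local equation of a cone meeting `J_j` is valid. -/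
theorem IsNefFan.exists_dualPart_on_cone (h : IsNefFan V J) {τ : Finset (Lat n)}
    (hτ : IsCone V τ) {j : Fin c} (hj : (τ ∩ J j).Nonempty) :
    ∃ u ∈ dualParts V J j, ∀ r ∈ τ, u ⬝ᵥ r = if r ∈ J j then -1 else 0 := by
  have hτV : τ ⊆ V := by
    obtain ⟨m, -, rfl⟩ := hτ
    exact Finset.filter_subset _ _
  obtain ⟨u, hu, hur⟩ := h.nef.generated j τ hτ
  have hu' := toVec_mem_sectionPolytope hu
  have hsub : ∀ p ∈ toVec '' ((insert 0 (dualParts V J j) : Finset (Lat n)) : Set (Lat n)),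
      p ∈ sectionPolytope V (J j) := by
    intro p hp
    rw [h.sectionPolytope_eq]
    exact subset_convexHull ℝ _ hp
  rw [h.sectionPolytope_eq] at hu'
  obtain ⟨p, ⟨v, hv, rfl⟩, hpv⟩ := exists_mem_faces τ (fun r => toVec r)
      (fun r => if r ∈ J j then -1 else 0) (fun r hr p hp =>
        le_of_mem_sectionPolytope (hsub p hp) (hτV hr)) hu' (fun r hr => by
        rw [toVec_dotProduct, hur r hr]; split_ifs <;> simp)
  have hvr : ∀ r ∈ τ, v ⬝ᵥ r = if r ∈ J j then -1 else 0 := by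
    intro r hr
    have := hpv r hr
    rw [toVec_dotProduct] at this
    split_ifs at this ⊢ <;> exact_mod_cast this
  rw [Finset.mem_coe, Finset.mem_insert] at hv
  rcases hv with rfl | hv
  · obtain ⟨r, hr⟩ := hj
    rw [Finset.mem_inter] at hr
    have := hvr r hr.1
    rw [if_pos hr.2, zero_dotProduct] at this
    omega
  · exact ⟨v, hv, hvr⟩

/-- Non-emptiness of the special fiber is self-dual. For rays r_k ∈ τ ∩ J_k the point ∑ r_k of ∇
defines the cone: an element of J_j° that is a local equation on τ takes the value -1 on it. -/
theorem IsNefFan.exists_dual_cone (h : IsNefFan V J)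
    (hX : ∃ τ, IsCone V τ ∧ ∀ j, (τ ∩ J j).Nonempty) :
    ∃ τ, IsCone (dualRays V J) τ ∧ ∀ j, (τ ∩ dualParts V J j).Nonempty := by
  obtain ⟨τ, hτ, hmeet⟩ := hX
  choose r hr using hmeet
  have hw : (∑ k, toVec (r k)) ∈ TropMirror.dual (nablaDual V J) :=
    h.mem_dual_nablaDual_iff.2 ⟨fun k => toVec (r k), fun k =>
      toVec_mem_nablaPart (Finset.mem_inter.1 (hr k)).2, rfl⟩
  refine ⟨_, ⟨_, fun s hs => h.le_of_mem_dual hw hs, rfl⟩, fun j => ?_⟩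
  obtain ⟨u, hu, hur⟩ := h.exists_dualPart_on_cone hτ ⟨r j, hr j⟩
  refine ⟨u, Finset.mem_inter.2 ⟨Finset.mem_filter.2 ⟨dualParts_subset j hu, ?_⟩, hu⟩⟩
  rw [dotProduct_sum]
  have : ∀ k, toVec u ⬝ᵥ toVec (r k) = if k = j then -1 else 0 := by
    intro k
    rw [toVec_dotProduct, hur _ (Finset.mem_inter.1 (hr k)).1]
    simp only [h.nef.mem_part_iff (Finset.mem_inter.1 (hr k)).2]
    split_ifs <;> simp
  simp [this]

/-- The half of the involutivity of the duality that is not immediate from `pairing`: Δ_k is spanned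
by 0 and J_k°, so the inequalities defining sections of E_j° are those that cut out ∇_j. -/
theorem IsNefFan.sectionPolytope_dual_subset (h : IsNefFan V J) (hn : 0 < n) (j : Fin c) :
    sectionPolytope (dualRays V J) (dualParts V J j) ⊆ nablaPart J j := by
  intro x hx
  refine h.mem_nablaPart fun k u hu => ?_
  have hu' := toVec_mem_sectionPolytope hu
  rw [h.sectionPolytope_eq] at hu'
  refine le_dotProduct_of_mem_convexHull ?_ hu'
  rintro _ ⟨r, hr, rfl⟩
  rw [Finset.mem_coe, Finset.mem_insert] at hr
  rcases hr with rfl | hr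
  · rw [toVec_zero, zero_dotProduct]; split_ifs <;> simp
  · have := le_of_mem_sectionPolytope hx (dualParts_subset k hr)
    simp only [h.mem_dualPart_iff hn hr] at this
    rwa [dotProduct_comm]

end Dual

/-! ### Generic freeness -/

section GenericFreeness
variable {A : Type*} [CommRing A]

open MvPolynomial in
/-- For an ideal of a polynomial ring over a domain there are polynomials `e d` of all degrees `d`
in a monomial ordering, which lie in the ideal if `d` is the degree of an element of the ideal, and
whose leading coefficients all divide one nonzero element. -/
theorem exists_adapted_family [IsDomain A] {σ : Type*} [Finite σ] (m : MonomialOrder σ)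
    (I : Ideal (MvPolynomial σ A)) :
    ∃ Q : A, Q ≠ 0 ∧ ∃ e : (σ →₀ ℕ) → MvPolynomial σ A,
      (∀ d, m.degree (e d) = d) ∧ (∀ d, coeff d (e d) ∣ Q) ∧
      ∀ d, (∃ f ∈ I, f ≠ 0 ∧ m.degree f = d) ∧ e d ∈ I ∨
        (¬ ∃ f ∈ I, f ≠ 0 ∧ m.degree f = d) ∧ e d = monomial d 1 := by
  set D : (σ →₀ ℕ) → Prop := fun d => ∃ f ∈ I, f ≠ 0 ∧ m.degree f = d with hD
  -- Dickson's lemma. Only finitely many minimal degrees occur; all other `e d` with d ∈ D are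
  -- monomial multiples of the chosen elements, so one product of finitely many leading coefficients
  -- serves for Q.
  have hfin : {d | Minimal D d}.Finite :=
    (setOfPred_minimal_antichain D).finite_of_partiallyWellOrderedOn
      ((Set.isPWO_of_wellQuasiOrderedLE {d | D d}).mono fun d hd => hd.1)
  have hex : ∀ d, D d → ∃ f ∈ I, f ≠ 0 ∧ m.degree f = d := fun d hd => hd
  choose! f hfI hf0 hfd using hex
  have hmin : ∀ d, D d → ∃ d' ≤ d, Minimal D d' := fun d hd =>
    exists_minimal_le_of_wellFoundedLT D d hd
  choose! μ hμle hμ using hmin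
  refine ⟨∏ d ∈ hfin.toFinset, m.leadingCoeff (f d), ?_,
    fun d => if D d then monomial (d - μ d) 1 * f (μ d) else monomial d 1, ?_, ?_, ?_⟩
  · rw [Finset.prod_ne_zero_iff]
    intro d hd
    rw [Set.Finite.mem_toFinset] at hd
    exact m.leadingCoeff_ne_zero_iff.2 (hf0 d hd.1)
  · intro d
    dsimp only
    split_ifs with h
    · rw [MonomialOrder.degree_mul (by simp) (hf0 _ (hμ d h).1), MonomialOrder.degree_monomial,
        if_neg one_ne_zero, hfd _ (hμ d h).1]
      exact tsub_add_cancel_of_le (hμle d h)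
    · rw [MonomialOrder.degree_monomial, if_neg one_ne_zero]
  · intro d
    dsimp only
    split_ifs with h
    · have : coeff d (monomial (d - μ d) 1 * f (μ d)) = m.leadingCoeff (f (μ d)) := by
        have h2 := coeff_monomial_mul (μ d) (d - μ d) (1 : A) (f (μ d))
        rw [tsub_add_cancel_of_le (hμle d h), one_mul] at h2
        rw [h2, MonomialOrder.leadingCoeff, hfd _ (hμ d h).1]
      rw [this]
      exact Finset.dvd_prod_of_mem (fun d => m.leadingCoeff (f d))
        (hfin.mem_toFinset.2 (hμ d h))
    · simp
  · intro d
    by_cases h : D d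
    · refine Or.inl ⟨h, ?_⟩
      dsimp only
      rw [if_pos h]
      exact I.mul_mem_left _ (hfI _ (hμ d h).1)
    · exact Or.inr ⟨h, if_neg h⟩

open MvPolynomial in
-- After inverting Q the `e d` span. Division by `e d` removes the leading term at the cost of one
-- factor Q, and the monomial order is well-founded.
theorem exists_pow_smul_eq {σ : Type*} (m : MonomialOrder σ) {Q : A}
    {e : (σ →₀ ℕ) → MvPolynomial σ A} (he : ∀ d, m.degree (e d) = d)
    (hQ : ∀ d, coeff d (e d) ∣ Q) (p : MvPolynomial σ A) :
    ∃ (N : ℕ) (a : (σ →₀ ℕ) →₀ A), Q ^ N • p = Finsupp.linearCombination A e a := by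
  have key : ∀ (s : m.syn) (p : MvPolynomial σ A), m.toSyn (m.degree p) = s →
      ∃ (N : ℕ) (a : (σ →₀ ℕ) →₀ A), Q ^ N • p = Finsupp.linearCombination A e a := by
    intro s
    induction s using WellFoundedLT.induction with
    | ind s ih =>
      intro p hp
      set d := m.degree p with hd
      obtain ⟨k, hk⟩ := hQ d
      set p' := Q • p - (k * coeff d p) • e d with hp'
      have hcoeff : ∀ x, coeff x p' ≠ 0 → m.toSyn x < s := by
        intro x hx
        by_contra hlt
        apply hx
        rcases eq_or_lt_of_le (not_lt.1 hlt) with h | h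
        · have hxd : x = d := m.toSyn.injective (h.symm.trans hp.symm)
          subst hxd
          simp only [hp', coeff_sub, coeff_smul, smul_eq_mul, hk]
          ring
        · have h1 : coeff x p = 0 := MonomialOrder.coeff_eq_zero_of_lt (m := m) (by
            rw [← hd, hp]; exact h)
          have h2 : coeff x (e d) = 0 := MonomialOrder.coeff_eq_zero_of_lt (m := m) (by
            rw [he, hp]; exact h)
          simp [hp', h1, h2]
      have hsum : ∃ (N : ℕ) (a : (σ →₀ ℕ) →₀ A),
          Q ^ N • p' = Finsupp.linearCombination A e a := by
        by_cases h0 : p' = 0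
        · exact ⟨0, 0, by simp [h0]⟩
        · refine ih _ (hcoeff _ ?_) p' rfl
          exact mem_support_iff.1 (m.degree_mem_support h0)
      obtain ⟨N, a, ha⟩ := hsum
      refine ⟨N + 1, a + Finsupp.single d (Q ^ N * (k * coeff d p)), ?_⟩
      rw [map_add, ← ha, Finsupp.linearCombination_single, hp', smul_sub, smul_smul, smul_smul,
        pow_succ]
      abel
  exact key _ p rfl

open MvPolynomial in
-- Triangularity modulo 𝔭: at the largest d with a d ∉ 𝔭, the coefficient of the combination is a d
-- times the leading coefficient of `e d`, up to 𝔭. That leading coefficient divides Q, so it is not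
-- in 𝔭 either.
theorem mem_of_linearCombination_mem {σ : Type*} (m : MonomialOrder σ) {Q : A}
    {e : (σ →₀ ℕ) → MvPolynomial σ A} (he : ∀ d, m.degree (e d) = d)
    (hQ : ∀ d, coeff d (e d) ∣ Q) {𝔭 : Ideal A} (h𝔭 : 𝔭.IsPrime) (hQ𝔭 : Q ∉ 𝔭)
    {a : (σ →₀ ℕ) →₀ A} (ha : Finsupp.linearCombination A e a ∈ 𝔭.map C) (d : σ →₀ ℕ) :
    a d ∈ 𝔭 := by
  by_contra hd
  set s := a.support.filter (fun d => a d ∉ 𝔭) with hs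
  have hne : s.Nonempty := ⟨d, Finset.mem_filter.2
    ⟨Finsupp.mem_support_iff.2 fun h0 => hd (h0 ▸ 𝔭.zero_mem), hd⟩⟩
  obtain ⟨x, hx, hmax⟩ := Finset.exists_max_image s m.toSyn hne
  rw [hs, Finset.mem_filter] at hx
  have h1 := (mem_map_C_iff.1 ha) x
  rw [Finsupp.linearCombination_apply, Finsupp.sum, coeff_sum] at h1
  have h2 : ∀ y ∈ a.support, y ≠ x → coeff x (a y • e y) ∈ 𝔭 := by
    intro y hy hyx
    rw [coeff_smul, smul_eq_mul]
    by_cases hya : a y ∈ 𝔭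
    · exact 𝔭.mul_mem_right _ hya
    · have hle := hmax y (Finset.mem_filter.2 ⟨hy, hya⟩)
      have hlt : m.toSyn y < m.toSyn x :=
        lt_of_le_of_ne hle fun h => hyx (m.toSyn.injective h)
      rw [MonomialOrder.coeff_eq_zero_of_lt (m := m) (by rw [he]; exact hlt), mul_zero]
      exact 𝔭.zero_mem
  rw [← Finset.add_sum_erase _ _ hx.1] at h1
  have h3 : coeff x (a x • e x) ∈ 𝔭 := by
    refine (Submodule.add_mem_iff_left _ (𝔭.sum_mem fun y hy => ?_)).1 h1
    exact h2 y (Finset.mem_of_mem_erase hy) (Finset.ne_of_mem_erase hy)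
  rw [coeff_smul, smul_eq_mul] at h3
  rcases h𝔭.mem_or_mem h3 with h | h
  · exact hx.2 h
  · exact hQ𝔭 (𝔭.mem_of_dvd (hQ x) h)

open MvPolynomial in
-- Once Q is inverted, I is free on the `e d` with d ∈ D and the quotient is free on the remaining
-- monomials. So the fiber of the quotient over 𝔭 has no torsion, and I meets the extension of 𝔭 in
-- 𝔭 I; the powers of Q record the localization.
theorem generic_freeness_mvPolynomial [IsDomain A] {k : ℕ} (I : Ideal (MvPolynomial (Fin k) A)) :
    ∃ Q : A, Q ≠ 0 ∧ ∀ 𝔭 : Ideal A, 𝔭.IsPrime → Q ∉ 𝔭 →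
      (∀ p ∉ 𝔭, ∀ f, p • f ∈ I ⊔ 𝔭.map C → ∃ N : ℕ, Q ^ N • f ∈ I ⊔ 𝔭.map C) ∧
      ∀ f ∈ I, f ∈ 𝔭.map C → ∃ N : ℕ, Q ^ N • f ∈ 𝔭.map C * I := by
  set m : MonomialOrder (Fin k) := MonomialOrder.lex
  obtain ⟨Q, hQ0, e, he, hQ, hD⟩ := exists_adapted_family m I
  set T := Finsupp.linearCombination A e with hT
  set D : (Fin k →₀ ℕ) → Prop := fun d => ∃ f ∈ I, f ≠ 0 ∧ m.degree f = d with hDdef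
  have heI : ∀ d, D d → e d ∈ I := fun d hd => ((hD d).resolve_right fun h => h.1 hd).2
  have heD : ∀ d, ¬ D d → e d = monomial d 1 := fun d hd =>
    ((hD d).resolve_left fun h => hd h.1).2
  have hTI : ∀ a : (Fin k →₀ ℕ) →₀ A, T (a.filter D) ∈ I := by
    intro a
    rw [hT, Finsupp.linearCombination_apply, Finsupp.sum]
    refine I.sum_mem fun d hd => ?_
    rw [smul_eq_C_mul]
    refine I.mul_mem_left _ (heI d ?_)
    by_contra h
    exact (Finsupp.mem_support_iff.1 hd) (Finsupp.filter_apply_neg D a h)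
  have hsplit : ∀ a, T a = T (a.filter D) + T (a.filter fun d => ¬ D d) := by
    intro a
    rw [← map_add, Finsupp.filter_add_filter_not]
  have hTcoeff : ∀ (a : (Fin k →₀ ℕ) →₀ A) d,
      coeff d (T (a.filter fun d => ¬ D d)) = if D d then 0 else a d := by
    intro a d
    rw [hT, Finsupp.linearCombination_apply, Finsupp.sum, coeff_sum]
    have : ∀ x ∈ (a.filter fun d => ¬ D d).support,
        coeff d ((a.filter fun d => ¬ D d) x • e x) = if x = d then a x else 0 := by
      intro x hx
      have hxD : ¬ D x := by
        by_contra h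
        exact (Finsupp.mem_support_iff.1 hx)
          (Finsupp.filter_apply_neg (fun d => ¬ D d) a (not_not.2 h))
      rw [heD x hxD, coeff_smul, coeff_monomial, Finsupp.filter_apply_pos _ a hxD]
      split_ifs <;> simp
    rw [Finset.sum_congr rfl this, Finset.sum_ite_eq']
    by_cases hd : D d
    · rw [if_pos hd, if_neg]
      rw [Finsupp.notMem_support_iff]
      exact Finsupp.filter_apply_neg (fun d => ¬ D d) a (not_not.2 hd)
    · rw [if_neg hd]
      split_ifs with h
      · rfl
      · rw [Finsupp.notMem_support_iff, Finsupp.filter_apply_pos _ a hd] at h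
        exact h.symm
  -- A nonzero remainder in I would have its degree in D, but the remainder has no monomials with
  -- exponent in D.
  have hzero : ∀ a, T a ∈ I → T a = T (a.filter D) := by
    intro a ha
    rw [hsplit a] at ha ⊢
    have hI : T (a.filter fun d => ¬ D d) ∈ I := (Submodule.add_mem_iff_right _ (hTI a)).1 ha
    by_cases h0 : T (a.filter fun d => ¬ D d) = 0
    · rw [h0, add_zero]
    · exfalso
      have h1 := mem_support_iff.1 (m.degree_mem_support h0)
      rw [hTcoeff, if_pos ⟨_, hI, h0, rfl⟩] at h1
      exact h1 rfl
  refine ⟨Q, hQ0, fun 𝔭 h𝔭 hQ𝔭 => ⟨?_, ?_⟩⟩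
  · intro p hp f hf
    obtain ⟨i, hi, x, hx, hix⟩ := Submodule.mem_sup.1 hf
    obtain ⟨N, a, ha⟩ := exists_pow_smul_eq m he hQ f
    obtain ⟨N', a', ha'⟩ := exists_pow_smul_eq m he hQ i
    have hi' : T a' = T (a'.filter D) :=
      hzero a' (by rw [← ha', smul_eq_C_mul]; exact I.mul_mem_left _ hi)
    have hcomb : T ((Q ^ N' * p) • a - Q ^ N • a'.filter D) ∈ 𝔭.map C := by
      rw [map_sub, map_smul, map_smul, ← hi', ← ha', ← ha]
      have : (Q ^ N' * p) • Q ^ N • f - Q ^ N • Q ^ N' • i = (Q ^ N * Q ^ N') • x := by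
        have hx' : x = p • f - i := by rw [← hix]; ring
        rw [hx']
        simp only [smul_smul, smul_sub]
        congr 2
        ring
      rw [this, smul_eq_C_mul]
      exact Ideal.mul_mem_left _ _ hx
    have hmem := mem_of_linearCombination_mem m he hQ h𝔭 hQ𝔭 hcomb
    refine ⟨N, ?_⟩
    rw [ha, ← hT, hsplit]
    refine Submodule.add_mem_sup (hTI a) (mem_map_C_iff.2 fun d => ?_)
    rw [hTcoeff]
    split_ifs with hd
    · exact 𝔭.zero_mem
    · have := hmem d
      rw [Finsupp.sub_apply, Finsupp.smul_apply, Finsupp.smul_apply,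
        Finsupp.filter_apply_neg D a' hd, smul_zero, sub_zero, smul_eq_mul] at this
      refine (h𝔭.mem_or_mem this).resolve_left fun h => ?_
      rcases h𝔭.mem_or_mem h with h | h
      · exact hQ𝔭 (h𝔭.mem_of_pow_mem _ h)
      · exact hp h
  · intro f hf hf𝔭
    obtain ⟨N, a, ha⟩ := exists_pow_smul_eq m he hQ f
    have haI : T a = T (a.filter D) :=
      hzero a (by rw [← ha, smul_eq_C_mul]; exact I.mul_mem_left _ hf)
    have hmem := mem_of_linearCombination_mem m he hQ h𝔭 hQ𝔭 (a := a) (by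
      rw [← ha, smul_eq_C_mul]; exact Ideal.mul_mem_left _ _ hf𝔭)
    refine ⟨N, ?_⟩
    rw [ha, ← hT, haI, hT, Finsupp.linearCombination_apply, Finsupp.sum]
    refine Ideal.sum_mem _ fun d hd => ?_
    rw [smul_eq_C_mul]
    have hdD : D d := by
      by_contra h
      exact (Finsupp.mem_support_iff.1 hd) (Finsupp.filter_apply_neg D a h)
    rw [Finsupp.filter_apply_pos D a hdD]
    exact Ideal.mul_mem_mul (Ideal.mem_map_of_mem C (hmem d)) (heI d hdD)

/-- Generic freeness of `B / J` over `A`, expressed by its consequences for fibers. -/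
theorem generic_freeness [IsDomain A] {B : Type*} [CommRing B] [Algebra A B] [Algebra.FiniteType A B]
    (J : Ideal B) :
    ∃ Q : A, Q ≠ 0 ∧ ∀ 𝔭 : Ideal A, 𝔭.IsPrime → Q ∉ 𝔭 →
      (∀ p ∉ 𝔭, ∀ f, p • f ∈ J ⊔ 𝔭.map (algebraMap A B) →
        ∃ N : ℕ, Q ^ N • f ∈ J ⊔ 𝔭.map (algebraMap A B)) ∧
      ∀ f ∈ J, f ∈ 𝔭.map (algebraMap A B) →
        ∃ N : ℕ, Q ^ N • f ∈ 𝔭.map (algebraMap A B) * J := by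
  obtain ⟨k, φ, hφ⟩ := Algebra.FiniteType.iff_quotient_mvPolynomial''.1 ‹Algebra.FiniteType A B›
  obtain ⟨Q, hQ0, hQ⟩ := generic_freeness_mvPolynomial (J.comap φ)
  have hmapJ : (J.comap φ).map φ = J := Ideal.map_comap_of_surjective φ hφ J
  have hmapp : ∀ 𝔭 : Ideal A, (𝔭.map MvPolynomial.C).map (φ : MvPolynomial (Fin k) A →+* B) =
      𝔭.map (algebraMap A B) := by
    intro 𝔭
    rw [Ideal.map_map]
    congr 1
    ext x
    simp [← MvPolynomial.algebraMap_eq]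
  have hker : ∀ x, φ x = 0 → x ∈ J.comap φ := fun x hx => by
    rw [Ideal.mem_comap, hx]; exact J.zero_mem
  have hφ' : Function.Surjective (φ : MvPolynomial (Fin k) A →+* B) := hφ
  refine ⟨Q, hQ0, fun 𝔭 h𝔭 hQ𝔭 => ⟨fun p hp f hf => ?_, fun f hf hf𝔭 => ?_⟩⟩
  · obtain ⟨g, rfl⟩ := hφ f
    have hmap : (J.comap φ ⊔ 𝔭.map MvPolynomial.C).map (φ : MvPolynomial (Fin k) A →+* B) =
        J ⊔ 𝔭.map (algebraMap A B) := by
      rw [Ideal.map_sup, hmapp]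
      congr 1
    rw [← hmap, Ideal.mem_map_iff_of_surjective _ hφ'] at hf
    obtain ⟨z, hz, hzf⟩ := hf
    have hpg : p • g ∈ J.comap φ ⊔ 𝔭.map MvPolynomial.C := by
      have : p • g - z ∈ J.comap φ := hker _ (by
        rw [map_sub, map_smul]; rw [← hzf]; exact sub_self _)
      have h2 := Submodule.add_mem _ (Ideal.mem_sup_left (T := 𝔭.map MvPolynomial.C) this) hz
      rwa [sub_add_cancel] at h2
    obtain ⟨N, hN⟩ := (hQ 𝔭 h𝔭 hQ𝔭).1 p hp g hpg
    refine ⟨N, ?_⟩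
    rw [← hmap, ← map_smul]
    exact Ideal.mem_map_of_mem (φ : MvPolynomial (Fin k) A →+* B) hN
  · rw [← hmapp, Ideal.mem_map_iff_of_surjective _ hφ'] at hf𝔭
    obtain ⟨g, hg, rfl⟩ := hf𝔭
    obtain ⟨N, hN⟩ := (hQ 𝔭 h𝔭 hQ𝔭).2 g hf hg
    refine ⟨N, ?_⟩
    have h1 := Ideal.mem_map_of_mem (φ : MvPolynomial (Fin k) A →+* B) hN
    rw [Ideal.map_mul, hmapp] at h1
    have h2 : (J.comap φ).map (φ : MvPolynomial (Fin k) A →+* B) = J := hmapJ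
    rw [h2] at h1
    have h3 : (φ : MvPolynomial (Fin k) A →+* B) (Q ^ N • g) =
      Q ^ N • (φ : MvPolynomial (Fin k) A →+* B) g := map_smul φ _ _
    rwa [h3] at h1

end GenericFreeness

/-! ### Regular sequences deforming coprime monomials -/

section Regular

/-- A form of the permutability of regular sequences. -/
theorem mem_span_of_mul_mem_span {Γ κ : Type*} [CommRing Γ] {s : Γ}
    (hs : ∀ x, s * x = 0 → x = 0) (F : κ → Γ)
    (H : ∀ (T : Finset κ) (k : κ), k ∉ T → ∀ p,
      F k * p ∈ Ideal.span {s} ⊔ Ideal.span (F '' T) →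
      p ∈ Ideal.span {s} ⊔ Ideal.span (F '' T))
    (T : Finset κ) : ∀ h, s * h ∈ Ideal.span (F '' T) → h ∈ Ideal.span (F '' T) := by
  induction T using Finset.induction_on with
  | empty =>
    intro h hh
    simp only [Finset.coe_empty, Set.image_empty, Ideal.span_empty, Ideal.mem_bot] at hh ⊢
    exact hs h hh
  | insert k T hk ih =>
    intro h hh
    rw [Finset.coe_insert, Set.image_insert_eq, Ideal.span_insert, Ideal.mem_span_singleton_sup]
      at hh ⊢
    obtain ⟨p, i, hi, hpi⟩ := hh
    -- Modulo s the relation s h = p F_k + i says that F_k kills p. By `H`, p = q s + i', after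
    -- which s (h - F_k q) only involves the smaller set.
    have h1 : F k * p ∈ Ideal.span {s} ⊔ Ideal.span (F '' T) := by
      rw [Ideal.mem_span_singleton_sup]
      exact ⟨h, -i, neg_mem hi, by rw [mul_comm h, ← hpi]; ring⟩
    have h2 := H T k hk p h1
    rw [Ideal.mem_span_singleton_sup] at h2
    obtain ⟨q, i', hi', hq⟩ := h2
    have h3 : s * (h - F k * q) ∈ Ideal.span (F '' T) := by
      have : s * (h - F k * q) = F k * i' + i := by
        rw [mul_sub, ← hpi, ← hq]; ring
      rw [this]
      exact add_mem (Ideal.mul_mem_left _ _ hi') hi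
    exact ⟨q, h - F k * q, ih _ h3, by ring⟩

variable {R G : Type*} [CommRing R] [AddCommMonoid G]

open AddMonoidAlgebra in
-- The ideal is homogeneous for the grading by exponents, so membership is decided coefficient by
-- coefficient.
theorem mem_span_monomials {κ : Type*} (s : R) (μ : κ → G) (T : Finset κ)
    (p : AddMonoidAlgebra R G) :
    p ∈ Ideal.span {single (0 : G) s} ⊔ Ideal.span ((fun k => single (μ k) (1 : R)) '' T) ↔
      ∀ a, s ∣ p.coeff a ∨ ∃ k ∈ T, ∃ b, a = μ k + b := by
  constructor
  · intro hp
    set I : Ideal (AddMonoidAlgebra R G) :=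
      { carrier := {p | ∀ a, s ∣ p.coeff a ∨ ∃ k ∈ T, ∃ b, a = μ k + b}
        zero_mem' := fun a => Or.inl (by simp)
        add_mem' := by
          intro p q hp hq a
          rcases hp a with h | h
          · rcases hq a with h' | h'
            · left
              rw [coeff_add, Finsupp.add_apply]
              exact dvd_add h h'
            · exact Or.inr h'
          · exact Or.inr h
        smul_mem' := by
          intro q p hp
          rw [smul_eq_mul]
          intro a
          by_cases ha : ∃ k ∈ T, ∃ b, a = μ k + b
          · exact Or.inr ha
          · left
            rw [AddMonoidAlgebra.coeff_mul]
            refine Finset.dvd_sum fun x _ => Finset.dvd_sum fun y _ => ?_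
            dsimp only
            split_ifs with hxy
            · rcases hp y with h | ⟨k, hk, b, hb⟩
              · exact dvd_mul_of_dvd_right h _
              · exact absurd ⟨k, hk, x + b, by rw [← hxy, hb]; abel⟩ ha
            · exact dvd_zero _ }
    have hle : Ideal.span {single (0 : G) s} ⊔
        Ideal.span ((fun k => single (μ k) (1 : R)) '' T) ≤ I := by
      refine sup_le (Ideal.span_le.2 ?_) (Ideal.span_le.2 ?_)
      · rintro _ rfl a
        left
        rw [coeff_single, Finsupp.single_apply]
        split_ifs <;> simp
      · rintro _ ⟨k, hk, rfl⟩ a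
        by_cases ha : μ k = a
        · exact Or.inr ⟨k, hk, 0, by rw [ha, add_zero]⟩
        · left
          rw [coeff_single, Finsupp.single_apply, if_neg ha]
          exact dvd_zero _
    exact hle hp
  · intro h
    rw [← AddMonoidAlgebra.sum_coeff_single p, Finsupp.sum]
    refine Ideal.sum_mem _ fun a _ => ?_
    rcases h a with ⟨c, hc⟩ | ⟨k, hk, b, hb⟩
    · refine Ideal.mem_sup_left ?_
      rw [hc, show single a (s * c) = single (0 : G) s * single a c by
        rw [single_mul_single, zero_add]]
      exact Ideal.mul_mem_right _ _ (Ideal.subset_span rfl)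
    · refine Ideal.mem_sup_right ?_
      rw [show single a (p.coeff a) = single (μ k) (1 : R) * single b (p.coeff a) by
        rw [single_mul_single, one_mul, ← hb]]
      exact Ideal.mul_mem_right _ _ (Ideal.subset_span ⟨k, hk, rfl⟩)

open AddMonoidAlgebra in
theorem span_sup_eq {Γ κ : Type*} [CommRing Γ] {s : Γ} {F F' : κ → Γ}
    (h : ∀ k, ∃ q, F k = F' k + s * q) (T : Set κ) :
    Ideal.span {s} ⊔ Ideal.span (F '' T) = Ideal.span {s} ⊔ Ideal.span (F' '' T) := by
  have hs : ∀ x, s * x ∈ Ideal.span {s} := fun x =>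
    Ideal.mul_mem_right _ _ (Ideal.subset_span rfl)
  apply le_antisymm
  · refine sup_le le_sup_left (Ideal.span_le.2 ?_)
    rintro _ ⟨k, hk, rfl⟩
    obtain ⟨q, hq⟩ := h k
    rw [hq]
    exact add_mem (Ideal.mem_sup_right (Ideal.subset_span ⟨k, hk, rfl⟩))
      (Ideal.mem_sup_left (hs q))
  · refine sup_le le_sup_left (Ideal.span_le.2 ?_)
    rintro _ ⟨k, hk, rfl⟩
    obtain ⟨q, hq⟩ := h k
    rw [show F' k = F k + s * (-q) by rw [hq]; ring]
    exact add_mem (Ideal.mem_sup_right (Ideal.subset_span ⟨k, hk, rfl⟩))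
      (Ideal.mem_sup_left (hs _))

open AddMonoidAlgebra in
/-- If the `F k` deform coprime monomials over the parameter `s`, then `s` is not a zero divisor
modulo the `F k`. -/
theorem parameter_regular [IsCancelAdd G] {κ : Type*} [Fintype κ] {s : R}
    (hs : ∀ x, s * x = 0 → x = 0)
    (μ : κ → G) (hcop : ∀ k i a b, k ≠ i → μ k + a = μ i + b → ∃ b', a = μ i + b')
    (F : κ → AddMonoidAlgebra R G)
    (hF : ∀ k, ∃ q, F k = single (μ k) 1 + single 0 s * q) (h : AddMonoidAlgebra R G)
    (hh : single 0 s * h ∈ Ideal.span (Set.range F)) : h ∈ Ideal.span (Set.range F) := by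
  have := mem_span_of_mul_mem_span (s := single (0 : G) s) (F := F) ?_ ?_ Finset.univ h
    (by simpa using hh)
  · simpa using this
  · intro x hx
    ext a
    have := congrArg (fun y => y.coeff (0 + a)) hx
    simp only [coeff_single_mul_add, coeff_zero, Finsupp.zero_apply] at this
    exact hs _ this
  · intro T k hk p hp
    -- Modulo s the F k are the monomials with exponents μ k, and coprimality makes each of them
    -- regular modulo the others.
    rw [span_sup_eq hF, mem_span_monomials] at hp ⊢
    obtain ⟨q, hq⟩ := hF k
    intro a
    have h1 : single (μ k) (1 : R) * p ∈
        Ideal.span {single (0 : G) s} ⊔ Ideal.span ((fun k => single (μ k) (1 : R)) '' T) := by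
      have h2 : F k * p ∈
        Ideal.span {single (0 : G) s} ⊔ Ideal.span ((fun k => single (μ k) (1 : R)) '' T) :=
        (mem_span_monomials _ _ _ _).2 hp
      have h3 : single (μ k) (1 : R) * p = F k * p - single 0 s * (q * p) := by
        rw [hq]; ring
      rw [h3]
      exact sub_mem h2 (Ideal.mem_sup_left (Ideal.mul_mem_right _ _ (Ideal.subset_span rfl)))
    rcases (mem_span_monomials _ _ _ _).1 h1 (μ k + a) with h | ⟨i, hi, b, hb⟩
    · left
      rwa [coeff_single_mul_add, one_mul] at h
    · right
      obtain ⟨b', hb'⟩ := hcop k i a b (fun hki => hk (hki ▸ hi)) hb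
      exact ⟨i, hi, b', hb'⟩

end Regular

/-! ### Families of complete intersections with universal coefficients -/

section Family
variable {G ι κ : Type*} [AddCommMonoid G]

open AddMonoidAlgebra in
/-- The local equation `χ^{μ_j} + s ∑_{α ∈ Φ_j} b_α χ^{ν_α}`. -/
def localEq {R : Type*} [CommRing R] (Φ : κ → Finset ι) (μ : κ → G) (ν : ι → G) (s : R)
    (b : ι → R) (j : κ) : AddMonoidAlgebra R G :=
  single (μ j) 1 + ∑ α ∈ Φ j, single (ν α) (s * b α)

open AddMonoidAlgebra in
theorem localEq_eq {R : Type*} [CommRing R] (Φ : κ → Finset ι) (μ : κ → G) (ν : ι → G) (s : R)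
    (b : ι → R) (j : κ) : localEq Φ μ ν s b j =
      single (μ j) 1 + single 0 s * ∑ α ∈ Φ j, single 0 (b α) * single (ν α) 1 := by
  rw [localEq, Finset.mul_sum]
  congr 1
  refine Finset.sum_congr rfl fun α _ => ?_
  rw [single_mul_single, single_mul_single, zero_add, zero_add, mul_one]

open AddMonoidAlgebra in
theorem map_localEq {R R' : Type*} [CommRing R] [CommRing R'] (φ : R →+* R') (Φ : κ → Finset ι)
    (μ : κ → G) (ν : ι → G) (s : R) (b : ι → R) (j : κ) :
    mapRingHom G φ (localEq Φ μ ν s b j) = localEq Φ μ ν (φ s) (fun α => φ (b α)) j := by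
  simp [localEq, map_sum]

/-- Hypotheses under which the family of all complete intersections is well-behaved. -/
structure IsLocalData (Φ : κ → Finset ι) (μ : κ → G) (ν : ι → G) : Prop where
  coprime : ∀ k i a b, k ≠ i → μ k + a = μ i + b → ∃ b', a = μ i + b'
  disjoint : ∀ j k, j ≠ k → Disjoint (Φ j) (Φ k)
  nonempty : ∀ j, (Φ j).Nonempty
  -- Some monomial of the j-th equation is a unit on the chart; this permits solving that equation
  -- for coefficients.
  unit : ∀ j, μ j = 0 ∨ ∃ α ∈ Φ j, ν α = 0

/-- The coefficient ring `ℂ[b_α][s]` of the universal family. -/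
abbrev UCoeff (ι : Type*) := (MvPolynomial ι ℂ)[X]

/-- The equations of the universal family. -/
abbrev univEq (Φ : κ → Finset ι) (μ : κ → G) (ν : ι → G) (j : κ) :
    AddMonoidAlgebra (UCoeff ι) G :=
  localEq Φ μ ν Polynomial.X (fun α => Polynomial.C (MvPolynomial.X α)) j

/-- The ideal of the universal family. -/
abbrev univIdeal (Φ : κ → Finset ι) (μ : κ → G) (ν : ι → G) :
    Ideal (AddMonoidAlgebra (UCoeff ι) G) :=
  Ideal.span (Set.range (univEq Φ μ ν))

open AddMonoidAlgebra in
theorem univ_parameter_regular [IsCancelAdd G] [Fintype κ]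
    {Φ : κ → Finset ι} {μ : κ → G} {ν : ι → G}
    (hd : IsLocalData Φ μ ν) {R : Type*} [CommRing R] (b : ι → R[X]) {h : AddMonoidAlgebra R[X] G}
    (hh : single 0 Polynomial.X * h ∈ Ideal.span (Set.range (localEq Φ μ ν Polynomial.X b))) :
    h ∈ Ideal.span (Set.range (localEq Φ μ ν Polynomial.X b)) := by
  refine parameter_regular (s := Polynomial.X) (fun x hx => ?_) μ hd.coprime _ (fun k => ?_) h hh
  · ext i
    have := congrArg (fun p => p.coeff (i + 1)) hx
    simpa using this
  · exact ⟨_, localEq_eq _ _ _ _ _ _⟩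

open AddMonoidAlgebra in
/-- On a chart that meets the special fiber, no element of the coefficient ring vanishes on the
universal family. -/
theorem univ_inter_eq_zero [IsCancelAdd G] [Fintype κ]
    {Φ : κ → Finset ι} {μ : κ → G} {ν : ι → G}
    (hd : IsLocalData Φ μ ν) (hμ : ∀ k b, (0 : G) ≠ μ k + b) {P : UCoeff ι}
    (hP : single (0 : G) P ∈ univIdeal Φ μ ν) : P = 0 := by
  by_contra h0
  -- Powers of s can be cancelled by regularity. The cofactor Q is not divisible by s, and modulo s
  -- the ideal is generated by monomials none of which divides 1, so it does not contain Q.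
  obtain ⟨k, Q, hQ, hPQ⟩ : ∃ k Q, ¬ Polynomial.X ∣ Q ∧ P = Polynomial.X ^ k * Q := by
    obtain ⟨Q, hQ, hX⟩ := Polynomial.exists_eq_pow_rootMultiplicity_mul_and_not_dvd P h0 0
    rw [Polynomial.C_0, sub_zero] at hQ hX
    exact ⟨_, Q, hX, hQ⟩
  have key : ∀ k, single (0 : G) (Polynomial.X ^ k * Q) ∈ univIdeal Φ μ ν →
      single (0 : G) Q ∈ univIdeal Φ μ ν := by
    intro k
    induction k with
    | zero => simp
    | succ k ih =>
      intro h
      apply ih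
      refine univ_parameter_regular hd _ ?_
      rw [single_mul_single, zero_add, ← mul_assoc, ← pow_succ']
      exact h
  have hQI := key k (hPQ ▸ hP)
  have h2 : single (0 : G) Q ∈ Ideal.span {single (0 : G) (Polynomial.X : UCoeff ι)} ⊔
      Ideal.span ((fun k => single (μ k) (1 : UCoeff ι)) '' (Finset.univ : Finset κ)) := by
    rw [← span_sup_eq (F := univEq Φ μ ν) (fun k => ⟨_, localEq_eq _ _ _ _ _ _⟩)]
    refine Ideal.mem_sup_right ?_
    simpa using hQI
  rcases (mem_span_monomials _ _ _ _).1 h2 0 with h | ⟨k, -, b, hb⟩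
  · rw [coeff_single, Finsupp.single_eq_same] at h
    exact hQ h
  · exact hμ k b hb

end Family

/-! ### Integrality of the universal family -/

section Prime

/-- Solving one equation of the universal family for its coefficients, after a localization. -/
theorem exists_solution {ι W : Type*} [CommRing W] (I : Ideal W) {Φ : Finset ι} {x m : W}
    {β ν : ι → W} (hx : IsUnit x) (hF : m + ∑ α ∈ Φ, x * β α * ν α ∈ I)
    (h : (∃ α ∈ Φ, ν α = 1) ∨ (m = 1 ∧ IsUnit (∑ α ∈ Φ, x * β α * ν α))) :
    ∃ v : ι → W, (∀ α ∈ Φ, v α - β α ∈ I) ∧ m + ∑ α ∈ Φ, x * v α * ν α = 0 := by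
  rcases h with ⟨α₀, hα₀, hν⟩ | ⟨rfl, hu⟩
  · obtain ⟨x', hx'⟩ := hx.exists_right_inv
    -- The coefficient at α₀ is multiplied by the unit x alone, so the equation can be solved for it
    -- with the other coefficients unchanged.
    refine ⟨fun α => if α = α₀ then -x' * (m + ∑ α ∈ Φ.erase α₀, x * β α * ν α) else β α,
      fun α _ => ?_, ?_⟩
    · by_cases h : α = α₀
      · subst h
        dsimp only
        rw [if_pos rfl]
        rw [← Finset.add_sum_erase _ _ hα₀, hν] at hF
        have : -x' * (m + ∑ α ∈ Φ.erase α, x * β α * ν α) - β α =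
            -x' * (m + (x * β α * 1 + ∑ α ∈ Φ.erase α, x * β α * ν α)) := by
          linear_combination (β α) * hx'
        rw [this]
        exact I.mul_mem_left _ hF
      · dsimp only
        rw [if_neg h, sub_self]
        exact I.zero_mem
    · rw [← Finset.add_sum_erase _ _ hα₀]
      have : ∑ α ∈ Φ.erase α₀, x * (if α = α₀ then
          -x' * (m + ∑ α ∈ Φ.erase α₀, x * β α * ν α) else β α) * ν α =
          ∑ α ∈ Φ.erase α₀, x * β α * ν α :=
        Finset.sum_congr rfl fun α hα => by rw [if_neg (Finset.ne_of_mem_erase hα)]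
      dsimp only
      rw [this, if_pos rfl, hν]
      linear_combination (-(m + ∑ α ∈ Φ.erase α₀, x * β α * ν α)) * hx'
  · obtain ⟨y, hy⟩ := hu.exists_right_inv
    -- Here m = 1, and rescaling all coefficients by -y makes the sum equal to -1.
    refine ⟨fun α => -β α * y, fun α _ => ?_, ?_⟩
    · have : -β α * y - β α = -β α * y * (1 + ∑ α ∈ Φ, x * β α * ν α) := by
        linear_combination (β α) * hy
      rw [this]
      exact I.mul_mem_left _ hF
    · have : ∑ α ∈ Φ, x * (-β α * y) * ν α = -((∑ α ∈ Φ, x * β α * ν α) * y) := by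
        rw [Finset.sum_mul, ← Finset.sum_neg_distrib]
        exact Finset.sum_congr rfl fun α _ => by ring
      rw [this, hy]
      ring

/-- If the coefficients `β` of equations over a domain are variables that one can substitute for,
and each equation can be solved for its coefficients after a localization, then the equations
generate the kernel of a homomorphism to a domain. -/
theorem exists_ker_eq_span.{u} {Γ : Type u} {ι κ : Type*} [CommRing Γ] [IsDomain Γ] [Fintype κ] {Φ : κ → Finset ι}
    {x : Γ} {β ν : ι → Γ} {m : κ → Γ} {S : Set Γ}
    (hdisj : ∀ j k, j ≠ k → Disjoint (Φ j) (Φ k))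
    (hsub : ∀ (W : Type u) [CommRing W] (loc : Γ →+* W) (v : ι → W),
      ∃ Ψ : Γ →+* W, Ψ x = loc x ∧ (∀ α, Ψ (β α) = v α) ∧ (∀ g ∈ S, Ψ g = loc g) ∧
        ∀ 𝔞 : Ideal W, (∀ α, v α - loc (β α) ∈ 𝔞) → ∀ h, Ψ h - loc h ∈ 𝔞)
    (hm : ∀ j, m j ∈ S) (hν : ∀ α, ν α ∈ S) (hx : x ≠ 0)
    (hunit : ∀ j, (∃ α ∈ Φ j, ν α = 1) ∨ (m j = 1 ∧ ∑ α ∈ Φ j, x * β α * ν α ≠ 0))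
    (hreg : ∀ h, x * h ∈ Ideal.span (Set.range fun j => m j + ∑ α ∈ Φ j, x * β α * ν α) →
      h ∈ Ideal.span (Set.range fun j => m j + ∑ α ∈ Φ j, x * β α * ν α)) :
    ∃ (W : Type u) (_ : CommRing W) (_ : IsDomain W) (Ψ : Γ →+* W),
      (∀ h, Ψ h = 0 ↔ h ∈ Ideal.span (Set.range fun j => m j + ∑ α ∈ Φ j, x * β α * ν α)) ∧
      ∀ g ∈ S, g ≠ 0 → Ψ g ≠ 0 := by
  set I := Ideal.span (Set.range fun j => m j + ∑ α ∈ Φ j, x * β α * ν α) with hI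
  have hFI : ∀ j, m j + ∑ α ∈ Φ j, x * β α * ν α ∈ I := fun j => Ideal.subset_span ⟨j, rfl⟩
  -- When m j = 1, the rest of the equation is -1 modulo I, so inverting it leaves the quotient by I
  -- unchanged.
  have he : ∀ j, ∃ e : Γ, e ≠ 0 ∧ IsUnit (Ideal.Quotient.mk I e) ∧
      ((∃ α ∈ Φ j, ν α = 1) ∨ (m j = 1 ∧ e = ∑ α ∈ Φ j, x * β α * ν α)) := by
    intro j
    rcases hunit j with h | ⟨h1, h2⟩
    · exact ⟨1, one_ne_zero, by rw [map_one]; exact isUnit_one, Or.inl h⟩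
    · refine ⟨_, h2, ?_, Or.inr ⟨h1, rfl⟩⟩
      have h3 := hFI j
      rw [h1, add_comm, ← sub_neg_eq_add] at h3
      rw [Ideal.Quotient.eq.2 h3, map_neg, map_one]
      exact isUnit_one.neg
  choose e he0 heI heq using he
  set d : Γ := x * ∏ j, e j with hd₀
  have hd0 : d ≠ 0 := mul_ne_zero hx (Finset.prod_ne_zero_iff.2 fun j _ => he0 j)
  have hle : Submonoid.powers d ≤ nonZeroDivisors Γ :=
    powers_le_nonZeroDivisors_of_noZeroDivisors hd0
  set W := Localization.Away d
  have hdom : IsDomain W := IsLocalization.isDomain_localization hle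
  set loc : Γ →+* W := algebraMap Γ W with hloc
  have hinj : Function.Injective loc := IsLocalization.injective W hle
  have hunit : IsUnit (loc x * ∏ j, loc (e j)) := by
    rw [← map_prod, ← map_mul]
    exact IsLocalization.Away.algebraMap_isUnit (S := W) d
  have hxu : IsUnit (loc x) := isUnit_of_mul_isUnit_left hunit
  have heu : ∀ j, IsUnit (loc (e j)) := fun j =>
    isUnit_of_dvd_unit (Finset.dvd_prod_of_mem (fun j => loc (e j)) (Finset.mem_univ j))
      (isUnit_of_mul_isUnit_right hunit)
  have hsum : ∀ j, loc (∑ α ∈ Φ j, x * β α * ν α) =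
      ∑ α ∈ Φ j, loc x * loc (β α) * loc (ν α) := fun j => by
    rw [map_sum]
    exact Finset.sum_congr rfl fun α _ => by rw [map_mul, map_mul]
  have hsol : ∀ j, ∃ v : ι → W, (∀ α ∈ Φ j, v α - loc (β α) ∈ I.map loc) ∧
      loc (m j) + ∑ α ∈ Φ j, loc x * v α * loc (ν α) = 0 := by
    intro j
    refine exists_solution (I.map loc) (β := fun α => loc (β α)) (ν := fun α => loc (ν α)) hxu
      ?_ ?_
    · have := Ideal.mem_map_of_mem loc (hFI j)
      rwa [map_add, hsum] at this
    · rcases heq j with ⟨α, hα, hα0⟩ | ⟨h1, h2⟩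
      · exact Or.inl ⟨α, hα, by rw [hα0, map_one]⟩
      · exact Or.inr ⟨by rw [h1, map_one], by rw [← hsum, ← h2]; exact heu j⟩
  choose v hvI hv0 using hsol
  set V : ι → W := fun α => if h : ∃ j, α ∈ Φ j then v h.choose α else loc (β α) with hV
  have hVv : ∀ j, ∀ α ∈ Φ j, V α = v j α := by
    intro j α hα
    have hex : ∃ j, α ∈ Φ j := ⟨j, hα⟩
    simp only [hV, dif_pos hex]
    have : hex.choose = j := by
      by_contra hne
      exact Finset.disjoint_left.1 (hdisj _ _ hne) hex.choose_spec hα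
    rw [this]
  have hVI : ∀ α, V α - loc (β α) ∈ I.map loc := by
    intro α
    by_cases hex : ∃ j, α ∈ Φ j
    · obtain ⟨j, hj⟩ := hex
      rw [hVv j α hj]
      exact hvI j α hj
    · simp only [hV, dif_neg hex, sub_self]
      exact Ideal.zero_mem _
  -- Ψ substitutes the solutions for the coefficients. It kills the equations and agrees with `loc`
  -- modulo the extended ideal, so its kernel is the contraction of that ideal.
  obtain ⟨Ψ, hΨx, hΨβ, hΨS, hΨI⟩ := hsub W loc V
  have hcongr := hΨI _ hVI
  have hΨF : ∀ j, Ψ (m j + ∑ α ∈ Φ j, x * β α * ν α) = 0 := by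
    intro j
    rw [map_add, map_sum, hΨS _ (hm j), ← hv0 j]
    congr 1
    refine Finset.sum_congr rfl fun α hα => ?_
    rw [map_mul, map_mul, hΨx, hΨβ, hVv j α hα, hΨS _ (hν α)]
  refine ⟨W, inferInstance, hdom, Ψ, fun h => ⟨fun h0 => ?_, fun hh => ?_⟩, fun g hg hg0 => ?_⟩
  · have h1 : loc h ∈ I.map loc := by
      have := hcongr h
      rw [h0, zero_sub] at this
      exact neg_mem_iff.1 this
    rw [hloc, IsLocalization.algebraMap_mem_map_algebraMap_iff (Submonoid.powers d)] at h1
    obtain ⟨_, ⟨k, rfl⟩, hm⟩ := h1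
    -- To descend from the localization, the e j are cancelled as units modulo I and then x by
    -- `hreg`.
    have h4 : x ^ k * h ∈ I := by
      have h5 : IsUnit (Ideal.Quotient.mk I ((∏ j, e j) ^ k)) := by
        rw [map_pow, map_prod]
        exact IsUnit.pow _ (IsUnit.prod_univ_iff.2 heI)
      rw [← Ideal.Quotient.eq_zero_iff_mem] at hm ⊢
      dsimp only at hm
      rw [hd₀, mul_pow, mul_comm (x ^ k), mul_assoc, map_mul] at hm
      exact (h5.mul_right_eq_zero).1 hm
    have h6 : ∀ k, x ^ k * h ∈ I → h ∈ I := by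
      intro k
      induction k with
      | zero => simp
      | succ k ih =>
        intro hk
        apply ih
        refine hreg _ ?_
        rw [← mul_assoc, ← pow_succ']
        exact hk
    exact h6 k h4
  · have : I ≤ RingHom.ker Ψ := by
      rw [hI, Ideal.span_le]
      rintro _ ⟨j, rfl⟩
      exact hΨF j
    exact this hh
  · rw [hΨS g hg]
    intro h0
    exact hg0 (hinj (h0.trans (map_zero loc).symm))

variable {G ι κ : Type*} [AddCommMonoid G]

open AddMonoidAlgebra in
-- Supplies the hypothesis `hsub` of `exists_ker_eq_span`: the b_α are free variables, so their
-- images can be changed independently. Two ring homomorphisms that agree on generators modulo 𝔞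
-- agree everywhere modulo 𝔞.
theorem exists_substitution {W : Type*} [CommRing W] (loc : AddMonoidAlgebra (UCoeff ι) G →+* W)
    (v : ι → W) : ∃ Ψ : AddMonoidAlgebra (UCoeff ι) G →+* W,
      Ψ (single 0 Polynomial.X) = loc (single 0 Polynomial.X) ∧
      (∀ α, Ψ (single 0 (Polynomial.C (MvPolynomial.X α))) = v α) ∧
      (∀ g, Ψ (single g 1) = loc (single g 1)) ∧
      ∀ 𝔞 : Ideal W, (∀ α, v α - loc (single 0 (Polynomial.C (MvPolynomial.X α))) ∈ 𝔞) →
        ∀ h, Ψ h - loc h ∈ 𝔞 := by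
  set loc₀ : UCoeff ι →+* W := loc.comp singleZeroRingHom with hloc₀
  have hl : ∀ a, loc₀ a = loc (single 0 a) := fun a => rfl
  set f : UCoeff ι →+* W := Polynomial.eval₂RingHom
    (MvPolynomial.eval₂Hom (loc₀.comp (Polynomial.C.comp MvPolynomial.C)) v)
    (loc₀ Polynomial.X) with hf
  set Ψ : AddMonoidAlgebra (UCoeff ι) G →+* W :=
    liftNCRingHom f ((loc : _ →* W).comp (AddMonoidAlgebra.of (UCoeff ι) G))
    (fun _ _ => Commute.all _ _) with hΨ
  have hΨs : ∀ g a, Ψ (single g a) = f a * loc (single g 1) := by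
    intro g a
    rw [hΨ, liftNCRingHom_single]
    rfl
  have hone : loc (single (0 : G) 1) = 1 := by
    rw [← AddMonoidAlgebra.one_def, map_one]
  refine ⟨Ψ, ?_, fun α => ?_, fun g => ?_, fun 𝔞 h𝔞 h => ?_⟩
  · rw [hΨs, hone, mul_one, hf, ← hl]
    simp
  · rw [hΨs, hone, mul_one, hf]
    simp
  · rw [hΨs, map_one, one_mul]
  · rw [← Ideal.Quotient.eq]
    have : (Ideal.Quotient.mk 𝔞).comp Ψ = (Ideal.Quotient.mk 𝔞).comp loc := by
      refine AddMonoidAlgebra.ringHom_ext (fun a => ?_) (fun g => ?_)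
      · have h2 : (Ideal.Quotient.mk 𝔞).comp f = (Ideal.Quotient.mk 𝔞).comp loc₀ := by
          refine Polynomial.ringHom_ext' ?_ ?_
          · refine MvPolynomial.ringHom_ext (fun z => ?_) (fun α => ?_)
            · simp only [hf, RingHom.comp_apply, Polynomial.coe_eval₂RingHom, Polynomial.eval₂_C,
                MvPolynomial.coe_eval₂Hom, MvPolynomial.eval₂_C]
            · simp only [hf, RingHom.comp_apply, Polynomial.coe_eval₂RingHom, Polynomial.eval₂_C,
                MvPolynomial.coe_eval₂Hom, MvPolynomial.eval₂_X]
              exact Ideal.Quotient.eq.2 (h𝔞 α)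
          · simp only [hf, RingHom.comp_apply, Polynomial.coe_eval₂RingHom, Polynomial.eval₂_X]
        have h3 := congrArg (fun φ => φ a) h2
        simp only [RingHom.comp_apply] at h3 ⊢
        rw [hΨs, hone, mul_one, h3, hl]
      · simp only [RingHom.comp_apply]
        rw [hΨs, map_one, one_mul]
    exact congrArg (fun φ => φ h) this

open AddMonoidAlgebra in
theorem localEq_eq_sum {R : Type*} [CommRing R] (Φ : κ → Finset ι) (μ : κ → G) (ν : ι → G) (s : R)
    (b : ι → R) : localEq Φ μ ν s b = fun j => single (μ j) 1 +
      ∑ α ∈ Φ j, single 0 s * single 0 (b α) * single (ν α) 1 := by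
  funext j
  rw [localEq_eq, Finset.mul_sum]
  congr 1
  exact Finset.sum_congr rfl fun α _ => by rw [mul_assoc]

open AddMonoidAlgebra in
theorem univIdeal_eq (Φ : κ → Finset ι) (μ : κ → G) (ν : ι → G) :
    univIdeal Φ μ ν = Ideal.span (Set.range fun j => single (μ j) 1 + ∑ α ∈ Φ j,
      single 0 Polynomial.X * single 0 (Polynomial.C (MvPolynomial.X α)) * single (ν α) 1) :=
  congrArg (fun f => Ideal.span (Set.range f)) (localEq_eq_sum Φ μ ν _ _)

open AddMonoidAlgebra in
theorem univEq_sum_ne_zero {Φ : Finset ι} (hΦ : Φ.Nonempty) (ν : ι → G) :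
    (∑ α ∈ Φ, single 0 Polynomial.X * single 0 (Polynomial.C (MvPolynomial.X α)) *
      single (ν α) 1 : AddMonoidAlgebra (UCoeff ι) G) ≠ 0 := by
  intro h0
  obtain ⟨α₀, hα₀⟩ := hΦ
  -- Setting s = 1, b_{α₀} = 1 and the other coefficients to 0 leaves a single monomial.
  have h1 := congrArg (mapRingHom G ((Polynomial.evalRingHom (1 : ℂ)).comp
    (Polynomial.mapRingHom (MvPolynomial.eval fun α => if α = α₀ then (1 : ℂ) else 0)))) h0
  rw [map_zero, map_sum, Finset.sum_eq_single α₀] at h1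
  · simp at h1
  · intro α _ hα
    simp [hα]
  · exact fun h => absurd hα₀ h

open AddMonoidAlgebra in
/-- The universal family is cut out by the kernel of a homomorphism to a domain in which monomials
do not vanish. -/
theorem exists_ker_eq_univIdeal.{u, v, w} {G : Type u} {ι : Type v} {κ : Type w}
    [AddCommMonoid G] [IsCancelAdd G] [Fintype κ] [UniqueSums G] {Φ : κ → Finset ι} {μ : κ → G}
    {ν : ι → G} (hd : IsLocalData Φ μ ν) :
    ∃ (W : Type (max u v)) (_ : CommRing W) (_ : IsDomain W)
      (Ψ : AddMonoidAlgebra (UCoeff ι) G →+* W),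
      (∀ h, Ψ h = 0 ↔ h ∈ univIdeal Φ μ ν) ∧ ∀ g, Ψ (single g 1) ≠ 0 := by
  have hs : ∀ g : G, single g (1 : UCoeff ι) ≠ 0 := fun g h =>
    one_ne_zero (AddMonoidAlgebra.single_eq_zero.1 h)
  have hreg : ∀ h, single 0 Polynomial.X * h ∈ univIdeal Φ μ ν → h ∈ univIdeal Φ μ ν :=
    fun h => univ_parameter_regular hd _
  have hunit : ∀ j, (∃ α ∈ Φ j, single (ν α) (1 : UCoeff ι) = 1) ∨
      (single (μ j) (1 : UCoeff ι) = 1 ∧ (∑ α ∈ Φ j, single 0 Polynomial.X *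
        single 0 (Polynomial.C (MvPolynomial.X α)) * single (ν α) 1 :
          AddMonoidAlgebra (UCoeff ι) G) ≠ 0) := by
    intro j
    rcases hd.unit j with h | ⟨α, hα, hα0⟩
    · exact Or.inr ⟨by rw [h, AddMonoidAlgebra.one_def], univEq_sum_ne_zero (hd.nonempty j) ν⟩
    · exact Or.inl ⟨α, hα, by rw [hα0, AddMonoidAlgebra.one_def]⟩
  rw [univIdeal_eq] at hreg
  have key := exists_ker_eq_span
    (Φ := Φ) (S := Set.range fun g : G => single g (1 : UCoeff ι))
    (x := single (0 : G) (Polynomial.X : UCoeff ι))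
    (β := fun α => single (0 : G) (Polynomial.C (MvPolynomial.X α)))
    (ν := fun α => single (ν α) (1 : UCoeff ι)) (m := fun j => single (μ j) (1 : UCoeff ι))
    hd.disjoint (fun W _ loc v => by
      obtain ⟨Ψ, a1, a2, a3, a4⟩ := exists_substitution loc v
      exact ⟨Ψ, a1, a2, by rintro _ ⟨g, rfl⟩; exact a3 g, a4⟩)
    (fun j => ⟨_, rfl⟩) (fun α => ⟨_, rfl⟩)
    (fun h => Polynomial.X_ne_zero (AddMonoidAlgebra.single_eq_zero.1 h))
    hunit hreg
  rw [← univIdeal_eq] at key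
  obtain ⟨W, hW, hdom, Ψ, h1, h2⟩ := key
  exact ⟨W, hW, hdom, Ψ, h1, fun g => h2 _ ⟨g, rfl⟩ (hs g)⟩

end Prime

/-! ### Torsion-freeness of general fibers -/

section GenericFlatness
variable {G : Type*} [AddCommMonoid G]

open AddMonoidAlgebra in
theorem mapRingHom_surjective {R R' : Type*} [CommRing R] [CommRing R'] {φ : R →+* R'}
    (hφ : Function.Surjective φ) : Function.Surjective (mapRingHom G φ) := by
  intro x
  induction x using AddMonoidAlgebra.induction_linear with
  | zero => exact ⟨0, map_zero _⟩
  | add x y hx hy =>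
    obtain ⟨a, rfl⟩ := hx
    obtain ⟨b, rfl⟩ := hy
    exact ⟨a + b, map_add _ _ _⟩
  | single g r =>
    obtain ⟨a, rfl⟩ := hφ r
    exact ⟨single g a, by simp⟩

open AddMonoidAlgebra in
theorem ker_mapRingHom_eq_map {R R' : Type*} [CommRing R] [CommRing R'] (φ : R →+* R') :
    RingHom.ker (mapRingHom G φ) =
      (RingHom.ker φ).map (algebraMap R (AddMonoidAlgebra R G)) := by
  apply le_antisymm
  · intro x hx
    rw [RingHom.mem_ker] at hx
    rw [← AddMonoidAlgebra.sum_coeff_single x, Finsupp.sum]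
    refine Ideal.sum_mem _ fun a _ => ?_
    have h1 : φ (x.coeff a) = 0 := by
      have := congrArg (fun y => y.coeff a) hx
      simpa using this
    rw [show single a (x.coeff a) = algebraMap R (AddMonoidAlgebra R G) (x.coeff a) *
      single a 1 by simp [single_mul_single]]
    exact Ideal.mul_mem_right _ _ (Ideal.mem_map_of_mem _ h1)
  · rw [Ideal.map_le_iff_le_comap]
    intro r hr
    rw [RingHom.mem_ker] at hr
    simp [Ideal.mem_comap, RingHom.mem_ker, hr]

/-- Regularity of q passes from the family J to its fiber J + K. If q y = i + e with e ∈ K, then e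
lies in (J + (q)) ∩ K, which up to powers of p is K (J + (q)). So p^l e = i' + z q with i' ∈ J and z
∈ K, and q cancels modulo J. -/
theorem mem_sup_of_pow_mul_mem {B : Type*} [CommRing B] {J K : Ideal B} {p q : B}
    (hq : ∀ h, q * h ∈ J → h ∈ J)
    (hGF : ∀ f ∈ J ⊔ Ideal.span {q}, f ∈ K → ∃ N : ℕ, p ^ N * f ∈ K * (J ⊔ Ideal.span {q}))
    (hp : ∀ (N : ℕ) (y : B), p ^ N * y ∈ J ⊔ K → y ∈ J ⊔ K) (N : ℕ) (y : B)
    (hy : q ^ N * y ∈ J ⊔ K) : y ∈ J ⊔ K := by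
  have hpeel : ∀ y, q * y ∈ J ⊔ K → y ∈ J ⊔ K := by
    intro y hy
    obtain ⟨i, hi, e, he, hie⟩ := Submodule.mem_sup.1 hy
    have he2 : e ∈ J ⊔ Ideal.span {q} := by
      rw [show e = q * y - i by rw [← hie]; ring]
      exact sub_mem (Ideal.mem_sup_right (Ideal.mul_mem_right _ _ (Ideal.subset_span rfl)))
        (Ideal.mem_sup_left hi)
    obtain ⟨l, hl⟩ := hGF e he2 he
    rw [Ideal.mul_sup] at hl
    obtain ⟨i', hi', e', he', hie'⟩ := Submodule.mem_sup.1 hl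
    rw [Ideal.mem_mul_span_singleton] at he'
    obtain ⟨z, hz, rfl⟩ := he'
    have h2 : q * (p ^ l * y - z) ∈ J := by
      rw [show q * (p ^ l * y - z) = p ^ l * i + i' by linear_combination -p ^ l * hie - hie']
      exact add_mem (Ideal.mul_mem_left _ _ hi) ((Ideal.mul_le_right : K * J ≤ J) hi')
    refine hp l y ?_
    rw [show p ^ l * y = (p ^ l * y - z) + z by ring]
    exact add_mem (Ideal.mem_sup_left (hq _ h2)) (Ideal.mem_sup_right hz)
  induction N with
  | zero => simpa using hy
  | succ N ih =>
    rw [pow_succ', mul_assoc] at hy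
    exact ih (hpeel _ hy)

open AddMonoidAlgebra in
/-- The fibers of the universal family over general coefficients `b` are torsion-free
over `ℂ[s]`. -/
theorem exists_generic_torsionFree {ι κ : Type*} [IsCancelAdd G] [Fintype κ] [UniqueSums G]
    [AddMonoid.FG G]
    {Φ : κ → Finset ι} {μ : κ → G} {ν : ι → G} (hd : IsLocalData Φ μ ν)
    (hcap : ∀ P : UCoeff ι, single (0 : G) P ∈ univIdeal Φ μ ν → P = 0) :
    ∃ P : MvPolynomial ι ℂ, P ≠ 0 ∧ ∀ b : ι → ℂ, MvPolynomial.eval b P ≠ 0 →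
      ∀ p : ℂ[X], p ≠ 0 → ∀ x : AddMonoidAlgebra ℂ[X] G,
        single 0 p * x ∈ Ideal.span (Set.range
          (localEq Φ μ ν Polynomial.X (fun α => Polynomial.C (b α)))) →
        x ∈ Ideal.span (Set.range
          (localEq Φ μ ν Polynomial.X (fun α => Polynomial.C (b α)))) := by
  obtain ⟨W, _, _, Ψ, hΨ, -⟩ := exists_ker_eq_univIdeal hd
  have hN : ∀ P : UCoeff ι, P ≠ 0 → ∀ h, single (0 : G) P * h ∈ univIdeal Φ μ ν →
      h ∈ univIdeal Φ μ ν := by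
    intro P hP h hh
    rw [← hΨ, map_mul] at hh
    rcases mul_eq_zero.1 hh with h0 | h0
    · exact absurd (hcap P ((hΨ _).1 h0)) hP
    · exact (hΨ _).1 h0
  set J := univIdeal Φ μ ν with hJdef
  -- Over ℂ[b][s] this shows that torsion of a fiber is killed by a power of Q.
  obtain ⟨Q, hQ0, hQ⟩ := generic_freeness (A := UCoeff ι) (B := AddMonoidAlgebra (UCoeff ι) G) J
  have : Algebra.FiniteType (MvPolynomial ι ℂ) (AddMonoidAlgebra (UCoeff ι) G) :=
    Algebra.FiniteType.trans (S := UCoeff ι) inferInstance inferInstance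
  -- Q still depends on s and may vanish at some points of the line over b. Generic freeness over
  -- ℂ[b] alone, for the locus Q = 0 of the family, shows that Q is a nonzerodivisor on general
  -- fibers. The factor `Q.leadingCoeff` below keeps Q nonzero after specialization of b.
  obtain ⟨P₃, hP0, hP⟩ := generic_freeness (A := MvPolynomial ι ℂ)
    (B := AddMonoidAlgebra (UCoeff ι) G)    (J ⊔ Ideal.span {single (0 : G) Q})
  refine ⟨P₃ * Q.leadingCoeff, mul_ne_zero hP0 (Polynomial.leadingCoeff_ne_zero.2 hQ0),
    fun b hb p hp x hx => ?_⟩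
  rw [map_mul] at hb
  set ev : MvPolynomial ι ℂ →+* ℂ := MvPolynomial.eval b
  set φ : UCoeff ι →+* ℂ[X] := Polynomial.mapRingHom ev
  set F : (AddMonoidAlgebra (UCoeff ι) G) →+* AddMonoidAlgebra ℂ[X] G := mapRingHom G φ
  have hev : Function.Surjective ev := fun z => ⟨MvPolynomial.C z, by simp [ev]⟩
  have hφ : Function.Surjective φ := Polynomial.map_surjective ev hev
  have hF : Function.Surjective F := mapRingHom_surjective hφ
  have hker : RingHom.ker F = (RingHom.ker φ).map (algebraMap (UCoeff ι) (AddMonoidAlgebra (UCoeff ι) G)) :=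
    ker_mapRingHom_eq_map φ
  have hker' : RingHom.ker F = (RingHom.ker ev).map (algebraMap (MvPolynomial ι ℂ) (AddMonoidAlgebra (UCoeff ι) G)) := by
    rw [hker, Polynomial.ker_mapRingHom, Ideal.map_map]
    rfl
  have hJ : Ideal.span (Set.range
      (localEq Φ μ ν Polynomial.X (fun α => Polynomial.C (b α)))) = J.map F := by
    rw [Ideal.map_span, ← Set.range_comp]
    congr 2
    funext j
    rw [Function.comp_apply, map_localEq]
    simp [φ, ev]
  have hmem : ∀ y, y ∈ J ⊔ RingHom.ker F ↔ F y ∈ J.map F := by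
    intro y
    rw [← Ideal.comap_map_of_surjective' F hF, Ideal.mem_comap]
  rw [hJ] at hx ⊢
  obtain ⟨p', rfl⟩ := hφ p
  obtain ⟨x', rfl⟩ := hF x
  have hp' : p' ∉ RingHom.ker φ := hp
  have hQφ : Q ∉ RingHom.ker φ := by
    intro h
    rw [RingHom.mem_ker] at h
    have := congrArg (fun q => q.coeff Q.natDegree) h
    simp only [φ, Polynomial.coe_mapRingHom, Polynomial.coeff_map, Polynomial.coeff_zero] at this
    exact (mul_ne_zero_iff.1 hb).2 this
  have hPev : P₃ ∉ RingHom.ker ev := (mul_ne_zero_iff.1 hb).1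
  have h1 : algebraMap (UCoeff ι) (AddMonoidAlgebra (UCoeff ι) G) p' * x' ∈ J ⊔ RingHom.ker F := by
    rw [hmem, map_mul]
    simpa [F] using hx
  obtain ⟨N, hN1⟩ := (hQ _ (RingHom.ker_isPrime φ) hQφ).1 p' hp' x'
    (by rw [← hker, Algebra.smul_def]; exact h1)
  rw [← hker, Algebra.smul_def, map_pow] at hN1
  have hunit : IsUnit (F (algebraMap (MvPolynomial ι ℂ) (AddMonoidAlgebra (UCoeff ι) G) P₃)) := by
    have h5 : F (algebraMap (MvPolynomial ι ℂ) (AddMonoidAlgebra (UCoeff ι) G) P₃) =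
        algebraMap ℂ _ (ev P₃) := by
      simp [F, φ]
    rw [h5]
    exact (IsUnit.mk0 _ hPev).map _
  refine (hmem _).1 (mem_sup_of_pow_mul_mem (p := algebraMap (MvPolynomial ι ℂ) _ P₃)
    (hN Q hQ0) (fun f hf hfK => ?_) (fun N y hy => ?_) N x' hN1)
  · obtain ⟨l, hl⟩ := (hP _ (RingHom.ker_isPrime ev) hPev).2 f hf (hker' ▸ hfK)
    rw [← hker', Algebra.smul_def, map_pow] at hl
    exact ⟨l, hl⟩
  · rw [hmem, map_mul, map_pow] at hy
    rw [hmem]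
    exact (Ideal.unit_mul_mem_iff_mem _ (hunit.pow N)).1 hy

end GenericFlatness

/-! ### Ideals on charts -/

section Charts

open AddMonoidAlgebra in
/-- The extension of monoid algebras for a submonoid that is closed under differences has a
retraction, so that ideals are contracted. -/
theorem comap_map_mapDomainRingHom {R G H : Type*} [CommRing R] [AddCommMonoid G] [AddCommMonoid H]
    (f : G →+ H) (hf : Function.Injective f) (hsat : ∀ g h a, f g + a = f h → ∃ k, f k = a)
    (I : Ideal (AddMonoidAlgebra R G)) :
    (I.map (mapDomainRingHom R f)).comap (mapDomainRingHom R f) = I := by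
  refine le_antisymm ?_ Ideal.le_comap_map
  have hret : ∀ x : AddMonoidAlgebra R G, comapDomain f hf (mapDomainRingHom R f x) = x := by
    intro x
    induction x using AddMonoidAlgebra.induction_linear with
    | zero => simp
    | add x y hx hy => rw [map_add, comapDomain_add, hx, hy]
    | single g r => simp [mapDomainRingHom_apply]
  have hsingle : ∀ a r, ∀ x ∈ I, comapDomain f hf (single a r * mapDomainRingHom R f x) ∈ I := by
    intro a r x hx
    by_cases ha : ∃ k, f k = a
    · obtain ⟨k, rfl⟩ := ha
      rw [show single (f k) r * mapDomainRingHom R f x = mapDomainRingHom R f (single k r * x) by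
        rw [map_mul]; simp [mapDomainRingHom_apply], hret]
      exact I.mul_mem_left _ hx
    · have : ∀ x, comapDomain f hf (single a r * mapDomainRingHom R f x) = 0 := by
        intro x
        induction x using AddMonoidAlgebra.induction_linear with
        | zero => simp
        | add x y hx hy => rw [map_add, mul_add, comapDomain_add, hx, hy, add_zero]
        | single g s =>
          rw [mapDomainRingHom_apply, mapDomain_single, single_mul_single]
          ext h
          rw [coeff_comapDomain, Finsupp.comapDomain_apply, coeff_single, Finsupp.single_apply,
            if_neg, coeff_zero, Finsupp.zero_apply]
          exact fun hh => ha (hsat g h a (by rw [add_comm]; exact hh))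
      rw [this]
      exact I.zero_mem
  have key : ∀ y ∈ I.map (mapDomainRingHom R f), ∀ z, comapDomain f hf (z * y) ∈ I := by
    intro y hy
    refine Submodule.span_induction (p := fun y _ => ∀ z, comapDomain f hf (z * y) ∈ I)
      ?_ ?_ ?_ ?_ hy
    · rintro _ ⟨x, hx, rfl⟩ z
      induction z using AddMonoidAlgebra.induction_linear with
      | zero => simp
      | add z z' hz hz' =>
        rw [add_mul, comapDomain_add]
        exact I.add_mem hz hz'
      | single a r => exact hsingle a r x hx
    · simp
    · intro x y _ _ hx hy z
      rw [mul_add, comapDomain_add]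
      exact I.add_mem (hx z) (hy z)
    · intro a x _ hx z
      rw [smul_eq_mul, ← mul_assoc]
      exact hx _
  intro x hx
  have := key _ (Ideal.mem_comap.1 hx) 1
  rwa [one_mul, hret] at this

variable {n c : ℕ} {V : Finset (Lat n)} {J : Fin c → Finset (Lat n)}

/-- Indicator exponents. -/
def indicator (V D : Finset (Lat n)) : V →₀ ℕ :=
  Finsupp.equivFunOnFinite.symm fun r => if (r : Lat n) ∈ D then 1 else 0

theorem prod_X_pow_eq {R : Type*} [CommRing R] (e : V → ℕ) :
    (∏ r : V, (MvPolynomial.X r ^ e r : MvPolynomial V R)) =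
      MvPolynomial.monomial (Finsupp.equivFunOnFinite.symm e) 1 := by
  rw [MvPolynomial.monomial_eq, map_one, one_mul, Finsupp.prod_fintype _ _ (fun _ => pow_zero _)]
  rfl

theorem divMonomial_eq (D : Finset (Lat n)) :
    divMonomial V D = MvPolynomial.monomial (indicator V D) 1 := by
  rw [indicator, ← prod_X_pow_eq, divMonomial]
  refine Finset.prod_congr rfl fun r _ => ?_
  split_ifs <;> simp

/-- The exponents of the Cox monomial of a section. -/
def sectionExponent (V D : Finset (Lat n)) (u : Lat n) : V →₀ ℕ :=
  Finsupp.equivFunOnFinite.symm fun r =>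
    ((if (r : Lat n) ∈ D then 1 else 0) + u ⬝ᵥ (r : Lat n)).toNat

theorem sectionMonomial_eq (D : Finset (Lat n)) (u : Lat n) :
    sectionMonomial V D u = MvPolynomial.monomial (sectionExponent V D u) 1 :=
  prod_X_pow_eq _

theorem sectionExponent_apply {D : Finset (Lat n)} {u : Lat n} (hu : u ∈ divSections V D) (r : V) :
    (sectionExponent V D u r : ℤ) = (if (r : Lat n) ∈ D then 1 else 0) + u ⬝ᵥ (r : Lat n) := by
  have := hu r r.2
  simp only [sectionExponent, Finsupp.equivFunOnFinite_symm_apply_apply]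
  rw [Int.toNat_of_nonneg]
  split_ifs at this ⊢ <;> omega

theorem monomial_mem_specialIdeal {e : V →₀ ℕ} :
    MvPolynomial.monomial e (1 : ℂ) ∈ specialIdeal V J ↔
      ∃ k, ∀ r : V, (r : Lat n) ∈ J k → 1 ≤ e r := by
  have : specialIdeal V J = Ideal.span ((fun s => MvPolynomial.monomial s (1 : ℂ)) ''
      Set.range fun k => indicator V (J k)) := by
    rw [specialIdeal, ← Set.range_comp]
    congr 2
    funext k
    exact divMonomial_eq _
  rw [this, MvPolynomial.mem_ideal_span_monomial_image]
  simp only [MvPolynomial.support_monomial, if_neg one_ne_zero, Finset.mem_singleton,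
    forall_eq, Set.exists_range_iff]
  refine exists_congr fun k => ?_
  rw [Finsupp.le_def]
  refine forall_congr' fun r => ?_
  simp only [indicator, Finsupp.equivFunOnFinite_symm_apply_apply]
  split_ifs with h <;> simp [h]

/-- A monomial avoids I₀ when every part J_k contains a variable of exponent 0; for a section of E_j
the exponent at r ∈ J_k is δ_jk + ⟨u, r⟩. -/
theorem mem_freeSections_iff (hJ : IsNefPartition V J) {j : Fin c} {u : Lat n} :
    u ∈ freeSections V J j ↔ u ∈ divSections V (J j) ∧
      ∀ k, ∃ r ∈ J k, u ⬝ᵥ r = if j = k then -1 else 0 := by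
  refine and_congr_right fun hu => ?_
  rw [sectionMonomial_eq, monomial_mem_specialIdeal]
  push Not
  refine forall_congr' fun k => ?_
  constructor
  · rintro ⟨r, hr, h⟩
    refine ⟨r, hr, ?_⟩
    have h1 := sectionExponent_apply hu r
    simp only [hJ.mem_part_iff hr, eq_comm (a := k)] at h1
    split_ifs at h1 ⊢ <;> omega
  · rintro ⟨r, hr, h⟩
    refine ⟨⟨r, hJ.subset k hr⟩, hr, ?_⟩
    have h1 := sectionExponent_apply hu ⟨r, hJ.subset k hr⟩
    simp only [hJ.mem_part_iff hr, eq_comm (a := k)] at h1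
    split_ifs at h1 h <;> omega

theorem freeSections_disjoint (hJ : IsNefPartition V J) {j k : Fin c} (hjk : j ≠ k) {u : Lat n}
    (hj : u ∈ freeSections V J j) (hk : u ∈ freeSections V J k) : False := by
  obtain ⟨r, hr, h⟩ := ((mem_freeSections_iff hJ).1 hk).2 k
  have h1 := hj.1 r (hJ.subset k hr)
  rw [h, if_pos rfl] at h1
  simp only [hJ.mem_part_iff hr, hjk.symm, if_false] at h1
  omega

theorem finite_freeSections (h : IsNefFan V J) (j : Fin c) : (freeSections V J j).Finite :=
  (finite_divSections h.interior (J j)).subset fun _ hu => hu.1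

/-- This is where the full Newton polytopes enter the charts: E_j is generated on every cone by m_j,
the section u = 0, or by a free section. -/
theorem exists_local_generators (h : IsNefFan V J) (hfull : HasFullNewtonPolytopes V J)
    {τ : Finset (Lat n)} (hτ : IsCone V τ) (j : Fin c) :
    ∃ u : Lat n, (u = 0 ∨ u ∈ freeSections V J j) ∧
      ∀ r ∈ τ, u ⬝ᵥ r = if r ∈ J j then -1 else 0 := by
  obtain ⟨u, hu, hur⟩ := h.nef.generated j τ hτ
  have hτV : τ ⊆ V := by
    obtain ⟨w, -, rfl⟩ := hτ
    exact Finset.filter_subset _ _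
  have h1 := toVec_mem_sectionPolytope hu
  rw [← hfull j] at h1
  have hS : ∀ p ∈ insert (0 : Vec n) (toVec '' freeSections V J j),
      p ∈ sectionPolytope V (J j) := fun p hp => by
    rw [← hfull j]
    exact subset_convexHull ℝ _ hp
  obtain ⟨p, hp, hpr⟩ := exists_mem_faces τ (fun r => toVec r)
    (fun r => (if r ∈ J j then -1 else 0 : ℝ))
    (fun r hr p hp => le_of_mem_sectionPolytope (hS p hp) (hτV hr)) h1 (fun r hr => by
      rw [toVec_dotProduct, hur r hr]
      split_ifs <;> simp)
  obtain ⟨v, hv, rfl⟩ : ∃ v : Lat n, (v = 0 ∨ v ∈ freeSections V J j) ∧ toVec v = p := by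
    rcases hp with rfl | ⟨v, hv, rfl⟩
    · exact ⟨0, Or.inl rfl, by simp⟩
    · exact ⟨v, Or.inr hv, rfl⟩
  refine ⟨v, hv, fun r hr => ?_⟩
  have := hpr r hr
  rw [toVec_dotProduct] at this
  split_ifs at this ⊢ <;> exact_mod_cast this

theorem freeSections_nonempty (h : IsNefFan V J) (hfull : HasFullNewtonPolytopes V J)
    (hX : ∃ τ, IsCone V τ ∧ ∀ j, (τ ∩ J j).Nonempty) (j : Fin c) :
    (freeSections V J j).Nonempty := by
  obtain ⟨τ, hτ, hτJ⟩ := hX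
  obtain ⟨u, hu, hur⟩ := exists_local_generators h hfull hτ j
  obtain ⟨r, hr⟩ := hτJ j
  rw [Finset.mem_inter] at hr
  refine ⟨u, hu.resolve_left ?_⟩
  rintro rfl
  have := hur r hr.1
  simp [hr.2] at this

end Charts

/-! ### Local equations of the canonical degeneration -/

section ChartEquations
variable {n c : ℕ} {V : Finset (Lat n)} {J : Fin c → Finset (Lat n)} {τ : Finset (Lat n)}

theorem mem_dualMonoid {u : Lat n} : u ∈ dualMonoid τ ↔ ∀ r ∈ τ, 0 ≤ u ⬝ᵥ r := Iff.rfl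

theorem IsCone.subset (hτ : IsCone V τ) : τ ⊆ V := by
  obtain ⟨w, -, rfl⟩ := hτ
  exact Finset.filter_subset _ _

/-- A lattice point as an element of the monoid `dualMonoid τ`. -/
def toDual (τ : Finset (Lat n)) (u : Lat n) : dualMonoid τ :=
  if h : u ∈ dualMonoid τ then ⟨u, h⟩ else 0

theorem coe_toDual {u : Lat n} (h : u ∈ dualMonoid τ) : (toDual τ u : Lat n) = u := by
  rw [toDual, dif_pos h]

/-- Sections generating the sheaves of the nef partition on the chart `τ`. -/
structure IsGenerators (V : Finset (Lat n)) (J : Fin c → Finset (Lat n)) (τ : Finset (Lat n))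
    (u : Fin c → Lat n) : Prop where
  free : ∀ j, u j = 0 ∨ u j ∈ freeSections V J j
  value : ∀ j, ∀ r ∈ τ, u j ⬝ᵥ r = if r ∈ J j then -1 else 0

theorem exists_isGenerators (h : IsNefFan V J) (hfull : HasFullNewtonPolytopes V J)
    (hτ : IsCone V τ) : ∃ u, IsGenerators V J τ u := by
  choose u hu hu' using fun j => exists_local_generators h hfull hτ j
  exact ⟨u, hu, hu'⟩

/-- The set of free sections as a finset. -/
def freeFinset (V : Finset (Lat n)) (J : Fin c → Finset (Lat n)) (j : Fin c) : Finset (Lat n) :=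
  if h : (freeSections V J j).Finite then h.toFinset else ∅

theorem IsNefFan.mem_freeFinset (h : IsNefFan V J) {j : Fin c} {u : Lat n} :
    u ∈ freeFinset V J j ↔ u ∈ freeSections V J j := by
  rw [freeFinset, dif_pos (finite_freeSections h j), Set.Finite.mem_toFinset]

/-- The exponents of `m_j` on a chart. -/
def chartMu (τ : Finset (Lat n)) (u : Fin c → Lat n) (j : Fin c) : dualMonoid τ := toDual τ (-u j)

/-- The exponents of the free sections on a chart. -/
def chartNu (V : Finset (Lat n)) (J : Fin c → Finset (Lat n)) (τ : Finset (Lat n))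
    (u : Fin c → Lat n) (α : Lat n) : dualMonoid τ :=
  if h : ∃ j, α ∈ freeSections V J j then toDual τ (α - u h.choose) else 0

variable {u : Fin c → Lat n}

theorem IsGenerators.coe_chartMu (hu : IsGenerators V J τ u) (j : Fin c) :
    (chartMu τ u j : Lat n) = -u j := by
  refine coe_toDual fun r hr => ?_
  rw [neg_dotProduct, hu.value j r hr]
  split_ifs <;> norm_num

theorem IsGenerators.sub_mem_dualMonoid (hu : IsGenerators V J τ u) (hτ : IsCone V τ) {j : Fin c}
    {α : Lat n} (hα : α ∈ divSections V (J j)) : α - u j ∈ dualMonoid τ := by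
  intro r hr
  rw [sub_dotProduct, hu.value j r hr]
  have := hα r (hτ.subset hr)
  omega

theorem IsGenerators.coe_chartNu (hJ : IsNefPartition V J) (hu : IsGenerators V J τ u)
    (hτ : IsCone V τ) {j : Fin c} {α : Lat n} (hα : α ∈ freeSections V J j) :
    (chartNu V J τ u α : Lat n) = α - u j := by
  have hex : ∃ j, α ∈ freeSections V J j := ⟨j, hα⟩
  have hj : hex.choose = j := by
    by_contra hne
    exact freeSections_disjoint hJ hne hex.choose_spec hα
  rw [chartNu, dif_pos hex, hj, coe_toDual (hu.sub_mem_dualMonoid hτ hα.1)]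

/-- Coprimality reflects disjointness of the parts: m_i, divided by its generator, has order 1 along
the rays of τ in J_i and order 0 along the other rays of τ. -/
theorem IsGenerators.isLocalData (h : IsNefFan V J) (hfull : HasFullNewtonPolytopes V J)
    (hX : ∃ τ, IsCone V τ ∧ ∀ j, (τ ∩ J j).Nonempty) (hu : IsGenerators V J τ u)
    (hτ : IsCone V τ) : IsLocalData (freeFinset V J) (chartMu τ u) (chartNu V J τ u) where
  coprime := by
    intro k i a b hki hab
    have hab' : -u k + (a : Lat n) = -u i + b := by
      have := congrArg (fun x : dualMonoid τ => (x : Lat n)) hab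
      simpa [hu.coe_chartMu] using this
    have hmem : (a : Lat n) + u i ∈ dualMonoid τ := by
      intro r hr
      rw [add_dotProduct, hu.value i r hr]
      have h1 := a.2 r hr
      by_cases hri : r ∈ J i
      · have h2 := congrArg (fun x => x ⬝ᵥ r) hab'
        simp only [add_dotProduct, neg_dotProduct, hu.value _ r hr, h.nef.mem_part_iff hri, hki.symm,
          if_true, if_false] at h2 ⊢
        have h3 := b.2 r hr
        omega
      · rw [if_neg hri, add_zero]
        exact h1
    refine ⟨⟨_, hmem⟩, ?_⟩
    ext1
    rw [AddSubmonoid.coe_add, hu.coe_chartMu]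
    exact (by abel : (a : Lat n) = -u i + (a + u i))
  disjoint := by
    intro j k hjk
    rw [Finset.disjoint_left]
    intro α hj hk
    exact freeSections_disjoint h.nef hjk (h.mem_freeFinset.1 hj) (h.mem_freeFinset.1 hk)
  nonempty := by
    intro j
    obtain ⟨α, hα⟩ := freeSections_nonempty h hfull hX j
    exact ⟨α, h.mem_freeFinset.2 hα⟩
  unit := by
    intro j
    rcases hu.free j with h0 | h0
    · left
      ext1
      rw [hu.coe_chartMu, h0, neg_zero]
      rfl
    · right
      refine ⟨u j, h.mem_freeFinset.2 h0, ?_⟩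
      ext1
      rw [hu.coe_chartNu h.nef hτ h0, sub_self]
      rfl

/-- A natural exponent vector as an exponent of the localized Cox ring. -/
def natExp (V τ : Finset (Lat n)) (e : V →₀ ℕ) : locMonoid V τ :=
  ⟨fun r => (e r : ℤ), fun _ _ => Int.natCast_nonneg _⟩

open AddMonoidAlgebra in
theorem coxToLoc_monomial {B : Type} [CommRing B] (e : V →₀ ℕ) (b : B) :
    coxToLoc B V τ (MvPolynomial.monomial e b) = single (natExp V τ e) b := by
  have h1 : coxToLoc B V τ (MvPolynomial.monomial e 1) = single (natExp V τ e) 1 := by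
    induction e using Finsupp.induction_linear with
    | zero => rw [MvPolynomial.monomial_zero', map_one, map_one]; rfl
    | add e f he hf =>
      rw [show MvPolynomial.monomial (e + f) (1 : B) =
        MvPolynomial.monomial e 1 * MvPolynomial.monomial f 1 by
          rw [MvPolynomial.monomial_mul, one_mul], map_mul, he, hf, single_mul_single, one_mul]
      rfl
    | single r k =>
      rw [← MvPolynomial.X_pow_eq_monomial, map_pow, coxToLoc, MvPolynomial.coe_eval₂Hom,
        MvPolynomial.eval₂_X, single_pow, one_pow]
      congr 1
      ext s
      by_cases hs : s = r
      · subst hs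
        simp [natExp]
      · simp [natExp, hs, Finsupp.single_apply, Ne.symm hs]
  rw [show MvPolynomial.monomial e b = MvPolynomial.C b * MvPolynomial.monomial e 1 by
    rw [MvPolynomial.C_mul_monomial, mul_one], map_mul, h1]
  rw [coxToLoc, MvPolynomial.coe_eval₂Hom, MvPolynomial.eval₂_C]
  simp [single_mul_single]

theorem degenerationIdeal_eq (h : IsNefFan V J) (b : Lat n → ℂ) :
    degenerationIdeal V J b = Ideal.span (Set.range fun j =>
      MvPolynomial.monomial (indicator V (J j)) (1 : ℂ[X]) + ∑ α ∈ freeFinset V J j,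
        MvPolynomial.monomial (sectionExponent V (J j) α)
          (Polynomial.X * Polynomial.C (b α))) := by
  rw [degenerationIdeal]
  congr 2
  funext j
  rw [add_comm, divMonomial_eq, MvPolynomial.map_monomial, map_one, freeSection,
    finsum_mem_eq_finite_toFinset_sum _ (finite_freeSections h j), map_sum, Finset.mul_sum,
    freeFinset, dif_pos (finite_freeSections h j)]
  congr 1
  refine Finset.sum_congr rfl fun α _ => ?_
  rw [map_mul, MvPolynomial.map_C, sectionMonomial_eq, MvPolynomial.map_monomial, map_one,
    MvPolynomial.C_mul_monomial, MvPolynomial.C_mul_monomial, mul_one]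

open AddMonoidAlgebra in
theorem chartToLoc_single {B : Type} [CommRing B] (g : dualMonoid τ) (b : B) :
    chartToLoc B V τ (single g b) = single (degZero V τ g) b := by
  simp [chartToLoc, mapDomainRingHom_apply]

open AddMonoidAlgebra in
-- The exponent e is that of the generating section u_j. It vanishes on the rays of τ, so its
-- monomial is invertible in the localized Cox ring, and dividing by it gives an equation of degree
-- 0.
theorem IsGenerators.coxToLoc_eq (h : IsNefFan V J) (hu : IsGenerators V J τ u) (hτ : IsCone V τ)
    (b : Lat n → ℂ) (j : Fin c) : ∃ e : locMonoid V τ, IsAddUnit e ∧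
      coxToLoc ℂ[X] V τ (MvPolynomial.monomial (indicator V (J j)) (1 : ℂ[X]) +
        ∑ α ∈ freeFinset V J j, MvPolynomial.monomial (sectionExponent V (J j) α)
          (Polynomial.X * Polynomial.C (b α))) =
      single e 1 * chartToLoc ℂ[X] V τ (localEq (freeFinset V J) (chartMu τ u) (chartNu V J τ u)
        Polynomial.X (fun α => Polynomial.C (b α)) j) := by
  have hval : ∀ r : V, (r : Lat n) ∈ τ →
      u j ⬝ᵥ (r : Lat n) + (if (r : Lat n) ∈ J j then 1 else 0) = 0 := by
    intro r hr
    rw [hu.value j r hr]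
    split_ifs <;> norm_num
  set e : locMonoid V τ :=
    ⟨fun r => u j ⬝ᵥ (r : Lat n) + (if (r : Lat n) ∈ J j then 1 else 0),
      fun r hr => (hval r hr).ge⟩
  set e' : locMonoid V τ :=
    ⟨fun r => -(u j ⬝ᵥ (r : Lat n) + (if (r : Lat n) ∈ J j then 1 else 0)),
      fun r hr => by dsimp only; rw [hval r hr, neg_zero]⟩
  have hee : e + e' = 0 := by
    ext r
    simp [e, e']
  refine ⟨e, IsAddUnit.of_add_eq_zero e' hee, ?_⟩
  rw [localEq, map_add, map_add, map_sum, map_sum, mul_add, Finset.mul_sum, coxToLoc_monomial,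
    chartToLoc_single, single_mul_single, one_mul]
  congr 1
  · congr 1
    ext r
    simp only [AddSubmonoid.coe_add, Pi.add_apply, natExp, degZero, AddMonoidHom.coe_mk,
      ZeroHom.coe_mk, e, indicator, Finsupp.equivFunOnFinite_symm_apply_apply, hu.coe_chartMu,
      neg_dotProduct]
    split_ifs <;> simp
  · refine Finset.sum_congr rfl fun α hα => ?_
    rw [h.mem_freeFinset] at hα
    rw [coxToLoc_monomial, chartToLoc_single, single_mul_single, one_mul]
    congr 1
    ext r
    simp only [AddSubmonoid.coe_add, Pi.add_apply, natExp, degZero, AddMonoidHom.coe_mk,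
      ZeroHom.coe_mk, e, sectionExponent_apply hα.1, hu.coe_chartNu h.nef hτ hα, sub_dotProduct]
    ring

theorem degZero_injective
    (h : (0 : Vec n) ∈ interior (convexHull ℝ (toVec '' (V : Set (Lat n))))) :
    Function.Injective (degZero V τ) := by
  intro g g' hg
  ext1
  refine eq_of_dotProduct_eq h fun r hr => ?_
  exact congrFun (congrArg Subtype.val hg) ⟨r, hr⟩

/-- The exponents of degree 0 are closed under differences inside the localized exponents, so
`comap_map_mapDomainRingHom` applies. -/
theorem comap_map_chartToLoc
    (h : (0 : Vec n) ∈ interior (convexHull ℝ (toVec '' (V : Set (Lat n))))) (hτ : τ ⊆ V)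
    {B : Type} [CommRing B] (I : Ideal (ChartRing B τ)) :
    (I.map (chartToLoc B V τ)).comap (chartToLoc B V τ) = I := by
  refine comap_map_mapDomainRingHom (degZero V τ) (degZero_injective h) (fun g g' a ha => ?_) I
  have hr : ∀ r : V, (g : Lat n) ⬝ᵥ (r : Lat n) + (a : V → ℤ) r = (g' : Lat n) ⬝ᵥ (r : Lat n) :=
    fun r => congrFun (congrArg Subtype.val ha) r
  refine ⟨⟨(g' : Lat n) - g, fun r hrτ => ?_⟩, ?_⟩
  · have h1 := hr ⟨r, hτ hrτ⟩
    have h2 := a.2 ⟨r, hτ hrτ⟩ hrτ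
    rw [sub_dotProduct]
    dsimp only at h1
    omega
  · ext r
    have h1 := hr r
    simp only [degZero, AddMonoidHom.coe_mk, ZeroHom.coe_mk, sub_dotProduct]
    omega

open AddMonoidAlgebra in
theorem IsGenerators.chartIdeal_eq (h : IsNefFan V J) (hu : IsGenerators V J τ u)
    (hτ : IsCone V τ) (b : Lat n → ℂ) : chartIdeal V τ (degenerationIdeal V J b) =
      Ideal.span (Set.range (localEq (freeFinset V J) (chartMu τ u) (chartNu V J τ u)
        Polynomial.X (fun α => Polynomial.C (b α)))) := by
  conv_rhs => rw [← comap_map_chartToLoc h.interior hτ.subset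
    (Ideal.span (Set.range (localEq (freeFinset V J) (chartMu τ u) (chartNu V J τ u)
        Polynomial.X (fun α => Polynomial.C (b α)))))]
  rw [chartIdeal]
  congr 1
  rw [degenerationIdeal_eq h, Ideal.map_span, Ideal.map_span, ← Set.range_comp, ← Set.range_comp]
  choose e he hee using fun j => hu.coxToLoc_eq h hτ b j
  have hunit : ∀ j, IsUnit (single (e j) (1 : ℂ[X])) := by
    intro j
    obtain ⟨e', he'⟩ := isAddUnit_iff_exists_neg.1 (he j)
    refine IsUnit.of_mul_eq_one (single e' 1) ?_
    rw [single_mul_single, he', one_mul, one_def]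
  apply le_antisymm
  · rw [Ideal.span_le]
    rintro _ ⟨j, rfl⟩
    rw [Function.comp_apply, hee]
    exact Ideal.mul_mem_left _ _ (Ideal.subset_span ⟨j, rfl⟩)
  · rw [Ideal.span_le]
    rintro _ ⟨j, rfl⟩
    rw [Function.comp_apply, SetLike.mem_coe, ← Ideal.unit_mul_mem_iff_mem _ (hunit j), ← hee]
    exact Ideal.subset_span ⟨j, rfl⟩

end ChartEquations

/-! ### Flatness of the degeneration for general coefficients -/

section Flatness
variable {n c : ℕ} {V : Finset (Lat n)} {J : Fin c → Finset (Lat n)} {τ : Finset (Lat n)}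
  {u : Fin c → Lat n}

/-- Gordan's lemma. -/
theorem fg_dualMonoid (τ : Finset (Lat n)) : (dualMonoid τ).FG := by
  -- Write u as a difference of natural vectors and add a slack variable for each ray: the monoid
  -- becomes an image of the natural solutions of a linear system f = g.
  let f : (Fin n → ℕ) × (Fin n → ℕ) × (τ → ℕ) →+ (τ → ℤ) :=
    { toFun := fun x r => (fun i => (x.1 i : ℤ)) ⬝ᵥ (r : Lat n)
      map_zero' := by
        ext r
        simp [dotProduct]
      map_add' := fun x y => by
        ext r
        simp [dotProduct, add_mul, Finset.sum_add_distrib] }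
  let g : (Fin n → ℕ) × (Fin n → ℕ) × (τ → ℕ) →+ (τ → ℤ) :=
    { toFun := fun x r => (fun i => (x.2.1 i : ℤ)) ⬝ᵥ (r : Lat n) + (x.2.2 r : ℤ)
      map_zero' := by
        ext r
        simp [dotProduct]
      map_add' := fun x y => by
        ext r
        simp [dotProduct, add_mul, Finset.sum_add_distrib]
        ring }
  let d : (Fin n → ℕ) × (Fin n → ℕ) × (τ → ℕ) →+ Lat n :=
    { toFun := fun x i => (x.1 i : ℤ) - x.2.1 i
      map_zero' := by
        ext i
        simp
      map_add' := fun x y => by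
        ext i
        simp
        ring }
  have h : (f.eqLocusM g).map d = dualMonoid τ := by
    ext u
    rw [AddSubmonoid.mem_map]
    constructor
    · rintro ⟨x, hx, rfl⟩ r hr
      have h1 : (fun i => (x.1 i : ℤ)) ⬝ᵥ r = (fun i => (x.2.1 i : ℤ)) ⬝ᵥ r + (x.2.2 ⟨r, hr⟩ : ℤ) :=
        congrFun (show f x = g x from hx) ⟨r, hr⟩
      have h2 : d x = (fun i => (x.1 i : ℤ)) - (fun i => (x.2.1 i : ℤ)) := rfl
      rw [h2, sub_dotProduct, h1]
      simp
    · intro hu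
      refine ⟨(fun i => (u i).toNat, fun i => (-u i).toNat, fun r => (u ⬝ᵥ (r : Lat n)).toNat),
        ?_, ?_⟩
      · show f _ = g _
        ext r
        have h1 : (((u ⬝ᵥ (r : Lat n)).toNat : ℕ) : ℤ) = u ⬝ᵥ (r : Lat n) :=
          Int.toNat_of_nonneg (hu r r.2)
        simp only [f, g, AddMonoidHom.coe_mk, ZeroHom.coe_mk, h1]
        rw [← add_dotProduct]
        congr 1
        ext i
        simp only [Pi.add_apply]
        omega
      · ext i
        simp only [d, AddMonoidHom.coe_mk, ZeroHom.coe_mk]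
        omega
  rw [← h]
  exact (AddSubmonoid.fg_eqLocusM f g).map d

instance (τ : Finset (Lat n)) : AddMonoid.FG (dualMonoid τ) :=
  (AddMonoid.fg_iff_addSubmonoid_fg _).2 (fg_dualMonoid τ)

instance (τ : Finset (Lat n)) : UniqueSums (dualMonoid τ) :=
  UniqueSums.of_injective_addHom (dualMonoid τ).subtype.toAddHom Subtype.val_injective inferInstance

open AddMonoidAlgebra in
/-- If every element of `L` is a difference of an element of `G` and a given type of elements,
then so is every element of an extended ideal. -/
theorem exists_single_mul_mem {R G L : Type*} [CommRing R] [AddCommMonoid G] [AddCommMonoid L]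
    (f : G →+ L) (hf : ∀ l, ∃ w g, f w + l = f g) (I : Ideal (AddMonoidAlgebra R G))
    {x : AddMonoidAlgebra R L} (hx : x ∈ I.map (mapDomainRingHom R f)) :
    ∃ w, ∃ y ∈ I, single (f w) 1 * x = mapDomainRingHom R f y := by
  have hs : ∀ g r, mapDomainRingHom R f (single g r) = single (f g) r := by
    simp [mapDomainRingHom_apply]
  have hadd : ∀ a b : L, single (a + b) (1 : R) = single a 1 * single b 1 := fun a b => by
    rw [single_mul_single, one_mul]
  have hall : ∀ z : AddMonoidAlgebra R L, ∃ w, ∃ y,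
      single (f w) 1 * z = mapDomainRingHom R f y := by
    intro z
    induction z using AddMonoidAlgebra.induction_linear with
    | zero => exact ⟨0, 0, by simp⟩
    | add z z' hz hz' =>
      obtain ⟨w, y, h⟩ := hz
      obtain ⟨w', y', h'⟩ := hz'
      refine ⟨w + w', single w' 1 * y + single w 1 * y', ?_⟩
      rw [map_add f, hadd, map_add, map_mul, map_mul, ← h, ← h', hs, hs]
      ring
    | single l r =>
      obtain ⟨w, g, h⟩ := hf l
      exact ⟨w, single g r, by rw [single_mul_single, one_mul, h, hs]⟩
  refine Submodule.span_induction (p := fun x _ => ∃ w, ∃ y ∈ I,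
    single (f w) 1 * x = mapDomainRingHom R f y) ?_ ?_ ?_ ?_ hx
  · rintro _ ⟨y, hy, rfl⟩
    exact ⟨0, y, hy, by rw [map_zero, ← one_def, one_mul]⟩
  · exact ⟨0, 0, I.zero_mem, by simp⟩
  · rintro x x' - - ⟨w, y, hy, h⟩ ⟨w', y', hy', h'⟩
    refine ⟨w + w', single w' 1 * y + single w 1 * y',
      add_mem (I.mul_mem_left _ hy) (I.mul_mem_left _ hy'), ?_⟩
    rw [map_add f, hadd, map_add, map_mul, map_mul, ← h, ← h', hs, hs]
    ring
  · rintro a x - ⟨w, y, hy, h⟩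
    obtain ⟨w', y', h'⟩ := hall a
    refine ⟨w' + w, y' * y, I.mul_mem_left _ hy, ?_⟩
    rw [map_add f, hadd, map_mul, ← h, ← h', smul_eq_mul]
    ring

/-- On a cone that meets all parts of the partition, the coefficients of the universal family
satisfy no relation. -/
theorem IsGenerators.univ_inter_eq_zero (h : IsNefFan V J) (hfull : HasFullNewtonPolytopes V J)
    (hτ : IsCone V τ) (hτJ : ∀ j, (τ ∩ J j).Nonempty) (hu : IsGenerators V J τ u)
    {P : UCoeff (Lat n)} (hP : AddMonoidAlgebra.single (0 : dualMonoid τ) P ∈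
      univIdeal (freeFinset V J) (chartMu τ u) (chartNu V J τ u)) : P = 0 := by
  refine TropMirror.univ_inter_eq_zero (hu.isLocalData h hfull ⟨τ, hτ, hτJ⟩ hτ) (fun k b hb => ?_)
    hP
  obtain ⟨r, hr⟩ := hτJ k
  rw [Finset.mem_inter] at hr
  have h1 := congrArg (fun x : dualMonoid τ => (x : Lat n) ⬝ᵥ r) hb
  simp only [AddSubmonoid.coe_zero, AddSubmonoid.coe_add, hu.coe_chartMu, add_dotProduct,
    neg_dotProduct, hu.value k r hr.1, if_pos hr.2, zero_dotProduct] at h1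
  have h2 := b.2 r hr.1
  omega

open AddMonoidAlgebra in
/-- The universal family on a torus. -/
theorem IsGenerators.map_univIdeal (h : IsNefFan V J) (hu : IsGenerators V J τ u)
    (hτ : IsCone V τ) :
    (univIdeal (freeFinset V J) (chartMu τ u) (chartNu V J τ u)).map
      (mapDomainRingHom (UCoeff (Lat n)) (dualMonoid τ).subtype) =
    Ideal.span (Set.range (localEq (freeFinset V J) (fun _ => (0 : Lat n)) id
      Polynomial.X (fun α => Polynomial.C (MvPolynomial.X α : MvPolynomial (Lat n) ℂ)))) := by
  rw [Ideal.map_span, ← Set.range_comp]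
  have key : ∀ j, mapDomainRingHom (UCoeff (Lat n)) (dualMonoid τ).subtype
      (univEq (freeFinset V J) (chartMu τ u) (chartNu V J τ u) j) =
      single (-u j) 1 * localEq (freeFinset V J) (fun _ => (0 : Lat n)) id
        Polynomial.X (fun α => Polynomial.C (MvPolynomial.X α : MvPolynomial (Lat n) ℂ)) j := by
    intro j
    have hs : ∀ (g : dualMonoid τ) (r : UCoeff (Lat n)),
        mapDomainRingHom (UCoeff (Lat n)) (dualMonoid τ).subtype (single g r) =
          single (g : Lat n) r := by
      simp [mapDomainRingHom_apply]
    rw [univEq, localEq, localEq, map_add, map_sum, mul_add, Finset.mul_sum, hs,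
      single_mul_single, hu.coe_chartMu, add_zero, one_mul]
    congr 1
    refine Finset.sum_congr rfl fun α hα => ?_
    rw [hs, single_mul_single, one_mul, hu.coe_chartNu h.nef hτ (h.mem_freeFinset.1 hα), id,
      sub_eq_neg_add]
  have hunit : ∀ j, IsUnit (single (-u j) (1 : UCoeff (Lat n))) := fun j =>
    IsUnit.of_mul_eq_one (single (u j) 1) (by
      rw [single_mul_single, neg_add_cancel, one_mul, one_def])
  apply le_antisymm
  · rw [Ideal.span_le]
    rintro _ ⟨j, rfl⟩
    rw [Function.comp_apply, key]
    exact Ideal.mul_mem_left _ _ (Ideal.subset_span ⟨j, rfl⟩)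
  · rw [Ideal.span_le]
    rintro _ ⟨j, rfl⟩
    rw [SetLike.mem_coe, ← Ideal.unit_mul_mem_iff_mem _ (hunit j), ← key]
    exact Ideal.subset_span ⟨j, rfl⟩

/-- The character -∑ u_j is 1 on every ray of τ, so a large multiple of it moves any character into
the dual cone. -/
theorem exists_add_mem_dualMonoid (h : IsNefFan V J) (hτ : IsCone V τ)
    (hu : IsGenerators V J τ u) (l : Lat n) :
    ∃ w g : dualMonoid τ, (w : Lat n) + l = g := by
  have hw : ∀ r ∈ τ, (-∑ j, u j) ⬝ᵥ r = 1 := by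
    intro r hr
    obtain ⟨j, hj⟩ := h.nef.exists_part (hτ.subset hr)
    rw [neg_dotProduct, sum_dotProduct, Finset.sum_eq_single j]
    · rw [hu.value j r hr, if_pos hj, neg_neg]
    · intro k _ hk
      rw [hu.value k r hr, if_neg]
      exact fun hrk => hk ((h.nef.mem_part_iff hj).1 hrk).symm
    · simp
  set N := ∑ r ∈ τ, |l ⬝ᵥ r|
  have hN : ∀ r ∈ τ, |l ⬝ᵥ r| ≤ N := fun r hr =>
    Finset.single_le_sum (f := fun r => |l ⬝ᵥ r|) (fun _ _ => abs_nonneg _) hr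
  have hN0 : 0 ≤ N := Finset.sum_nonneg fun _ _ => abs_nonneg _
  refine ⟨⟨N • (-∑ j, u j), fun r hr => ?_⟩, ⟨N • (-∑ j, u j) + l, fun r hr => ?_⟩, rfl⟩
  · rw [smul_dotProduct, hw r hr]
    simpa using hN0
  · rw [add_dotProduct, smul_dotProduct, hw r hr]
    have := (abs_le.1 (hN r hr)).1
    simp only [smul_eq_mul, mul_one]
    linarith

open AddMonoidAlgebra in
-- All charts induce the same ideal on the torus. A relation on τ thus yields a monomial multiple of
-- it on a chart τ₀ meeting the special fiber. There the ideal is the kernel of a map to a domain in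
-- which monomials do not vanish, so the monomial cancels.
theorem IsNefFan.univ_inter_eq_zero (h : IsNefFan V J) (hfull : HasFullNewtonPolytopes V J)
    (hX : ∃ τ, IsCone V τ ∧ ∀ j, (τ ∩ J j).Nonempty) (hτ : IsCone V τ)
    (hu : IsGenerators V J τ u) {P : UCoeff (Lat n)}
    (hP : single (0 : dualMonoid τ) P ∈
      univIdeal (freeFinset V J) (chartMu τ u) (chartNu V J τ u)) : P = 0 := by
  obtain ⟨τ₀, hτ₀, hτJ⟩ := id hX
  obtain ⟨u₀, hu₀⟩ := exists_isGenerators h hfull hτ₀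
  have h1 := Ideal.mem_map_of_mem (mapDomainRingHom (UCoeff (Lat n)) (dualMonoid τ).subtype) hP
  rw [hu.map_univIdeal h hτ, ← hu₀.map_univIdeal h hτ₀] at h1
  obtain ⟨w, y, hy, hwy⟩ := exists_single_mul_mem (dualMonoid τ₀).subtype
    (exists_add_mem_dualMonoid h hτ₀ hu₀) _ h1
  have hs : ∀ (τ : Finset (Lat n)) (g : dualMonoid τ) (r : UCoeff (Lat n)),
      mapDomainRingHom (UCoeff (Lat n)) (dualMonoid τ).subtype (single g r) =
        single (g : Lat n) r := by
    simp [mapDomainRingHom_apply]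
  have h2 : y = single w P := by
    refine mapDomain_injective (f := (dualMonoid τ₀).subtype) Subtype.val_injective ?_
    have h3 : mapDomainRingHom (UCoeff (Lat n)) (dualMonoid τ₀).subtype y =
        mapDomainRingHom (UCoeff (Lat n)) (dualMonoid τ₀).subtype (single w P) := by
      rw [← hwy, hs, hs, AddSubmonoid.subtype_apply, AddSubmonoid.coe_zero, single_mul_single,
        one_mul, add_zero]
    exact h3
  obtain ⟨W, _, _, Ψ, hΨ, hΨ1⟩ := exists_ker_eq_univIdeal (hu₀.isLocalData h hfull hX hτ₀)
  rw [h2, show single w P = single w 1 * single (0 : dualMonoid τ₀) P by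
    rw [single_mul_single, one_mul, add_zero], ← hΨ, map_mul] at hy
  exact hu₀.univ_inter_eq_zero h hfull hτ₀ hτJ ((hΨ _).1 ((mul_eq_zero.1 hy).resolve_left (hΨ1 w)))

/-- The canonical degeneration attached to general coefficients is flat. -/
theorem exists_flat (h : IsNefFan V J) (hfull : HasFullNewtonPolytopes V J)
    (hX : ∃ τ, IsCone V τ ∧ ∀ j, (τ ∩ J j).Nonempty) :
    ∃ P : MvPolynomial (Lat n) ℂ, P ≠ 0 ∧ ∀ b : Lat n → ℂ, MvPolynomial.eval b P ≠ 0 →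
      ∀ τ, IsCone V τ →
        Module.Flat ℂ[X] (ChartRing ℂ[X] τ ⧸ chartIdeal V τ (degenerationIdeal V J b)) := by
  have key : ∀ τ, ∃ P : MvPolynomial (Lat n) ℂ, P ≠ 0 ∧ (IsCone V τ → ∀ b : Lat n → ℂ,
      MvPolynomial.eval b P ≠ 0 →
        Module.Flat ℂ[X] (ChartRing ℂ[X] τ ⧸ chartIdeal V τ (degenerationIdeal V J b))) := by
    intro τ
    by_cases hτ : IsCone V τ
    · obtain ⟨u, hu⟩ := exists_isGenerators h hfull hτ
      obtain ⟨P, hP, hPb⟩ := exists_generic_torsionFree (hu.isLocalData h hfull hX hτ)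
        (fun P hP => h.univ_inter_eq_zero hfull hX hτ hu hP)
      refine ⟨P, hP, fun _ b hb => ?_⟩
      rw [hu.chartIdeal_eq h hτ b, Module.Flat.flat_iff_torsion_eq_bot_of_isBezout, eq_bot_iff]
      intro x hx
      rw [Submodule.mem_torsion_iff] at hx
      obtain ⟨p, hp⟩ := hx
      obtain ⟨y, rfl⟩ := Ideal.Quotient.mk_surjective x
      rw [Submodule.mem_bot, Ideal.Quotient.eq_zero_iff_mem]
      refine hPb b hb p (nonZeroDivisors.coe_ne_zero p) y ?_
      rw [← Ideal.Quotient.eq_zero_iff_mem]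
      exact (congrArg (Ideal.Quotient.mk _) (Algebra.smul_def (p : ℂ[X]) y).symm).trans hp
    · exact ⟨1, one_ne_zero, fun h => absurd h hτ⟩
  choose P hP hPb using key
  refine ⟨∏ τ ∈ V.powerset, P τ, Finset.prod_ne_zero_iff.2 fun τ _ => hP τ, fun b hb τ hτ => ?_⟩
  refine hPb τ hτ b ?_
  rw [map_prod, Finset.prod_ne_zero_iff] at hb
  exact hb τ (Finset.mem_powerset.2 hτ.subset)

end Flatness

/-! ### Lattice points of the strata of the special fiber -/

section Strata
variable {n c : ℕ} {V : Finset (Lat n)} {J : Fin c → Finset (Lat n)} {τ : Finset (Lat n)}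

theorem specialIdeal_le_span_iff : specialIdeal V J ≤
      Ideal.span (MvPolynomial.X '' {r : V | (r : Lat n) ∈ τ}) ↔
    ∀ j, ∃ r ∈ V, r ∈ τ ∧ r ∈ J j := by
  rw [specialIdeal, Ideal.span_le, Set.range_subset_iff]
  refine forall_congr' fun j => ?_
  rw [divMonomial_eq, SetLike.mem_coe, MvPolynomial.mem_ideal_span_X_image]
  simp only [MvPolynomial.support_monomial, if_neg one_ne_zero, Finset.mem_singleton, forall_eq,
    indicator, Finsupp.equivFunOnFinite_symm_apply_apply, Set.mem_ofPred_eq]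
  constructor
  · rintro ⟨r, hr, h⟩
    exact ⟨r, r.2, hr, by by_contra h0; simp [h0] at h⟩
  · rintro ⟨r, hr, h, h'⟩
    exact ⟨⟨r, hr⟩, h, by simp [h']⟩

/-- Take vertices u_k ∈ J_k° that are local equations on τ. Their values at α are integers ≤ 0 with
sum -1, so exactly one of them, the j-th, is -1. This places α in ∇_j, and the u_k are the rays that
witness freeness. -/
theorem IsNefFan.mem_freeSections_of_mem_deformationPoints (h : IsNefFan V J) (hn : 0 < n)
    {α : Lat n} (hα : α ∈ deformationPoints V (specialIdeal V J))
    (hN : IsNefPartition (dualRays V J) (dualParts V J)) :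
    ∃ j, α ∈ freeSections (dualRays V J) (dualParts V J) j := by
  obtain ⟨τ, hτ, hI, hατ⟩ := hα
  rw [specialIdeal_le_span_iff] at hI
  have hrep : ∀ j, ∃ u ∈ dualParts V J j, ∀ r ∈ τ, u ⬝ᵥ r = if r ∈ J j then -1 else 0 := by
    intro j
    obtain ⟨r, -, hrτ, hr⟩ := hI j
    exact h.exists_dualPart_on_cone hτ ⟨r, Finset.mem_inter.2 ⟨hrτ, hr⟩⟩
  choose u hu huv using hrep
  rw [mem_convexHull_toVec] at hατ
  obtain ⟨a, ha0, ha1, haα⟩ := hατ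
  have hval : ∀ j, ((u j ⬝ᵥ α : ℤ) : ℝ) = -∑ r ∈ τ, if r ∈ J j then a r else 0 := by
    intro j
    rw [← toVec_dotProduct, ← haα, dotProduct_sum, ← Finset.sum_neg_distrib]
    refine Finset.sum_congr rfl fun r hr => ?_
    rw [dotProduct_smul, toVec_dotProduct, huv j r hr]
    split_ifs <;> simp
  have hsum : ∑ j, (u j ⬝ᵥ α) = -1 := by
    have : ((∑ j, (u j ⬝ᵥ α) : ℤ) : ℝ) = -1 := by
      push_cast
      rw [Finset.sum_congr rfl fun j _ => hval j, Finset.sum_neg_distrib, Finset.sum_comm, ← ha1]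
      congr 1
      refine Finset.sum_congr rfl fun r hr => ?_
      obtain ⟨j, hj⟩ := h.nef.exists_part (hτ.subset hr)
      simp only [h.nef.mem_part_iff hj]
      simp
    exact_mod_cast this
  have hle : ∀ j, u j ⬝ᵥ α ≤ 0 := by
    intro j
    have : ((u j ⬝ᵥ α : ℤ) : ℝ) ≤ 0 := by
      rw [hval, neg_nonpos]
      refine Finset.sum_nonneg fun r _ => ?_
      split_ifs
      exacts [ha0 r, le_rfl]
    exact_mod_cast this
  obtain ⟨j, hj⟩ : ∃ j, u j ⬝ᵥ α ≠ 0 := by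
    by_contra! h0
    simp [h0] at hsum
  have hother : ∀ k, k ≠ j → u k ⬝ᵥ α = 0 := by
    intro k hk
    have h1 : ∑ i, u i ⬝ᵥ α ≤ u k ⬝ᵥ α + u j ⬝ᵥ α := by
      rw [← Finset.sum_erase_add _ _ (Finset.mem_univ j)]
      refine add_le_add_left ?_ _
      rw [← Finset.sum_erase_add _ _ (Finset.mem_erase.2 ⟨hk, Finset.mem_univ k⟩)]
      have := Finset.sum_nonpos fun i (_ : i ∈ (Finset.univ.erase j).erase k) => hle i
      linarith
    have h2 := hle k
    have h3 := hle j
    omega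
  have hjval : u j ⬝ᵥ α = -1 := by
    rw [← hsum, Finset.sum_eq_single j (fun k _ hk => hother k hk) (by simp)]
  have hαj : toVec α ∈ nablaPart J j := by
    have hz : ∀ r ∈ τ, r ∉ J j → a r = 0 := by
      have h1 := hval j
      rw [hjval] at h1
      have h2 : ∑ r ∈ τ, (a r - if r ∈ J j then a r else 0) = 0 := by
        rw [Finset.sum_sub_distrib, ha1]
        push_cast at h1
        linarith
      rw [Finset.sum_eq_zero_iff_of_nonneg (fun r _ => by
        split_ifs
        · simp
        · simpa using ha0 r)] at h2
      intro r hr hrj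
      simpa [hrj] using h2 r hr
    rw [← haα]
    rw [Finset.sum_congr rfl (g := fun r => a r • if r ∈ J j then toVec r else 0) fun r hr => by
      split_ifs with hrj
      · rfl
      · rw [hz r hr hrj, zero_smul, zero_smul]]
    refine (convex_convexHull ℝ _).sum_mem (fun r _ => ha0 r) ha1 fun r hr => ?_
    split_ifs with hrj
    exacts [toVec_mem_nablaPart hrj, zero_mem_nablaPart j]
  refine ⟨j, (mem_freeSections_iff hN).2 ⟨h.nablaPart_pairing hn hαj, fun k => ⟨u k, hu k, ?_⟩⟩⟩
  rw [dotProduct_comm]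
  split_ifs with hjk
  · rw [← hjk, hjval]
  · exact hother k (Ne.symm hjk)

/-- With w defining τ, let σ be a cone containing α + w. The rays r_k, tight at w and at α, force
the mass of α + w along J_k to be at least 1 + δ_jk, so σ meets every J_k and the local equations
u_k satisfy ⟨u_k, α⟩ = -δ_jk. Their sum m is at least -1 on all rays and equal to -1 on σ and at α:
the face m = -1 contains α and its stratum lies in X₀. -/
theorem IsNefFan.mem_deformationPoints (h : IsNefFan V J) (hn : 0 < n) (hτ : IsCone (dualRays V J) τ)
    {j : Fin c} {α : Lat n} (hα : α ∈ divSections (dualRays V J) (dualParts V J j))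
    (hr : ∀ k, ∃ r ∈ dualParts V J k, r ∈ τ ∧ α ⬝ᵥ r = if j = k then -1 else 0) :
    α ∈ deformationPoints V (specialIdeal V J) := by
  obtain ⟨w, hw, hτw⟩ := hτ
  have hwQ := h.mem_dual_of_le hw
  have hαj : toVec α ∈ nablaPart J j :=
    h.sectionPolytope_dual_subset hn j (toVec_mem_sectionPolytope hα)
  obtain ⟨σ, hσ, e, he0, heσ, hsum, hgen⟩ := h.exists_decomposition (toVec α + w)
  choose u hu huσ huw using hgen
  choose r hrK hrτ hrα using hr
  have hrw : ∀ k, toVec (r k) ⬝ᵥ w = -1 := fun k => by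
    have := hrτ k
    rw [hτw] at this
    exact (Finset.mem_filter.1 this).2
  have hlow : ∀ k, (1 + if j = k then 1 else 0 : ℝ) ≤ ∑ ρ ∈ J k, e ρ := by
    intro k
    have h1 : toVec (r k) ⬝ᵥ (toVec α + w) = -(1 + if j = k then 1 else 0 : ℝ) := by
      rw [dotProduct_add, toVec_dotProduct, hrw, dotProduct_comm, hrα]
      split_ifs <;> norm_num
    have h2 : -∑ ρ ∈ J k, e ρ ≤ toVec (r k) ⬝ᵥ (toVec α + w) := by
      rw [← hsum, dotProduct_sum, ← Finset.sum_erase_add _ _ (Finset.mem_univ k)]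
      have h3 : ∀ i, toVec (r k) ⬝ᵥ (∑ ρ ∈ J i, e ρ • toVec ρ) =
          ∑ ρ ∈ J i, e ρ * ((r k ⬝ᵥ ρ : ℤ) : ℝ) := by
        intro i
        rw [dotProduct_sum]
        refine Finset.sum_congr rfl fun ρ _ => ?_
        rw [dotProduct_smul, toVec_dotProduct, smul_eq_mul]
      have hdiv : r k ∈ divSections V (J k) := (h.mem_dualParts.1 (hrK k)).2
      have h4 : 0 ≤ ∑ i ∈ Finset.univ.erase k, toVec (r k) ⬝ᵥ (∑ ρ ∈ J i, e ρ • toVec ρ) := by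
        refine Finset.sum_nonneg fun i hi => ?_
        rw [h3]
        refine Finset.sum_nonneg fun ρ hρ => mul_nonneg (he0 ρ) ?_
        have h5 := hdiv ρ (h.nef.subset i hρ)
        simp only [h.nef.mem_part_iff hρ, Finset.ne_of_mem_erase hi, if_false] at h5
        exact_mod_cast h5
      have h6 : -∑ ρ ∈ J k, e ρ ≤ toVec (r k) ⬝ᵥ (∑ ρ ∈ J k, e ρ • toVec ρ) := by
        rw [h3, ← Finset.sum_neg_distrib]
        refine Finset.sum_le_sum fun ρ hρ => ?_
        have h5 := hdiv ρ (h.nef.subset k hρ)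
        rw [if_pos hρ] at h5
        have h7 : (-1 : ℝ) ≤ ((r k ⬝ᵥ ρ : ℤ) : ℝ) := by exact_mod_cast h5
        nlinarith [he0 ρ]
      linarith
    linarith
  have hupα : ∀ k, (if j = k then -1 else 0 : ℝ) ≤ toVec (u k) ⬝ᵥ toVec α := fun k => by
    have := pairing h.nef (toVec_mem_sectionPolytope (hu k)) hαj
    simpa only [eq_comm (a := k)] using this
  have hupw : ∀ k, -1 ≤ toVec (u k) ⬝ᵥ w := fun k => mem_dual_nablaDual.1 hwQ k _ (hu k)
  have huα : ∀ k, toVec (u k) ⬝ᵥ toVec α = if j = k then -1 else 0 := by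
    intro k
    have h1 := huw k
    rw [dotProduct_add] at h1
    have h2 := hupα k
    have h3 := hupw k
    have h4 := hlow k
    split_ifs at h2 h4 ⊢ <;> linarith
  set m := ∑ k, u k with hm
  have hmr : ∀ ρ ∈ V, -1 ≤ m ⬝ᵥ ρ := by
    intro ρ hρ
    obtain ⟨i, hi⟩ := h.nef.exists_part hρ
    rw [hm, sum_dotProduct]
    have : ∑ k, (if i = k then (-1 : ℤ) else 0) ≤ ∑ k, u k ⬝ᵥ ρ := by
      refine Finset.sum_le_sum fun k _ => ?_
      have := hu k ρ hρ
      simpa only [h.nef.mem_part_iff hi] using this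
    simpa using this
  have hmσ : ∀ ρ ∈ σ, m ⬝ᵥ ρ = -1 := by
    intro ρ hρ
    obtain ⟨i, hi⟩ := h.nef.exists_part (hσ.subset hρ)
    rw [hm, sum_dotProduct]
    rw [Finset.sum_congr rfl fun k _ => huσ k ρ hρ]
    simp only [h.nef.mem_part_iff hi]
    simp
  have hmα : toVec α ⬝ᵥ toVec m = -1 := by
    rw [hm, toVec_sum, dotProduct_sum]
    simp only [dotProduct_comm (toVec α), huα]
    simp
  refine ⟨V.filter fun ρ => toVec ρ ⬝ᵥ toVec m = -1, ⟨toVec m, fun ρ hρ => ?_, rfl⟩, ?_, ?_⟩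
  · rw [toVec_dotProduct, dotProduct_comm]
    exact_mod_cast hmr ρ hρ
  · rw [specialIdeal_le_span_iff]
    intro k
    obtain ⟨ρ, hρ, hρe⟩ : ∃ ρ ∈ J k, e ρ ≠ 0 := by
      refine Finset.exists_ne_zero_of_sum_ne_zero ?_
      have := hlow k
      split_ifs at this <;> linarith
    have hρσ : ρ ∈ σ := by
      by_contra h0
      exact hρe (heσ ρ h0)
    refine ⟨ρ, hσ.subset hρσ, Finset.mem_filter.2 ⟨hσ.subset hρσ, ?_⟩, hρ⟩
    rw [toVec_dotProduct, dotProduct_comm, hmσ ρ hρσ]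
    norm_num
  · have hS : ∀ s ∈ toVec '' ((insert 0 (J j) : Finset (Lat n)) : Set (Lat n)), -1 ≤ s ⬝ᵥ toVec m := by
      rintro _ ⟨ρ, hρ, rfl⟩
      rcases Finset.mem_insert.1 (Finset.mem_coe.1 hρ) with rfl | hρ
      · simp
      · rw [toVec_dotProduct, dotProduct_comm]
        exact_mod_cast hmr ρ (h.nef.subset j hρ)
    refine convexHull_mono ?_ (mem_convexHull_face hS hαj hmα)
    rintro _ ⟨⟨ρ, hρ, rfl⟩, h1⟩
    rcases Finset.mem_insert.1 (Finset.mem_coe.1 hρ) with rfl | hρ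
    · simp at h1
    · exact ⟨ρ, Finset.mem_coe.2 (Finset.mem_filter.2 ⟨h.nef.subset j hρ, h1⟩), rfl⟩

end Strata

/-! ### The first order tropical mirror on charts -/

section FirstOrder
variable {n c : ℕ} {V : Finset (Lat n)} {J : Fin c → Finset (Lat n)} {τ : Finset (Lat n)}
  {u : Fin c → Lat n}

/-- The exponents of the monomials in the ideal `I₀` on the chart `τ`. -/
def IsSpecialExponent (J : Fin c → Finset (Lat n)) (τ : Finset (Lat n)) (g : Lat n) : Prop :=
  ∃ j, ∀ r ∈ J j, r ∈ τ → 1 ≤ g ⬝ᵥ r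

open AddMonoidAlgebra in
/-- The part of the first order deformations with exponents in `I₀`. -/
def epsIdeal (J : Fin c → Finset (Lat n)) (τ : Finset (Lat n)) : Ideal (ChartRing ℂ[ε] τ) :=
  Ideal.span {f | ∃ g : dualMonoid τ, IsSpecialExponent J τ g ∧ f = single g ε}

open AddMonoidAlgebra in
theorem smul_shiftMonomial_mem_epsIdeal {α : Lat n} {g : dualMonoid τ} (z : ℂ)
    (h : (g : Lat n) + α ∈ dualMonoid τ → IsSpecialExponent J τ (g + α)) :
    algebraMap ℂ[ε] (ChartRing ℂ[ε] τ) (z • ε) * shiftMonomial ℂ[ε] τ α g ∈ epsIdeal J τ := by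
  rw [shiftMonomial]
  split_ifs with hg
  · rw [Algebra.smul_def z, map_mul, mul_assoc]
    refine Ideal.mul_mem_left _ _ (Ideal.subset_span ⟨⟨_, hg⟩, h hg, ?_⟩)
    simp [single_mul_single]
  · rw [mul_zero]
    exact Ideal.zero_mem _

open AddMonoidAlgebra in
/-- The first order part of the equations. -/
abbrev epsEq (V : Finset (Lat n)) (J : Fin c → Finset (Lat n)) (τ : Finset (Lat n))
    (u : Fin c → Lat n) (b : Lat n → ℂ) : Fin c → ChartRing ℂ[ε] τ :=
  localEq (freeFinset V J) (chartMu τ u) (chartNu V J τ u) ε (fun α => algebraMap ℂ ℂ[ε] (b α))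

open AddMonoidAlgebra in
theorem IsGenerators.map_toFirstOrder (h : IsNefFan V J) (hu : IsGenerators V J τ u)
    (hτ : IsCone V τ) (b : Lat n → ℂ) :
    (chartIdeal V τ (degenerationIdeal V J b)).map (toFirstOrder τ) =
      Ideal.span (Set.range (epsEq V J τ u b)) := by
  rw [hu.chartIdeal_eq h hτ b, Ideal.map_span, ← Set.range_comp]
  congr 2
  funext j
  rw [Function.comp_apply, toFirstOrder, map_localEq]
  simp [epsEq]

open AddMonoidAlgebra in
-- For exponents g divisible by m_j, this multiple of the j-th equation has the shape of a generator
-- of the first order mirror, with the free sections of E_j in place of Ξ.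
theorem IsGenerators.single_mul_epsEq (h : IsNefFan V J) (hu : IsGenerators V J τ u)
    (hτ : IsCone V τ) (b : Lat n → ℂ) {j : Fin c} {g k : dualMonoid τ}
    (hk : (k : Lat n) = g + u j) :
    single k 1 * epsEq V J τ u b j = single g 1 + ∑ α ∈ freeFinset V J j,
      algebraMap ℂ[ε] (ChartRing ℂ[ε] τ) (b α • ε) * shiftMonomial ℂ[ε] τ α g := by
  rw [epsEq, localEq, mul_add, Finset.mul_sum, single_mul_single, one_mul]
  congr 1
  · congr 1
    ext1
    rw [AddSubmonoid.coe_add, hk, hu.coe_chartMu, add_neg_cancel_right]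
  · refine Finset.sum_congr rfl fun α hα => ?_
    have hν := hu.coe_chartNu h.nef hτ (h.mem_freeFinset.1 hα)
    have hmem : (g : Lat n) + α = ((k + chartNu V J τ u α : dualMonoid τ) : Lat n) := by
      rw [AddSubmonoid.coe_add, hk, hν]
      abel
    have hmem' : (g : Lat n) + α ∈ dualMonoid τ := hmem ▸ SetLike.coe_mem _
    rw [shiftMonomial, dif_pos hmem', single_mul_single, one_mul, Algebra.smul_def, mul_comm ε]
    have : (⟨(g : Lat n) + α, hmem'⟩ : dualMonoid τ) = k + chartNu V J τ u α := Subtype.ext hmem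
    rw [this]
    simp [single_mul_single]

theorem IsGenerators.add_mem_dualMonoid (hu : IsGenerators V J τ u)
    {j : Fin c} {g : dualMonoid τ} (hg : ∀ r ∈ J j, r ∈ τ → 1 ≤ (g : Lat n) ⬝ᵥ r) :
    (g : Lat n) + u j ∈ dualMonoid τ := by
  intro r hr
  rw [add_dotProduct, hu.value j r hr]
  split_ifs with hrj
  · have := hg r hrj hr
    omega
  · have := g.2 r hr
    omega

open AddMonoidAlgebra in
theorem eps_mul_smul_shiftMonomial (z : ℂ) (x : ChartRing ℂ[ε] τ) :
    single (0 : dualMonoid τ) ε * (algebraMap ℂ[ε] (ChartRing ℂ[ε] τ) (z • ε) * x) = 0 := by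
  rw [← mul_assoc]
  have : single (0 : dualMonoid τ) (ε : ℂ[ε]) * algebraMap ℂ[ε] (ChartRing ℂ[ε] τ) (z • ε) = 0 := by
    simp [single_mul_single]
  rw [this, zero_mul]

open AddMonoidAlgebra in
-- The multiples in `single_mul_epsEq` and the generators of the first order family differ only by
-- terms ε χ^{g+α} with g + α again in the special ideal. These terms lie in both ideals, since ε
-- times either kind of generator is ε χ^g.
theorem IsGenerators.firstOrder_eq (h : IsNefFan V J) (hu : IsGenerators V J τ u)
    (hτ : IsCone V τ) (I₀ : Ideal (MvPolynomial V ℂ))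
    (hI₀ : ∀ g : dualMonoid τ, single g (1 : ℂ) ∈ chartIdeal V τ I₀ ↔ IsSpecialExponent J τ g)
    (Ξ : Set (Lat n)) (hΞ : ∀ α ∈ Ξ, ∃ j, α ∈ freeSections V J j)
    (hΞ' : ∀ j, ∀ α ∈ divSections V (J j),
      (∀ k, ∃ r ∈ J k, r ∈ τ ∧ α ⬝ᵥ r = if j = k then -1 else 0) → α ∈ Ξ) (b : Lat n → ℂ) :
    (chartIdeal V τ (degenerationIdeal V J b)).map (toFirstOrder τ) =
      firstOrderIdeal V I₀ Ξ b τ := by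
  rw [hu.map_toFirstOrder h hτ]
  set ΞF : Finset (Lat n) := (Finset.univ.biUnion (freeFinset V J)).filter (· ∈ Ξ) with hΞF
  have hmemΞ : ∀ α, α ∈ ΞF ↔ α ∈ Ξ := by
    intro α
    simp only [hΞF, Finset.mem_filter, Finset.mem_biUnion, Finset.mem_univ, true_and,
      h.mem_freeFinset, and_iff_right_iff_imp]
    exact hΞ α
  set s : dualMonoid τ → Lat n → ChartRing ℂ[ε] τ := fun g α =>
    algebraMap ℂ[ε] (ChartRing ℂ[ε] τ) (b α • ε) * shiftMonomial ℂ[ε] τ α g with hs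
  have hfirst : firstOrderIdeal V I₀ Ξ b τ = Ideal.span {f | ∃ g : dualMonoid τ,
      IsSpecialExponent J τ g ∧ f = single g 1 + ∑ α ∈ ΞF, s g α} := by
    rw [firstOrderIdeal]
    congr 1
    ext f
    refine exists_congr fun g => ?_
    rw [hI₀]
    have : (∑ᶠ α ∈ Ξ, algebraMap ℂ[ε] (ChartRing ℂ[ε] τ) (b α • ε) *
        shiftMonomial ℂ[ε] τ α g) = ∑ α ∈ ΞF, s g α := by
      rw [← finsum_mem_coe_finset]
      have hset : Ξ = (ΞF : Set (Lat n)) := by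
        ext α
        rw [Finset.mem_coe, hmemΞ]
      rw [← hset]
    rw [this]
  rw [hfirst]
  have hdiff : ∀ (j : Fin c) (g k : dualMonoid τ), (k : Lat n) = g + u j →
      (∀ r ∈ J j, r ∈ τ → 1 ≤ (g : Lat n) ⬝ᵥ r) →
      single k 1 * epsEq V J τ u b j - (single g 1 + ∑ α ∈ ΞF, s g α) ∈ epsIdeal J τ := by
    intro j g k hk hg
    rw [hu.single_mul_epsEq h hτ b hk, add_sub_add_left_eq_sub, ← Finset.sum_sdiff_sub_sum_sdiff]
    refine sub_mem (Ideal.sum_mem _ fun α hα => ?_) (Ideal.sum_mem _ fun α hα => ?_)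
    · rw [Finset.mem_sdiff, h.mem_freeFinset, hmemΞ] at hα
      refine smul_shiftMonomial_mem_epsIdeal _ fun hgα => ?_
      -- If g + α is not special, every part has a ray of τ on which g + α is at most 0. This forces
      -- ⟨α, r⟩ = -δ_jk there, so α belongs to Ξ after all.
      by_contra hspec
      refine hα.2 (hΞ' j α hα.1.1 fun i => ?_)
      rw [IsSpecialExponent] at hspec
      push Not at hspec
      obtain ⟨r, hri, hrτ, hr⟩ := hspec i
      refine ⟨r, hri, hrτ, ?_⟩
      have h1 := hgα r hrτ
      have h2 := hα.1.1 r (hτ.subset hrτ)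
      have h3 := g.2 r hrτ
      rw [add_dotProduct] at hr h1
      simp only [h.nef.mem_part_iff hri, eq_comm (a := i)] at h2
      split_ifs at h2 ⊢ with hji
      · subst hji
        have := hg r hri hrτ
        omega
      · omega
    · rw [Finset.mem_sdiff, h.mem_freeFinset, hmemΞ] at hα
      refine smul_shiftMonomial_mem_epsIdeal _ fun hgα => ?_
      obtain ⟨i, hi⟩ := hΞ α hα.1
      -- A section of another part is nonnegative on J_j, so g + α remains special through j.
      refine ⟨j, fun r hr hrτ => ?_⟩
      have hij : j ≠ i := by
        rintro rfl
        exact hα.2 hi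
      have h2 := hi.1 r (hτ.subset hrτ)
      simp only [h.nef.mem_part_iff hr, hij, if_false] at h2
      rw [add_dotProduct]
      have := hg r hr hrτ
      omega
  have hE : epsIdeal J τ ≤ Ideal.span (Set.range (epsEq V J τ u b)) := by
    rw [epsIdeal, Ideal.span_le]
    rintro _ ⟨g, ⟨j, hg⟩, rfl⟩
    have hk := hu.single_mul_epsEq h hτ b (j := j) (g := g)
      (k := ⟨_, hu.add_mem_dualMonoid hg⟩) rfl
    have h1 := congrArg (fun x => single (0 : dualMonoid τ) (ε : ℂ[ε]) * x) hk
    rw [mul_add, Finset.mul_sum, Finset.sum_eq_zero fun α _ => eps_mul_smul_shiftMonomial _ _,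
      single_mul_single, zero_add, mul_one, add_zero] at h1
    rw [SetLike.mem_coe, ← h1]
    exact Ideal.mul_mem_left _ _ (Ideal.mul_mem_left _ _ (Ideal.subset_span ⟨j, rfl⟩))
  have hE' : epsIdeal J τ ≤ Ideal.span {f | ∃ g : dualMonoid τ,
      IsSpecialExponent J τ g ∧ f = single g 1 + ∑ α ∈ ΞF, s g α} := by
    rw [epsIdeal, Ideal.span_le]
    rintro _ ⟨g, hg, rfl⟩
    have h1 : single (0 : dualMonoid τ) (ε : ℂ[ε]) * (single g 1 + ∑ α ∈ ΞF, s g α) =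
        single g ε := by
      rw [mul_add, Finset.mul_sum, Finset.sum_eq_zero fun α _ => eps_mul_smul_shiftMonomial _ _,
        single_mul_single, zero_add, mul_one, add_zero]
    rw [SetLike.mem_coe, ← h1]
    exact Ideal.mul_mem_left _ _ (Ideal.subset_span ⟨g, hg, rfl⟩)
  apply le_antisymm
  · rw [Ideal.span_le]
    rintro _ ⟨j, rfl⟩
    have hμ : ∀ r ∈ J j, r ∈ τ → 1 ≤ (chartMu τ u j : Lat n) ⬝ᵥ r := by
      intro r hr hrτ
      rw [hu.coe_chartMu, neg_dotProduct, hu.value j r hrτ, if_pos hr, neg_neg]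
    have h1 := hdiff j (chartMu τ u j) 0 (by
      rw [hu.coe_chartMu, neg_add_cancel, AddSubmonoid.coe_zero]) hμ
    rw [← one_def, one_mul] at h1
    have h2 := add_mem (hE' h1) (Ideal.subset_span ⟨chartMu τ u j, ⟨j, hμ⟩, rfl⟩)
    rwa [sub_add_cancel] at h2
  · rw [Ideal.span_le]
    rintro _ ⟨g, ⟨j, hg⟩, rfl⟩
    have h1 := hE (hdiff j g ⟨_, hu.add_mem_dualMonoid hg⟩ rfl hg)
    have h0 : epsEq V J τ u b j ∈ Ideal.span (Set.range (epsEq V J τ u b)) :=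
      Ideal.subset_span ⟨j, rfl⟩
    have h2 := sub_mem (Ideal.mul_mem_left _ (single ⟨_, hu.add_mem_dualMonoid hg⟩ 1) h0) h1
    rwa [sub_sub_cancel] at h2

open AddMonoidAlgebra in
/-- The maps `φ_α` are homomorphisms of modules. -/
theorem IsNefFan.isDeformation (h : IsNefFan V J) {I₀ : Ideal (MvPolynomial V ℂ)}
    (hI₀ : ∀ τ, IsCone V τ → ∀ x, x ∈ chartIdeal V τ I₀ ↔
      ∀ g ∈ x.coeff.support, IsSpecialExponent J τ (g : dualMonoid τ))
    {j : Fin c} {α : Lat n} (hα : α ∈ divSections V (J j)) : IsDeformation V I₀ α := by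
  intro τ hτ
  have hsingle : ∀ (g : dualMonoid τ) (z : ℂ), IsSpecialExponent J τ g →
      single g z ∈ chartIdeal V τ I₀ := by
    intro g z hg
    rw [hI₀ τ hτ]
    intro g' hg'
    have := Finsupp.support_single_subset hg'
    rw [Finset.mem_singleton] at this
    rwa [this]
  set mk := Ideal.Quotient.mk (chartIdeal V τ I₀)
  set φ₀ : ChartRing ℂ τ →+ ChartRing ℂ τ ⧸ chartIdeal V τ I₀ :=
    (Finsupp.liftAddHom fun g => (mk : ChartRing ℂ τ →+ _).comp
      ((AddMonoidHom.mulRight (shiftMonomial ℂ τ α g)).comp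
        (algebraMap ℂ (ChartRing ℂ τ) : ℂ →+ ChartRing ℂ τ))).comp coeffAddEquiv.toAddMonoidHom with hφ₀
  have hφs : ∀ g z, φ₀ (single g z) =
      mk (algebraMap ℂ (ChartRing ℂ τ) z * shiftMonomial ℂ τ α g) := by
    intro g z
    simp [hφ₀]
  -- The critical case is g + α not regular but k + g + α regular. Then g vanishes on a ray of J_j ∩
  -- τ, so it is special through a different part. There α is nonnegative, and χ^{k+g+α} is zero in
  -- the quotient.
  have key : ∀ (g k : dualMonoid τ), IsSpecialExponent J τ g →
      mk (shiftMonomial ℂ τ α (k + g)) = mk (single k 1 * shiftMonomial ℂ τ α g) := by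
    intro g k hg
    have hassoc : ((k + g : dualMonoid τ) : Lat n) + α = k + (g + α) := by
      rw [AddSubmonoid.coe_add, add_assoc]
    by_cases h1 : (g : Lat n) + α ∈ dualMonoid τ
    · have h2 : ((k + g : dualMonoid τ) : Lat n) + α ∈ dualMonoid τ := by
        rw [hassoc]
        exact add_mem k.2 h1
      rw [shiftMonomial, shiftMonomial, dif_pos h1, dif_pos h2, single_mul_single, one_mul]
      congr 2
      exact Subtype.ext hassoc
    · rw [shiftMonomial, shiftMonomial, dif_neg h1, mul_zero, map_zero]
      split_ifs with h2
      · rw [Ideal.Quotient.eq_zero_iff_mem]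
        refine hsingle _ _ ?_
        obtain ⟨i, hi⟩ := hg
        rw [mem_dualMonoid] at h1
        push Not at h1
        obtain ⟨r, hrτ, hr⟩ := h1
        rw [add_dotProduct] at hr
        have hαr := hα r (hτ.subset hrτ)
        have hgr := g.2 r hrτ
        have hrj : r ∈ J j := by
          by_contra hrj
          rw [if_neg hrj] at hαr
          omega
        rw [if_pos hrj] at hαr
        have hij : i ≠ j := by
          rintro rfl
          have := hi r hrj hrτ
          omega
        refine ⟨i, fun ρ hρ hρτ => ?_⟩
        have h3 := hα ρ (hτ.subset hρτ)
        simp only [h.nef.mem_part_iff hρ, hij, if_false] at h3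
        have h4 := hi ρ hρ hρτ
        have h5 := k.2 ρ hρτ
        dsimp only
        rw [hassoc, add_dotProduct, add_dotProduct]
        omega
      · rw [map_zero]
  have hlin : ∀ (a x : ChartRing ℂ τ), x ∈ chartIdeal V τ I₀ → φ₀ (a * x) = a • φ₀ x := by
    intro a x hx
    rw [hI₀ τ hτ] at hx
    have hx' : x = ∑ g ∈ x.coeff.support, single g (x.coeff g) :=
      (AddMonoidAlgebra.sum_coeff_single x).symm
    rw [hx', Finset.mul_sum, map_sum, map_sum, Finset.smul_sum]
    refine Finset.sum_congr rfl fun g hg => ?_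
    induction a using AddMonoidAlgebra.induction_linear with
    | zero => simp
    | add a a' ha ha' => rw [add_mul, map_add, add_smul, ha, ha']
    | single k z =>
      rw [single_mul_single, hφs, hφs, map_mul, map_mul, key g k (hx g hg), ← map_mul, ← map_mul]
      change _ = mk (single k z * _)
      congr 1
      rw [show single k z = algebraMap ℂ (ChartRing ℂ τ) z * single k 1 by
        simp [single_mul_single], map_mul (algebraMap ℂ (ChartRing ℂ τ))]
      ring
  refine ⟨{ toFun := fun x => φ₀ x, map_add' := fun x y => by simp, map_smul' := fun a x => ?_ },
    fun g hg => ?_⟩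
  · exact hlin a x x.2
  · change φ₀ (single g 1) = _
    rw [hφs, map_one, one_mul]

end FirstOrder

/-! ### The polytope of special fiber weights -/

section Groebner

theorem exists_max_of_strictTotal {α : Type*} (lt : α → α → Prop)
    (htrans : ∀ a b c, lt a b → lt b c → lt a c) (htri : ∀ a b, a ≠ b → lt a b ∨ lt b a)
    (S : Finset α) (hS : S.Nonempty) : ∃ p ∈ S, ∀ q ∈ S, q ≠ p → lt q p := by
  induction hS using Finset.Nonempty.cons_induction with
  | singleton a => exact ⟨a, by simp, by simp⟩
  | cons a S ha hS ih =>
    obtain ⟨p, hp, hmax⟩ := ih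
    have hap : a ≠ p := fun h => ha (h ▸ hp)
    rcases htri a p hap with h | h
    · refine ⟨p, by simp [hp], fun q hq hqp => ?_⟩
      rcases Finset.mem_cons.1 hq with rfl | hq
      exacts [h, hmax q hq hqp]
    · refine ⟨a, by simp, fun q hq hqa => ?_⟩
      have hq := (Finset.mem_cons.1 hq).resolve_left hqa
      by_cases hqp : q = p
      · exact hqp ▸ h
      · exact htrans _ _ _ (hmax q hq hqp) h

variable {σ : Type} [Fintype σ]

theorem weightLT_trans (ord : LocalMonomialOrder σ) (wt : ℝ) (ω : σ → ℝ)
    (a b c : ℕ × (σ →₀ ℕ)) (h : weightLT ord wt ω a b) (h' : weightLT ord wt ω b c) :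
    weightLT ord wt ω a c := by
  have := ord.strictTotal
  rcases h with h | ⟨h, h2⟩ <;> rcases h' with h' | ⟨h', h2'⟩
  · exact Or.inl (h.trans h')
  · exact Or.inl (h'.symm ▸ h)
  · exact Or.inl (h ▸ h')
  · exact Or.inr ⟨h.trans h', _root_.trans h2 h2'⟩

theorem weightLT_or (ord : LocalMonomialOrder σ) (wt : ℝ) (ω : σ → ℝ)
    (a b : ℕ × (σ →₀ ℕ)) (h : a ≠ b) : weightLT ord wt ω a b ∨ weightLT ord wt ω b a := by
  have := ord.strictTotal
  rcases lt_trichotomy (weight wt ω a) (weight wt ω b) with h1 | h1 | h1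
  · exact Or.inl (Or.inl h1)
  · rcases trichotomous_of ord.lt a b with h2 | h2 | h2
    · exact Or.inl (Or.inr ⟨h1, h2⟩)
    · exact absurd h2 h
    · exact Or.inr (Or.inr ⟨h1.symm, h2⟩)
  · exact Or.inr (Or.inl h1)

theorem weight_le_of_weightLT {ord : LocalMonomialOrder σ} {wt : ℝ} {ω : σ → ℝ}
    {a b : ℕ × (σ →₀ ℕ)} (h : weightLT ord wt ω a b) : weight wt ω a ≤ weight wt ω b :=
  h.elim le_of_lt fun h => h.1.le

variable {n c : ℕ} {V : Finset (Lat n)} {J : Fin c → Finset (Lat n)}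

/-- The generators of the ideal of the canonical degeneration. -/
def degEq (V : Finset (Lat n)) (J : Fin c → Finset (Lat n)) (a : Lat n → ℂ) (j : Fin c) :
    MvPolynomial V ℂ[X] :=
  MvPolynomial.monomial (indicator V (J j)) (1 : ℂ[X]) + ∑ α ∈ freeFinset V J j,
    MvPolynomial.monomial (sectionExponent V (J j) α) (Polynomial.X * Polynomial.C (a α))

theorem IsNefFan.degenerationIdeal_eq_span_degEq (h : IsNefFan V J) (a : Lat n → ℂ) :
    degenerationIdeal V J a = Ideal.span (Set.range (degEq V J a)) := degenerationIdeal_eq h a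

theorem monomial_mem_map_specialIdeal {e : V →₀ ℕ} {p : ℂ[X]} (hp : p ≠ 0) :
    MvPolynomial.monomial e p ∈
      (specialIdeal V J).map (MvPolynomial.map (Polynomial.C : ℂ →+* ℂ[X])) ↔
      ∃ k, ∀ r : V, (r : Lat n) ∈ J k → 1 ≤ e r := by
  have : (specialIdeal V J).map (MvPolynomial.map (Polynomial.C : ℂ →+* ℂ[X])) =
      Ideal.span ((fun s => MvPolynomial.monomial s (1 : ℂ[X])) ''
        Set.range fun k => indicator V (J k)) := by
    rw [specialIdeal, Ideal.map_span, ← Set.range_comp, ← Set.range_comp]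
    congr 2
    funext k
    rw [Function.comp_apply, divMonomial_eq, MvPolynomial.map_monomial, map_one]
    rfl
  rw [this, MvPolynomial.mem_ideal_span_monomial_image]
  simp only [MvPolynomial.support_monomial, if_neg hp, Finset.mem_singleton,
    forall_eq, Set.exists_range_iff]
  refine exists_congr fun k => ?_
  rw [Finsupp.le_def]
  refine forall_congr' fun r => ?_
  simp only [indicator, Finsupp.equivFunOnFinite_symm_apply_apply]
  split_ifs with h <;> simp [h]

theorem tcoeff_add {σ : Type} (q : ℕ × (σ →₀ ℕ)) (f g : MvPolynomial σ ℂ[X]) :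
    tcoeff q (f + g) = tcoeff q f + tcoeff q g := by
  simp [tcoeff]

theorem tcoeff_sum {ι : Type*} {S : Type} (q : ℕ × (S →₀ ℕ)) (s : Finset ι)
    (f : ι → MvPolynomial S ℂ[X]) : tcoeff q (∑ i ∈ s, f i) = ∑ i ∈ s, tcoeff q (f i) := by
  simp [tcoeff, MvPolynomial.coeff_sum]

theorem tcoeff_monomial {σ : Type} (q : ℕ × (σ →₀ ℕ)) (e : σ →₀ ℕ) (p : ℂ[X]) :
    tcoeff q (MvPolynomial.monomial e p) = if e = q.2 then p.coeff q.1 else 0 := by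
  rw [tcoeff, MvPolynomial.coeff_monomial]
  split_ifs <;> simp

theorem sectionExponent_injOn
    (h : (0 : Vec n) ∈ interior (convexHull ℝ (toVec '' (V : Set (Lat n))))) {D : Finset (Lat n)}
    {α β : Lat n} (hα : α ∈ divSections V D) (hβ : β ∈ divSections V D)
    (he : sectionExponent V D α = sectionExponent V D β) : α = β := by
  refine eq_of_dotProduct_eq h fun r hr => ?_
  have h1 := sectionExponent_apply hα ⟨r, hr⟩
  have h2 := sectionExponent_apply hβ ⟨r, hr⟩
  rw [he] at h1
  dsimp only at h1 h2
  omega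

theorem IsNefFan.tcoeff_degEq_section (h : IsNefFan V J) (a : Lat n → ℂ) {j : Fin c} {α : Lat n}
    (hα : α ∈ freeSections V J j) :
    tcoeff (1, sectionExponent V (J j) α) (degEq V J a j) = a α := by
  rw [degEq, tcoeff_add, tcoeff_sum, tcoeff_monomial, Finset.sum_eq_single α]
  · rw [tcoeff_monomial, if_pos rfl]
    simp [Polynomial.coeff_one]
  · intro β hβ hne
    rw [tcoeff_monomial, if_neg]
    intro he
    exact hne (sectionExponent_injOn h.interior (h.mem_freeFinset.1 hβ).1 hα.1 he)
  · exact fun hn => absurd (h.mem_freeFinset.2 hα) hn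

theorem IsNefFan.tcoeff_degEq_ne_zero (h : IsNefFan V J) (a : Lat n → ℂ) {j : Fin c}
    {q : ℕ × (V →₀ ℕ)} (hq : tcoeff q (degEq V J a j) ≠ 0) : q = (0, indicator V (J j)) ∨
      ∃ α ∈ freeSections V J j, q = (1, sectionExponent V (J j) α) := by
  rw [degEq, tcoeff_add, tcoeff_sum] at hq
  by_contra! hcon
  refine hq ?_
  rw [tcoeff_monomial, Finset.sum_eq_zero, add_zero]
  · split_ifs with h1
    · rw [Polynomial.coeff_one, if_neg]
      intro h0
      exact hcon.1 (Prod.ext h0 h1.symm)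
    · rfl
  · intro α hα
    rw [tcoeff_monomial]
    split_ifs with h1
    · rw [mul_comm, Polynomial.coeff_C_mul, Polynomial.coeff_X, if_neg, mul_zero]
      intro h0
      exact hcon.2 α (h.mem_freeFinset.1 hα) (Prod.ext h0.symm h1.symm)
    · rfl

theorem tcoeff_degEq_indicator (a : Lat n → ℂ) (j : Fin c) :
    tcoeff (0, indicator V (J j)) (degEq V J a j) = 1 := by
  rw [degEq, tcoeff_add, tcoeff_sum, tcoeff_monomial, if_pos rfl, Finset.sum_eq_zero]
  · simp
  · intro α _
    rw [tcoeff_monomial]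
    split_ifs <;> simp

theorem weight_indicator (wt : ℝ) (ω : V → ℝ) (D : Finset (Lat n)) :
    weight wt ω (0, indicator V D) = ∑ r : V, ω r * if (r : Lat n) ∈ D then 1 else 0 := by
  simp [weight, indicator]

theorem weight_section (wt : ℝ) (ω : V → ℝ) {D : Finset (Lat n)} {α : Lat n}
    (hα : α ∈ divSections V D) :
    weight wt ω (1, sectionExponent V D α) = weight wt ω (0, indicator V D) +
      (wt + toVec α ⬝ᵥ ∑ r : V, ω r • toVec (r : Lat n)) := by
  rw [weight_indicator, weight, dotProduct_sum]
  have : ∀ r : V, ω r * (sectionExponent V D α r : ℝ) =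
      ω r * (if (r : Lat n) ∈ D then 1 else 0) + toVec α ⬝ᵥ (ω r • toVec (r : Lat n)) := by
    intro r
    have h1 := congrArg (fun z : ℤ => (z : ℝ)) (sectionExponent_apply hα r)
    push_cast at h1
    rw [h1, dotProduct_smul, toVec_dotProduct, smul_eq_mul]
    ring
  rw [Finset.sum_congr rfl fun r _ => this r, Finset.sum_add_distrib]
  push_cast
  ring

/-- The lead monomial of t g_j + m_j lies in I₀, but the monomials of g_j do not, so m_j is the lead
monomial; comparing weights gives the inequality. Nonzero coefficients are needed for every u to
occur. -/
theorem IsNefFan.le_of_leadIdeal_eq (h : IsNefFan V J) (ord : LocalMonomialOrder V)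
    {a : Lat n → ℂ} (ha : ∀ j, ∀ u ∈ freeSections V J j, a u ≠ 0) {wt : ℝ} {ω : V → ℝ}
    (hlead : leadIdeal ord wt ω (degenerationIdeal V J a) =
      (specialIdeal V J).map (MvPolynomial.map Polynomial.C)) {j : Fin c} {α : Lat n}
    (hα : α ∈ freeSections V J j) :
    wt + toVec α ⬝ᵥ ∑ r : V, ω r • toVec (r : Lat n) ≤ 0 := by
  set S : Finset (ℕ × (V →₀ ℕ)) := insert (0, indicator V (J j))
    ((freeFinset V J j).image fun α => (1, sectionExponent V (J j) α)) with hS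
  have hmem : ∀ q ∈ S, tcoeff q (degEq V J a j) ≠ 0 := by
    intro q hq
    rcases Finset.mem_insert.1 hq with rfl | hq
    · rw [tcoeff_degEq_indicator]
      exact one_ne_zero
    · obtain ⟨β, hβ, rfl⟩ := Finset.mem_image.1 hq
      rw [h.tcoeff_degEq_section a (h.mem_freeFinset.1 hβ)]
      exact ha j β (h.mem_freeFinset.1 hβ)
  obtain ⟨p, hp, hmax⟩ := exists_max_of_strictTotal (weightLT ord wt ω)
    (weightLT_trans ord wt ω) (weightLT_or ord wt ω) S ⟨_, Finset.mem_insert_self _ _⟩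
  have hlp : MvPolynomial.monomial p.2 (Polynomial.X ^ p.1) ∈
      leadIdeal ord wt ω (degenerationIdeal V J a) := by
    refine Ideal.subset_span ⟨degEq V J a j, ?_, p, hmem p hp, fun q hq hqp => hmax q ?_ hqp, rfl⟩
    · rw [h.degenerationIdeal_eq_span_degEq]
      exact Ideal.subset_span ⟨j, rfl⟩
    · rcases h.tcoeff_degEq_ne_zero a hq with rfl | ⟨β, hβ, rfl⟩
      · exact Finset.mem_insert_self _ _
      · exact Finset.mem_insert_of_mem (Finset.mem_image_of_mem _ (h.mem_freeFinset.2 hβ))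
  rw [hlead, monomial_mem_map_specialIdeal (pow_ne_zero _ Polynomial.X_ne_zero)] at hlp
  have hp0 : p = (0, indicator V (J j)) := by
    rcases Finset.mem_insert.1 hp with hp | hp
    · exact hp
    · obtain ⟨β, hβ, rfl⟩ := Finset.mem_image.1 hp
      refine absurd ?_ (h.mem_freeFinset.1 hβ).2
      rw [sectionMonomial_eq, monomial_mem_specialIdeal]
      exact hlp
  have hq : (1, sectionExponent V (J j) α) ∈ S :=
    Finset.mem_insert_of_mem (Finset.mem_image_of_mem _ (h.mem_freeFinset.2 hα))
  have h1 := weight_le_of_weightLT (hmax _ hq (by rw [hp0]; simp))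
  rw [hp0, weight_section wt ω hα.1] at h1
  linarith

theorem IsNefFan.specialFiberPolytope_subset (h : IsNefFan V J)
    (hfull : HasFullNewtonPolytopes V J) (ord : LocalMonomialOrder V)
    {a : Lat n → ℂ} (ha : ∀ j, ∀ u ∈ freeSections V J j, a u ≠ 0) :
    specialFiberPolytope V ord (specialIdeal V J) (degenerationIdeal V J a) ⊆
      TropMirror.dual (nablaDual V J) := by
  intro w hw
  have key : ∀ j, ∀ α ∈ freeSections V J j, -1 ≤ toVec α ⬝ᵥ w := by
    intro j α hα
    have hcl : IsClosed {p : ℝ × Vec n | -p.1 ≤ toVec α ⬝ᵥ p.2} := by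
      refine isClosed_le (by fun_prop) ?_
      simp only [dotProduct]
      fun_prop
    refine (closure_minimal ?_ hcl : groebnerCone V ord (specialIdeal V J)
      (degenerationIdeal V J a) ⊆ _) hw
    rintro p ⟨ω, hω, hlead⟩
    have := h.le_of_leadIdeal_eq ord ha hlead hα
    rw [hω, dotProduct_neg] at this
    simp only [Set.mem_ofPred_eq]
    linarith
  rw [mem_dual_nablaDual]
  intro j u hu
  have hu' := toVec_mem_sectionPolytope hu
  rw [← hfull j] at hu'
  refine le_dotProduct_of_mem_convexHull ?_ hu'
  rintro _ (rfl | ⟨α, hα, rfl⟩)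
  · simp
  · exact key j α hα

end Groebner

/-! ### Homogenization and standard bases -/

section Rees
variable {n c : ℕ} {V : Finset (Lat n)} {J : Fin c → Finset (Lat n)} {σ : Type} [Fintype σ]

/-- The degree of `t^k x^m` for positive integral weights. -/
def natDeg (d : ℕ) (k : σ → ℕ) (q : ℕ × (σ →₀ ℕ)) : ℕ := d * q.1 + ∑ r, k r * q.2 r

open AddMonoidAlgebra in
/-- The homogenization with respect to positive integral weights. -/
def rees (d : ℕ) (k : σ → ℕ) :
    MvPolynomial σ ℂ[X] →+* AddMonoidAlgebra ℂ[X] (ℕ × (σ →₀ ℕ)) :=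
  MvPolynomial.eval₂Hom
    (Polynomial.eval₂RingHom ((algebraMap ℂ[X] _).comp Polynomial.C)
      (single ((1, 0) : ℕ × (σ →₀ ℕ)) (Polynomial.X ^ d)))
    fun r => single (0, Finsupp.single r 1) (Polynomial.X ^ k r)

open AddMonoidAlgebra in
theorem rees_monomial (d : ℕ) (k : σ → ℕ) (i : ℕ) (e : σ →₀ ℕ) (z : ℂ) :
    rees d k (MvPolynomial.monomial e (Polynomial.monomial i z)) =
      single (i, e) (Polynomial.C z * Polynomial.X ^ natDeg d k (i, e)) := by
  have h1 : rees d k (MvPolynomial.monomial e 1) =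
      single (0, e) (Polynomial.X ^ natDeg d k (0, e)) := by
    induction e using Finsupp.induction_linear with
    | zero =>
      rw [MvPolynomial.monomial_zero', map_one, map_one]
      simp [natDeg, one_def]
      rfl
    | add e f he hf =>
      rw [show MvPolynomial.monomial (e + f) (1 : ℂ[X]) =
        MvPolynomial.monomial e 1 * MvPolynomial.monomial f 1 by
          rw [MvPolynomial.monomial_mul, one_mul], map_mul, he, hf, single_mul_single, ← pow_add]
      congr 2
      simp [natDeg, mul_add, Finset.sum_add_distrib]
    | single r m =>
      rw [← MvPolynomial.X_pow_eq_monomial, map_pow, rees, MvPolynomial.coe_eval₂Hom,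
        MvPolynomial.eval₂_X, single_pow, ← pow_mul]
      congr 1
      · simp
      · simp [natDeg, Finsupp.single_apply, Finset.sum_ite_eq]
  rw [show MvPolynomial.monomial e (Polynomial.monomial i z) =
    MvPolynomial.C (Polynomial.monomial i z) * MvPolynomial.monomial e 1 by
    rw [MvPolynomial.C_mul_monomial, mul_one], map_mul, h1]
  rw [rees, MvPolynomial.coe_eval₂Hom, MvPolynomial.eval₂_C, Polynomial.coe_eval₂RingHom,
    Polynomial.eval₂_monomial, single_pow]
  simp [single_mul_single, natDeg, pow_add, pow_mul, mul_assoc]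

open AddMonoidAlgebra in
theorem coeff_rees (d : ℕ) (k : σ → ℕ) (f : MvPolynomial σ ℂ[X]) (q : ℕ × (σ →₀ ℕ)) :
    (rees d k f).coeff q = Polynomial.C (tcoeff q f) * Polynomial.X ^ natDeg d k q := by
  induction f using MvPolynomial.induction_on' with
  | add f g hf hg => rw [map_add, coeff_add, Finsupp.add_apply, hf, hg, tcoeff_add, map_add, add_mul]
  | monomial e p =>
    induction p using Polynomial.induction_on' with
    | add p p' hp hp' =>
      rw [map_add, map_add, coeff_add, Finsupp.add_apply, hp, hp', tcoeff_add, map_add, add_mul]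
    | monomial i z =>
      rw [rees_monomial, coeff_single, Finsupp.single_apply, tcoeff_monomial,
        Polynomial.coeff_monomial]
      split_ifs with h1 h2 h3 h2 h3
      · rw [h1]
      · exact absurd (congrArg Prod.fst h1) h3
      · exact absurd (congrArg Prod.snd h1) h2
      · exact absurd (Prod.ext h3 h2) h1
      · simp
      · simp

open AddMonoidAlgebra in
theorem exists_eq_single_mul {R G : Type*} [CommRing R] [AddCommMonoid G] {s : R}
    {x : AddMonoidAlgebra R G} (h : ∀ a, s ∣ x.coeff a) : ∃ y, x = single 0 s * y := by
  choose y hy using h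
  refine ⟨∑ a ∈ x.coeff.support, single a (y a), ?_⟩
  conv_lhs => rw [← AddMonoidAlgebra.sum_coeff_single x]
  rw [Finsupp.sum, Finset.mul_sum]
  refine Finset.sum_congr rfl fun a _ => ?_
  rw [single_mul_single, zero_add, ← hy]

open AddMonoidAlgebra in
/-- If the lead monomials of the generators are the `m_j`, then the lead ideal is generated by
them. -/
theorem IsNefFan.lead_mem (h : IsNefFan V J) (a : Lat n → ℂ) {d : ℕ} {k : V → ℕ}
    (hlt : ∀ j, ∀ α ∈ freeSections V J j,
      natDeg d k (0, indicator V (J j)) < natDeg d k (1, sectionExponent V (J j) α))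
    {f : MvPolynomial V ℂ[X]} (hf : f ∈ degenerationIdeal V J a) {p : ℕ × (V →₀ ℕ)}
    (hp : tcoeff p f ≠ 0) (hmin : ∀ q, tcoeff q f ≠ 0 → natDeg d k p ≤ natDeg d k q) :
    ∃ j, ∀ r : V, (r : Lat n) ∈ J j → 1 ≤ p.2 r := by
  set μ : Fin c → ℕ × (V →₀ ℕ) := fun j => (0, indicator V (J j)) with hμ
  -- In the homogenized ring, each generator is a power of X times F_j = m_j + X q_j, and f is a
  -- power of X times f' with a nonzero constant coefficient at p. Cancelling X via coprimality puts
  -- f' in the ideal of the F_j, and reduction modulo X puts p among the multiples of the m_j.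
  have hF : ∀ j, ∃ F q, rees d k (degEq V J a j) =
      single 0 (Polynomial.X ^ natDeg d k (μ j)) * F ∧
      F = single (μ j) 1 + single 0 Polynomial.X * q := by
    intro j
    have h1 : ∀ e, (rees d k (degEq V J a j) -
        single (μ j) (Polynomial.X ^ natDeg d k (μ j))).coeff e ∈
          Ideal.span {(Polynomial.X ^ (natDeg d k (μ j) + 1) : ℂ[X])} := by
      intro e
      rw [coeff_sub, Finsupp.sub_apply, coeff_rees, coeff_single, Finsupp.single_apply]
      by_cases he : tcoeff e (degEq V J a j) = 0
      · have : μ j ≠ e := by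
          rintro rfl
          rw [tcoeff_degEq_indicator] at he
          exact one_ne_zero he
        rw [if_neg this, he]
        simp
      · rcases h.tcoeff_degEq_ne_zero a he with rfl | ⟨α, hα, rfl⟩
        · rw [tcoeff_degEq_indicator, if_pos rfl]
          simp [hμ]
        · rw [if_neg (by simp [hμ]), sub_zero, Ideal.mem_span_singleton]
          exact dvd_mul_of_dvd_right (pow_dvd_pow _ (hlt j α hα)) _
    obtain ⟨q, hq⟩ := exists_eq_single_mul fun e => Ideal.mem_span_singleton.1 (h1 e)
    refine ⟨_, q, ?_, rfl⟩
    rw [mul_add, single_mul_single, zero_add, mul_one, ← mul_assoc, single_mul_single, zero_add,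
      ← pow_succ, ← hq]
    ring
  choose F q hF hFq using hF
  obtain ⟨f', hf'⟩ : ∃ f', rees d k f = single 0 (Polynomial.X ^ natDeg d k p) * f' := by
    refine exists_eq_single_mul fun e => ?_
    rw [coeff_rees]
    by_cases he : tcoeff e f = 0
    · simp [he]
    · exact dvd_mul_of_dvd_right (pow_dvd_pow _ (hmin e he)) _
  have hfp : f'.coeff p = Polynomial.C (tcoeff p f) := by
    have h1 := congrArg (fun x => x.coeff (0 + p)) hf'
    rw [coeff_single_mul_add, zero_add, coeff_rees, mul_comm] at h1
    exact (mul_left_cancel₀ (pow_ne_zero _ Polynomial.X_ne_zero) h1).symm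
  have hmemF : rees d k f ∈ Ideal.span (Set.range F) := by
    rw [h.degenerationIdeal_eq_span_degEq] at hf
    have h1 := Ideal.mem_map_of_mem (rees d k) hf
    rw [Ideal.map_span, ← Set.range_comp] at h1
    refine (Ideal.span_le.2 ?_ : Ideal.span _ ≤ _) h1
    rintro _ ⟨j, rfl⟩
    rw [Function.comp_apply, hF]
    exact Ideal.mul_mem_left _ _ (Ideal.subset_span ⟨j, rfl⟩)
  have hcop : ∀ (k i : Fin c) (a b : ℕ × (V →₀ ℕ)), k ≠ i → μ k + a = μ i + b →
      ∃ b', a = μ i + b' := by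
    intro k i a b hki hab
    refine ⟨(a.1, a.2 - indicator V (J i)), Prod.ext (by simp [hμ]) ?_⟩
    ext r
    have h1 := congrArg (fun x => x.2 r) hab
    simp only [hμ, Prod.snd_add, Finsupp.add_apply, Finsupp.tsub_apply, indicator,
      Finsupp.equivFunOnFinite_symm_apply_apply] at h1 ⊢
    by_cases hr : (r : Lat n) ∈ J i
    · simp only [h.nef.mem_part_iff hr, hki.symm, if_true, if_false] at h1 ⊢
      omega
    · simp [hr]
  have hred : ∀ m : ℕ, single 0 (Polynomial.X ^ m) * f' ∈ Ideal.span (Set.range F) →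
      f' ∈ Ideal.span (Set.range F) := by
    intro m
    induction m with
    | zero => simp [← one_def]
    | succ m ih =>
      intro hm
      apply ih
      refine parameter_regular (s := Polynomial.X) (fun x hx => ?_) μ hcop F
        (fun j => ⟨q j, hFq j⟩) _ ?_
      · exact (mul_eq_zero.1 hx).resolve_left Polynomial.X_ne_zero
      · rw [← mul_assoc, single_mul_single, zero_add, ← pow_succ']
        exact hm
  have h2 := hred _ (hf' ▸ hmemF)
  have h3 : f' ∈ Ideal.span {single (0 : ℕ × (V →₀ ℕ)) (Polynomial.X : ℂ[X])} ⊔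
      Ideal.span ((fun k => single (μ k) (1 : ℂ[X])) '' (Finset.univ : Finset (Fin c))) := by
    rw [← span_sup_eq (F := F) (fun k => ⟨_, hFq k⟩)]
    refine Ideal.mem_sup_right ?_
    simpa using h2
  rcases (mem_span_monomials _ _ _ _).1 h3 p with h4 | ⟨j, -, b, hb⟩
  · rw [hfp, Polynomial.X_dvd_iff, Polynomial.coeff_C_zero] at h4
    exact absurd h4 hp
  · refine ⟨j, fun r hr => ?_⟩
    rw [hb]
    simp [hμ, indicator, hr]

end Rees

/-! ### The special fiber polytope equals ∇ -/

section GroebnerCone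
variable {n c : ℕ} {V : Finset (Lat n)} {J : Fin c → Finset (Lat n)}

theorem weight_eq_natDeg {σ : Type} [Fintype σ] {d : ℕ} (hd : 0 < d) (k : σ → ℕ)
    (q : ℕ × (σ →₀ ℕ)) :
    weight (-1) (fun r => -((k r : ℝ) / d)) q = -((natDeg d k q : ℝ) / d) := by
  have hd' : (d : ℝ) ≠ 0 := by positivity
  rw [weight, natDeg]
  push_cast
  rw [add_div, mul_div_cancel_left₀ _ hd', Finset.sum_div, neg_add, ← Finset.sum_neg_distrib,
    neg_one_mul]
  congr 1
  exact Finset.sum_congr rfl fun r _ => by ring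

/-- The weights are -k/d, so a term of largest weight is one of least degree and `lead_mem` applies;
ties are harmless. -/
theorem IsNefFan.leadIdeal_eq (h : IsNefFan V J) (ord : LocalMonomialOrder V) (a : Lat n → ℂ)
    {d : ℕ} (hd : 0 < d) {k : V → ℕ}
    (hk : ∀ j, ∀ α ∈ freeSections V J j,
      -1 < toVec α ⬝ᵥ ∑ r : V, ((k r : ℝ) / d) • toVec (r : Lat n)) :
    leadIdeal ord (-1) (fun r => -((k r : ℝ) / d)) (degenerationIdeal V J a) =
      (specialIdeal V J).map (MvPolynomial.map Polynomial.C) := by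
  have hd' : (0 : ℝ) < d := by positivity
  have hle : ∀ p q, natDeg d k p ≤ natDeg d k q ↔
      weight (-1) (fun r => -((k r : ℝ) / d)) q ≤ weight (-1) (fun r => -((k r : ℝ) / d)) p := by
    intro p q
    rw [weight_eq_natDeg hd, weight_eq_natDeg hd, neg_le_neg_iff, div_le_div_iff_of_pos_right hd',
      Nat.cast_le]
  have hlt : ∀ j, ∀ α ∈ freeSections V J j,
      natDeg d k (0, indicator V (J j)) < natDeg d k (1, sectionExponent V (J j) α) := by
    intro j α hα
    rw [← not_le, hle, weight_section _ _ hα.1, not_le]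
    have := hk j α hα
    simp only [neg_smul, Finset.sum_neg_distrib, dotProduct_neg]
    linarith
  apply le_antisymm
  · rw [leadIdeal, Ideal.span_le]
    rintro _ ⟨f, hf, p, hp, hmax, rfl⟩
    rw [SetLike.mem_coe, monomial_mem_map_specialIdeal (pow_ne_zero _ Polynomial.X_ne_zero)]
    refine h.lead_mem a hlt hf hp fun q hq => ?_
    by_cases hqp : q = p
    · rw [hqp]
    · rw [hle]
      exact weight_le_of_weightLT (hmax q hq hqp)
  · rw [specialIdeal, Ideal.map_span, Ideal.span_le]
    rintro _ ⟨_, ⟨j, rfl⟩, rfl⟩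
    refine Ideal.subset_span ⟨degEq V J a j, ?_, (0, indicator V (J j)), ?_, fun q hq hqp => ?_, ?_⟩
    · rw [h.degenerationIdeal_eq_span_degEq]
      exact Ideal.subset_span ⟨j, rfl⟩
    · rw [tcoeff_degEq_indicator]
      exact one_ne_zero
    · rcases h.tcoeff_degEq_ne_zero a hq with rfl | ⟨α, hα, rfl⟩
      · exact absurd rfl hqp
      · left
        rw [← not_le, ← hle, not_le]
        exact hlt j α hα
    · dsimp only
      rw [divMonomial_eq, MvPolynomial.map_monomial, map_one, pow_zero]

/-- Rational vectors have a common denominator. -/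
theorem exists_common_denominator {σ : Type} [Fintype σ] (q : σ → ℚ) (hq : ∀ r, 0 < q r) :
    ∃ d : ℕ, 0 < d ∧ ∃ k : σ → ℕ, ∀ r, (q r : ℝ) = (k r : ℝ) / d := by
  refine ⟨∏ r, (q r).den, Finset.prod_pos fun r _ => (q r).pos,
    fun r => (q r).num.toNat * ∏ s ∈ Finset.univ.erase r, (q s).den, fun r => ?_⟩
  have h1 : (((q r).num.toNat : ℕ) : ℤ) = (q r).num :=
    Int.toNat_of_nonneg (Rat.num_nonneg.2 (hq r).le)
  have h2 : (((q r).num.toNat : ℕ) : ℝ) = ((q r).num : ℝ) := by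
    simpa only [Int.cast_natCast] using congrArg (fun z : ℤ => (z : ℝ)) h1
  rw [← Finset.mul_prod_erase _ _ (Finset.mem_univ r), Nat.cast_mul, Nat.cast_mul, h2,
    mul_div_mul_right, Rat.cast_def]
  exact Nat.cast_ne_zero.2 (Finset.prod_ne_zero_iff.2 fun s _ => (q s).den_ne_zero)

/-- For t < 1 the point tw satisfies the inequalities strictly and has a representation by positive
weights. Rational weights are dense among those, and t → 1 reaches w. -/
theorem IsNefFan.subset_specialFiberPolytope (h : IsNefFan V J) (ord : LocalMonomialOrder V)
    (a : Lat n → ℂ) : TropMirror.dual (nablaDual V J) ⊆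
      specialFiberPolytope V ord (specialIdeal V J) (degenerationIdeal V J a) := by
  intro w hw
  set G := groebnerCone V ord (specialIdeal V J) (degenerationIdeal V J a) with hG
  have hGcl : IsClosed G := isClosed_closure
  set φ : (V → ℝ) → ℝ × Vec n := fun e => (1, ∑ r : V, e r • toVec (r : Lat n)) with hφ
  have hφc : Continuous φ := by fun_prop
  set O : Set (V → ℝ) := {e | (∀ r, 0 < e r) ∧
    ∀ j, ∀ α ∈ freeFinset V J j, -1 < toVec α ⬝ᵥ ∑ r : V, e r • toVec (r : Lat n)} with hO
  have hOo : IsOpen O := by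
    have h1 : O = (⋂ r, {e | 0 < e r}) ∩ ⋂ j, ⋂ α ∈ freeFinset V J j,
        {e | -1 < toVec α ⬝ᵥ ∑ r : V, e r • toVec (r : Lat n)} := by
      ext e
      simp [hO]
    rw [h1]
    refine (isOpen_iInter_of_finite fun r => isOpen_lt continuous_const (continuous_apply r)).inter
      (isOpen_iInter_of_finite fun j => isOpen_biInter_finset fun α _ =>
        isOpen_lt continuous_const ?_)
    simp only [dotProduct]
    fun_prop
  have hrat : DenseRange (fun q : V → ℚ => fun r => (q r : ℝ)) :=
    DenseRange.piMap fun _ => Rat.denseRange_cast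
  have hOG : ∀ e ∈ O, φ e ∈ G := by
    have h1 : O ⊆ closure (O ∩ Set.range (fun q : V → ℚ => fun r => (q r : ℝ))) :=
      hrat.open_subset_closure_inter hOo
    have h2 : O ∩ Set.range (fun q : V → ℚ => fun r => (q r : ℝ)) ⊆ φ ⁻¹' G := by
      rintro _ ⟨he, q, rfl⟩
      obtain ⟨d, hd, k, hk⟩ := exists_common_denominator q fun r => (Rat.cast_pos (K := ℝ)).1 (he.1 r)
      refine subset_closure ⟨fun r => -((k r : ℝ) / d), ?_, h.leadIdeal_eq ord a hd fun j α hα => ?_⟩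
      · simp [hφ, hk]
      · simpa only [hk] using he.2 j α (h.mem_freeFinset.2 hα)
    exact fun e he => closure_minimal h2 (hGcl.preimage hφc) (h1 he)
  have hlam : ∀ t ∈ Set.Ico (0 : ℝ) 1, ((1, t • w) : ℝ × Vec n) ∈ G := by
    rintro t ⟨ht0, ht1⟩
    obtain ⟨e, he, hew⟩ := exists_pos_combination h.interior (t • w)
    have h1 : ∑ r : V, e (r : Lat n) • toVec (r : Lat n) = t • w := by
      rw [← hew, Finset.sum_coe_sort V (fun r => e r • toVec r)]
    have := hOG (fun r => e r) ⟨fun r => he r, fun j α hα => ?_⟩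
    · simpa only [hφ, h1] using this
    · rw [h1, dotProduct_smul, smul_eq_mul]
      have := mem_dual_nablaDual.1 hw j α (h.mem_freeFinset.1 hα).1
      nlinarith
  have hcl : IsClosed {t : ℝ | ((1, t • w) : ℝ × Vec n) ∈ G} :=
    hGcl.preimage (by fun_prop)
  have h1 : (1 : ℝ) ∈ closure (Set.Ico (0 : ℝ) 1) := by
    rw [closure_Ico zero_ne_one]
    exact ⟨zero_le_one, le_rfl⟩
  have h2 := closure_minimal (fun t ht => hlam t ht : Set.Ico (0 : ℝ) 1 ⊆ _) hcl h1
  have h3 : ((1, (1 : ℝ) • w) : ℝ × Vec n) ∈ G := h2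
  rwa [one_smul] at h3

theorem IsNefFan.specialFiberPolytope_eq (h : IsNefFan V J)
    (hfull : HasFullNewtonPolytopes V J) (ord : LocalMonomialOrder V)
    {a : Lat n → ℂ} (ha : ∀ j, ∀ u ∈ freeSections V J j, a u ≠ 0) :
    specialFiberPolytope V ord (specialIdeal V J) (degenerationIdeal V J a) =
      TropMirror.dual (nablaDual V J) :=
  (h.specialFiberPolytope_subset hfull ord ha).antisymm (h.subset_specialFiberPolytope ord a)

end GroebnerCone

/-! ### The special fiber tropical variety -/

section Tropical
variable {n c : ℕ} {V : Finset (Lat n)} {J : Fin c → Finset (Lat n)}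

theorem evalAt_monomial {σ : Type} [Fintype σ] (t : PuiseuxField) (x : σ → PuiseuxField)
    (e : σ →₀ ℕ) (p : ℂ[X]) : evalAt t x (MvPolynomial.monomial e p) =
      Polynomial.eval₂ HahnSeries.C t p * ∏ r, x r ^ e r := by
  rw [evalAt, MvPolynomial.coe_eval₂Hom, MvPolynomial.eval₂_monomial,
    Finsupp.prod_fintype _ _ fun _ => pow_zero _, Polynomial.coe_eval₂RingHom]

theorem evalAt_degEq (t : PuiseuxField) (x : V → PuiseuxField) (a : Lat n → ℂ) (j : Fin c) :
    evalAt t x (degEq V J a j) = ∏ r, x r ^ indicator V (J j) r + ∑ α ∈ freeFinset V J j,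
      t * HahnSeries.C (a α) * ∏ r, x r ^ sectionExponent V (J j) α r := by
  simp only [degEq, map_add, map_sum, evalAt_monomial, Polynomial.eval₂_one, one_mul,
    Polynomial.eval₂_mul, Polynomial.eval₂_X, Polynomial.eval₂_C]

theorem order_prod_pow {σ : Type} [Fintype σ] {x : σ → PuiseuxField} (hx : ∀ r, x r ≠ 0)
    (e : σ → ℕ) : (∏ r, x r ^ e r).order = ∑ r, (x r).order * e r := by
  have key : ∀ s : Finset σ, (∏ r ∈ s, x r ^ e r).order = ∑ r ∈ s, (x r).order * e r := by
    intro s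
    induction s using Finset.induction_on with
    | empty => simp
    | insert i s hi ih =>
      rw [Finset.prod_insert hi, Finset.sum_insert hi, HahnSeries.order_mul (pow_ne_zero _ (hx i))
        (Finset.prod_ne_zero_iff.2 fun r _ => pow_ne_zero _ (hx r)), ih, HahnSeries.order_pow,
        nsmul_eq_mul, mul_comm]
  exact key _

theorem sum_order_sectionExponent {x : V → PuiseuxField} {D : Finset (Lat n)} {α : Lat n}
    (hα : α ∈ divSections V D) :
    ∑ r, (x r).order * (sectionExponent V D α r : ℝ) =
      ∑ r, (x r).order * (indicator V D r : ℝ) +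
        toVec α ⬝ᵥ ∑ r : V, (x r).order • toVec (r : Lat n) := by
  rw [dotProduct_sum, ← Finset.sum_add_distrib]
  refine Finset.sum_congr rfl fun r _ => ?_
  have := congrArg (Int.cast (R := ℝ)) (sectionExponent_apply hα r)
  push_cast at this
  rw [this, dotProduct_smul, toVec_dotProduct, smul_eq_mul, indicator,
    Finsupp.coe_equivFunOnFinite_symm, ← mul_add]
  push_cast
  rfl

/-- At a point of the tropical variety, the minimum in each tropical equation is attained by a
section that is different from `m_j`. -/
theorem IsNefFan.exists_free_of_mem_tropSupport (h : IsNefFan V J) (a : Lat n → ℂ) {w : Vec n}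
    (hw : ((1, w) : ℝ × Vec n) ∈ bergmanFan V (degenerationIdeal V J a)) (j : Fin c) :
    ∃ α ∈ freeSections V J j, toVec α ⬝ᵥ w ≤ -1 := by
  obtain ⟨t, x, ht, hx, h0, ht1, hxw⟩ := hw
  dsimp only at ht1 hxw
  by_contra! hcon
  have h1 := h0 (degEq V J a j) (by
    rw [h.degenerationIdeal_eq_span_degEq]; exact Ideal.subset_span ⟨j, rfl⟩)
  rw [evalAt_degEq] at h1
  set m := ∏ r, x r ^ indicator V (J j) r with hm
  have hm0 : m ≠ 0 := Finset.prod_ne_zero_iff.2 fun r _ => pow_ne_zero _ (hx r)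
  -- Otherwise all other terms have larger order than m_j and nothing cancels its leading
  -- coefficient.
  have h2 := congrArg (fun y => HahnSeries.coeff y m.order) h1
  simp only [HahnSeries.coeff_add, HahnSeries.coeff_zero, HahnSeries.coeff_sum] at h2
  rw [Finset.sum_eq_zero, add_zero, HahnSeries.coeff_order_eq_zero] at h2
  · exact hm0 h2
  · intro α hα
    have hα' := h.mem_freeFinset.1 hα
    by_cases haα : a α = 0
    · rw [haα, map_zero, mul_zero, zero_mul, HahnSeries.coeff_zero]
    · have hp : ∏ r, x r ^ sectionExponent V (J j) α r ≠ 0 :=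
        Finset.prod_ne_zero_iff.2 fun r _ => pow_ne_zero _ (hx r)
      have hC : (HahnSeries.C (a α) : PuiseuxField) ≠ 0 := HahnSeries.C_ne_zero haα
      apply HahnSeries.coeff_eq_zero_of_lt_order
      rw [HahnSeries.order_mul (mul_ne_zero ht hC) hp, HahnSeries.order_mul ht hC,
        HahnSeries.order_C, ht1, hm, order_prod_pow hx, order_prod_pow hx,
        sum_order_sectionExponent hα'.1, hxw]
      linarith [hcon α hα']

theorem IsNefFan.isClosed_dual (h : IsNefFan V J) : IsClosed (TropMirror.dual (nablaDual V J)) :=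
  h.isLatticePolytope_dual_nablaDual.isCompact.isClosed

/-- The facets of J_j° cover T: the tight free section lies in Δ_j = conv(0, J_j°), so its face
contains an element of J_j°. -/
theorem IsNefFan.exists_dualPart_of_mem_tropSupport (h : IsNefFan V J) {a : Lat n → ℂ} {w : Vec n}
    (hw : w ∈ tropSupport V (degenerationIdeal V J a) (TropMirror.dual (nablaDual V J)))
    (j : Fin c) : ∃ r ∈ dualParts V J j, toVec r ⬝ᵥ w = -1 := by
  have hwQ : w ∈ TropMirror.dual (nablaDual V J) := h.isClosed_dual.frontier_subset hw.1
  obtain ⟨α, hα, hαw⟩ := h.exists_free_of_mem_tropSupport a hw.2 j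
  have h1 := toVec_mem_sectionPolytope hα.1
  rw [h.sectionPolytope_eq, nablaPart] at h1
  obtain ⟨s, hs, hsw⟩ := exists_mem_face (w := w) (c := -1) (by
    rintro _ ⟨r, hr, rfl⟩
    rcases Finset.mem_insert.1 hr with rfl | hr
    · simp
    · exact h.le_of_mem_dual hwQ (dualParts_subset j hr)) h1
    (le_antisymm hαw (mem_dual_nablaDual.1 hwQ j α hα.1))
  obtain ⟨r, hr, rfl⟩ := hs
  rcases Finset.mem_insert.1 hr with rfl | hr
  · simp at hsw
  · exact ⟨r, hr, hsw⟩

/-- The exponents of a squarefree monomial. -/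
def finsetExponent {W : Finset (Lat n)} (A : Finset W) : W →₀ ℕ :=
  Finsupp.equivFunOnFinite.symm fun r => if r ∈ A then 1 else 0

theorem prod_X_eq {W : Finset (Lat n)} (A : Finset W) :
    ∏ r ∈ A, (MvPolynomial.X r : MvPolynomial W ℂ) =
      MvPolynomial.monomial (finsetExponent A) 1 := by
  rw [finsetExponent, ← prod_X_pow_eq, Finset.prod_congr rfl fun r _ => pow_ite _ _ _ _]
  simp only [pow_one, pow_zero, Finset.prod_ite_mem, Finset.univ_inter]

open AddMonoidAlgebra in
/-- The ideal of `X_0°` on a chart. -/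
theorem mem_chartIdeal_mirrorSpecialIdeal {W τ : Finset (Lat n)}
    (hW : (0 : Vec n) ∈ interior (convexHull ℝ (toVec '' (W : Set (Lat n))))) {Q T : Set (Vec n)}
    {x : ChartRing ℂ τ} : x ∈ chartIdeal W τ (mirrorSpecialIdeal W Q T) ↔
      ∀ g ∈ x.coeff.support, ∃ A : Finset W,
        T ⊆ (⋃ r ∈ A, {w | w ∈ Q ∧ toVec (r : Lat n) ⬝ᵥ w = -1}) ∧
        ∀ r ∈ A, (r : Lat n) ∈ τ → 1 ≤ (g : Lat n) ⬝ᵥ (r : Lat n) := by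
  set C : Finset (Finset W) := Finset.univ.filter fun A =>
    T ⊆ (⋃ r ∈ A, {w | w ∈ Q ∧ toVec (r : Lat n) ⬝ᵥ w = -1}) with hC
  have h1 : (mirrorSpecialIdeal W Q T).map (coxToLoc ℂ W τ) =
      Ideal.span {single (0 : locMonoid W τ) (0 : ℂ)} ⊔ Ideal.span
        ((fun A => single (natExp W τ (finsetExponent A)) (1 : ℂ)) '' C) := by
    rw [mirrorSpecialIdeal, Ideal.map_span, single_zero, Ideal.span_singleton_zero, bot_sup_eq]
    congr 1
    ext y
    simp only [Set.mem_image, Set.mem_ofPred_eq, hC, Finset.coe_filter, Finset.mem_univ, true_and]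
    constructor
    · rintro ⟨_, ⟨A, hA, rfl⟩, rfl⟩
      exact ⟨A, hA, by rw [prod_X_eq, coxToLoc_monomial]⟩
    · rintro ⟨A, hA, rfl⟩
      exact ⟨_, ⟨A, hA, rfl⟩, by rw [prod_X_eq, coxToLoc_monomial]⟩
  have h2 : ∀ (g : dualMonoid τ) (A : Finset W),
      (∃ b, degZero W τ g = natExp W τ (finsetExponent A) + b) ↔
        ∀ r ∈ A, (r : Lat n) ∈ τ → 1 ≤ (g : Lat n) ⬝ᵥ (r : Lat n) := by
    intro g A
    constructor
    · rintro ⟨b, hb⟩ r hr hrτ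
      have h3 := congrFun (congrArg Subtype.val hb) r
      have h4 := b.2 r hrτ
      simp only [degZero, natExp, finsetExponent, AddMonoidHom.coe_mk, ZeroHom.coe_mk,
        AddSubmonoid.coe_add, Pi.add_apply, Finsupp.coe_equivFunOnFinite_symm, if_pos hr] at h3
      push_cast at h3
      omega
    · intro hg
      refine ⟨⟨fun r => (g : Lat n) ⬝ᵥ (r : Lat n) - finsetExponent A r, fun r hr => ?_⟩, ?_⟩
      · have h3 := g.2 r hr
        have h4 := hg r
        rw [finsetExponent, Finsupp.coe_equivFunOnFinite_symm]
        dsimp only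
        split_ifs with hrA
        · have := h4 hrA hr
          push_cast
          omega
        · push_cast
          omega
      · ext r
        simp [degZero, natExp]
  rw [chartIdeal, Ideal.mem_comap, h1, mem_span_monomials]
  have h3 : ∀ g, (chartToLoc ℂ W τ x).coeff (degZero W τ g) = x.coeff g := fun g =>
    Finsupp.mapDomain_apply (degZero_injective hW) _ _
  simp only [zero_dvd_iff]
  constructor
  · intro hx g hg
    rcases hx (degZero W τ g) with h4 | ⟨A, hA, h4⟩
    · rw [h3] at h4
      exact absurd h4 (Finsupp.mem_support_iff.1 hg)
    · exact ⟨A, (Finset.mem_filter.1 hA).2, (h2 g A).1 h4⟩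
  · intro hx a
    by_cases ha : ∃ g, degZero W τ g = a
    · obtain ⟨g, rfl⟩ := ha
      by_cases hg : x.coeff g = 0
      · left
        rw [h3, hg]
      · right
        obtain ⟨A, hA, h4⟩ := hx g (Finsupp.mem_support_iff.2 hg)
        exact ⟨A, Finset.mem_filter.2 ⟨Finset.mem_univ _, hA⟩, (h2 g A).2 h4⟩
    · left
      exact Finsupp.mapDomain_of_notMem_range _ _ fun ⟨g, hg⟩ => ha ⟨g, hg⟩

end Tropical

/-! ### Solving equations in power series -/

section PowerSeriesSolution

open PowerSeries in
/-- A contraction in the `X`-adic topology has a fixed point. -/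
theorem exists_powerSeries_fixedPoint {κ R : Type*} [CommRing R] (Φ : (κ → R⟦X⟧) → κ → R⟦X⟧)
    (hΦ : ∀ m a b, (∀ k, X ^ m ∣ a k - b k) → ∀ k, X ^ (m + 1) ∣ Φ a k - Φ b k) :
    ∃ L, Φ L = L := by
  set A : ℕ → κ → R⟦X⟧ := fun m => Φ^[m] 0 with hA
  have hA1 : ∀ m, A (m + 1) = Φ (A m) := fun m => Function.iterate_succ_apply' _ _ _
  have h1 : ∀ m p k, X ^ m ∣ A (m + p) k - A m k := by
    intro m
    induction m with
    | zero => intro p k; rw [pow_zero]; exact one_dvd _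
    | succ m ih =>
      intro p k
      rw [add_right_comm, hA1, hA1]
      exact hΦ m _ _ (ih p) k
  -- The coefficient of X^m no longer changes from the (m+1)-st iterate on.
  set L : κ → R⟦X⟧ := fun k => mk fun m => coeff m (A (m + 1) k) with hL
  have h2 : ∀ m k, X ^ m ∣ L k - A m k := by
    intro m k
    rw [X_pow_dvd_iff]
    intro i hi
    obtain ⟨p, rfl⟩ := Nat.exists_eq_add_of_lt hi
    have := X_pow_dvd_iff.1 (h1 (i + 1) p k) i (Nat.lt_succ_self i)
    rw [map_sub, hL, coeff_mk, ← neg_sub, ← map_sub, neg_eq_zero, add_right_comm]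
    exact this
  refine ⟨L, funext fun k => ?_⟩
  rw [← sub_eq_zero]
  ext m
  have h3 : X ^ (m + 1) ∣ Φ L k - L k := by
    have := dvd_sub (hΦ m _ _ (h2 m) k) (h2 (m + 1) k)
    rwa [hA1, sub_sub_sub_cancel_right] at this
  rw [X_pow_dvd_iff.1 h3 m (Nat.lt_succ_self m), map_zero]

open PowerSeries in
-- Solve each equation for its linear term L j. Terms with d = 0 do not involve L and the others
-- carry a factor X, so the iteration contracts. The constant term of L j is fixed by the d = 0
-- terms, hence nonzero.
theorem exists_powerSeries_solution {κ ι : Type*} [Fintype κ] (S : κ → Finset ι) {c : κ → ℂ}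
    (hc : ∀ j, c j ≠ 0) (β : κ → ι → ℂ) (d : κ → ι → ℕ) (m : κ → ι → κ → ℕ)
    (hm : ∀ j, ∀ α ∈ S j, d j α = 0 → ∀ k, m j α k = 0)
    (hβ : ∀ j, ∑ α ∈ (S j).filter (fun α => d j α = 0), β j α ≠ 0) :
    ∃ L : κ → ℂ⟦X⟧, (∀ j, constantCoeff (L j) ≠ 0) ∧
      ∀ j, C (c j) * L j + ∑ α ∈ S j, C (β j α) * X ^ d j α * ∏ k, L k ^ m j α k = 0 := by
  obtain ⟨L, hL⟩ := exists_powerSeries_fixedPoint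
    (fun (a : κ → ℂ⟦X⟧) j => -C (c j)⁻¹ * ∑ α ∈ S j, C (β j α) * X ^ d j α * ∏ k, a k ^ m j α k) (by
      intro i a b hab j
      rw [← mul_sub, ← Finset.sum_sub_distrib]
      refine Dvd.dvd.mul_left (Finset.dvd_sum fun α hα => ?_) _
      rw [← mul_sub]
      by_cases h0 : d j α = 0
      · simp [hm j α hα h0]
      · obtain ⟨e, he⟩ := Nat.exists_eq_succ_of_ne_zero h0
        have h1 : X ^ i ∣ ∏ k, a k ^ m j α k - ∏ k, b k ^ m j α k := by
          simp only [← Ideal.mem_span_singleton, ← Ideal.Quotient.eq] at hab ⊢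
          rw [map_prod, map_prod]
          exact Finset.prod_congr rfl fun k _ => by rw [map_pow, map_pow, hab]
        rw [he, pow_succ' X e, pow_succ', mul_left_comm (C _), mul_assoc X]
        exact mul_dvd_mul_left _ (Dvd.dvd.mul_left h1 _))
  have hL' : ∀ j, C (c j) * L j + ∑ α ∈ S j, C (β j α) * X ^ d j α * ∏ k, L k ^ m j α k = 0 := by
    intro j
    have h1 := congrFun hL j
    have h2 : C (c j) * C (c j)⁻¹ = (1 : ℂ⟦X⟧) := by
      rw [← map_mul, mul_inv_cancel₀ (hc j), map_one]
    nth_rewrite 1 [← h1]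
    rw [← mul_assoc, mul_neg, h2, neg_one_mul, neg_add_cancel]
  refine ⟨L, fun j hj => hβ j ?_, hL'⟩
  have h1 := congrArg constantCoeff (hL' j)
  rw [map_add, map_mul, hj, mul_zero, zero_add, map_sum, map_zero] at h1
  rw [Finset.sum_filter]
  refine (Finset.sum_congr rfl fun α hα => ?_).trans h1
  split_ifs with h0
  · simp [h0, hm j α hα h0]
  · simp [h0]

/-- Substitution of `t ^ (1 / N)` in a power series. -/
def toPuiseux (N : ℕ) [NeZero N] : PowerSeries ℂ →+* PuiseuxField :=
  (HahnSeries.embDomainRingHom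
    ((AddMonoidHom.mulRight ((N : ℝ)⁻¹)).comp (Nat.castAddMonoidHom ℝ))
    (fun a b h => by
      have : (N : ℝ) ≠ 0 := NeZero.ne _
      simpa [this] using h)
    (fun a b => by
      have : (0 : ℝ) < (N : ℝ)⁻¹ := inv_pos.2 (Nat.cast_pos.2 (NeZero.pos N))
      simp [mul_le_mul_iff_left₀ this])).comp
    (HahnSeries.toPowerSeries (R := ℂ)).symm.toRingHom

theorem coeff_toPuiseux (N : ℕ) [NeZero N] (y : PowerSeries ℂ) (k : ℕ) :
    (toPuiseux N y).coeff (k / N) = PowerSeries.coeff k y :=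
  HahnSeries.embDomain_coeff (a := k) (x := HahnSeries.toPowerSeries.symm y)

theorem exists_of_coeff_toPuiseux_ne_zero (N : ℕ) [NeZero N] {y : PowerSeries ℂ} {g : ℝ}
    (hg : (toPuiseux N y).coeff g ≠ 0) : ∃ k : ℕ, g = k / N := by
  by_contra hk
  refine hg (HahnSeries.embDomain_of_notMem_range ?_)
  rintro ⟨k, rfl⟩
  exact hk ⟨k, rfl⟩

theorem toPuiseux_ext (N : ℕ) [NeZero N] {y : PowerSeries ℂ} {x : PuiseuxField}
    (h1 : ∀ k : ℕ, x.coeff (k / N) = PowerSeries.coeff k y)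
    (h2 : ∀ g, x.coeff g ≠ 0 → ∃ k : ℕ, g = k / N) : toPuiseux N y = x := by
  ext g
  by_cases hg : ∃ k : ℕ, g = k / N
  · obtain ⟨k, rfl⟩ := hg
    rw [coeff_toPuiseux, h1]
  · rw [not_not.1 (mt (exists_of_coeff_toPuiseux_ne_zero N) hg), not_not.1 (mt (h2 g) hg)]

theorem toPuiseux_C_mul_X_pow (N : ℕ) [NeZero N] (z : ℂ) (m : ℕ) :
    toPuiseux N (PowerSeries.C z * PowerSeries.X ^ m) = HahnSeries.single ((m : ℝ) / N) z := by
  have hN : (N : ℝ) ≠ 0 := NeZero.ne _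
  refine toPuiseux_ext N (fun k => ?_) fun g hg => ?_
  · rw [PowerSeries.coeff_C_mul, PowerSeries.coeff_X_pow, HahnSeries.coeff_single,
      div_left_inj' hN, Nat.cast_inj]
    simp
  · refine ⟨m, by_contra fun h => hg ?_⟩
    rw [HahnSeries.coeff_single, if_neg h]

theorem order_toPuiseux (N : ℕ) [NeZero N] (m : ℕ) {u : PowerSeries ℂ}
    (hu : PowerSeries.constantCoeff u ≠ 0) :
    (toPuiseux N (PowerSeries.X ^ m * u)).order = (m : ℝ) / N := by
  have h0 : (toPuiseux N (PowerSeries.X ^ m * u)).coeff (m / N) ≠ 0 := by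
    rw [coeff_toPuiseux, PowerSeries.coeff_X_pow_mul', if_pos le_rfl, Nat.sub_self,
      PowerSeries.coeff_zero_eq_constantCoeff_apply]
    exact hu
  have hne : toPuiseux N (PowerSeries.X ^ m * u) ≠ 0 := fun h => h0 (by
    rw [h, HahnSeries.coeff_zero])
  refine le_antisymm (HahnSeries.order_le_of_coeff_ne_zero h0) ?_
  have h1 := mt HahnSeries.coeff_order_eq_zero.1 hne
  obtain ⟨k, hk⟩ := exists_of_coeff_toPuiseux_ne_zero N h1
  rw [hk, coeff_toPuiseux, PowerSeries.coeff_X_pow_mul'] at h1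
  rw [hk]
  split_ifs at h1 with h2
  · gcongr
  · exact absurd rfl h1

end PowerSeriesSolution

/-! ### Explicit zeros over Puiseux series -/

section BergmanFan
variable {n c : ℕ} {V : Finset (Lat n)} {J : Fin c → Finset (Lat n)}

/-- A point of the torus at which given initial forms of the `g_j` do not vanish. -/
theorem exists_torus_point
    (h : (0 : Vec n) ∈ interior (convexHull ℝ (toVec '' (V : Set (Lat n))))) {a : Lat n → ℂ}
    (F : Fin c → Finset (Lat n)) (hF : ∀ j, ∀ α ∈ F j, α ∈ divSections V (J j))
    (hne : ∀ j, (F j).Nonempty) (ha : ∀ j, ∀ α ∈ F j, a α ≠ 0) :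
    ∃ z : V → ℂ, (∀ r, z r ≠ 0) ∧
      ∀ j, ∑ α ∈ F j, a α * ∏ r, z r ^ sectionExponent V (J j) α r ≠ 0 := by
  set p : MvPolynomial V ℂ := (∏ r, MvPolynomial.X r) * ∏ j, ∑ α ∈ F j,
    MvPolynomial.monomial (sectionExponent V (J j) α) (a α) with hp
  have hp0 : p ≠ 0 := by
    refine mul_ne_zero (Finset.prod_ne_zero_iff.2 fun r _ => MvPolynomial.X_ne_zero r)
      (Finset.prod_ne_zero_iff.2 fun j _ hj => ?_)
    obtain ⟨α, hα⟩ := hne j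
    have h1 := congrArg (MvPolynomial.coeff (sectionExponent V (J j) α)) hj
    rw [MvPolynomial.coeff_sum, Finset.sum_eq_single_of_mem α hα, MvPolynomial.coeff_monomial,
      if_pos rfl, MvPolynomial.coeff_zero] at h1
    · exact ha j α hα h1
    · intro β hβ hne
      rw [MvPolynomial.coeff_monomial, if_neg]
      exact fun he => hne (sectionExponent_injOn h (hF j β hβ) (hF j α hα) he)
  obtain ⟨z, hz⟩ : ∃ z, MvPolynomial.eval z p ≠ 0 := by
    by_contra! hcon
    exact hp0 (MvPolynomial.funext fun z => by rw [hcon z, map_zero])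
  rw [hp, map_mul, map_prod, map_prod, mul_ne_zero_iff, Finset.prod_ne_zero_iff,
    Finset.prod_ne_zero_iff] at hz
  refine ⟨z, fun r => by simpa using hz.1 r (Finset.mem_univ r), fun j => ?_⟩
  have h1 := hz.2 j (Finset.mem_univ j)
  rw [map_sum] at h1
  convert h1 using 2 with α
  rw [MvPolynomial.eval_monomial, Finsupp.prod_fintype _ _ fun _ => pow_zero _]

variable {ι : Type*} [Fintype ι]

/-- The number of times that a ray occurs in a family. -/
def multiplicity (V : Finset (Lat n)) (v : ι → Fin c → Lat n) (r : V) : ℕ :=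
  ∑ i, ∑ k, if v i k = (r : Lat n) then 1 else 0

theorem sum_multiplicity_smul {v : ι → Fin c → Lat n} (hv : ∀ i k, v i k ∈ V) {M : Type*}
    [AddCommMonoid M] (f : Lat n → M) :
    ∑ r : V, multiplicity V v r • f r = ∑ i, ∑ k, f (v i k) := by
  simp only [multiplicity, Finset.sum_smul, ite_smul, one_smul, zero_smul]
  rw [Finset.sum_comm]
  refine Finset.sum_congr rfl fun i _ => ?_
  rw [Finset.sum_comm]
  refine Finset.sum_congr rfl fun k _ => ?_
  rw [Finset.sum_coe_sort V (fun r => if v i k = r then f r else 0), Finset.sum_ite_eq,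
    if_pos (hv i k)]

theorem IsNefFan.sum_multiplicity_indicator (h : IsNefFan V J) {v : ι → Fin c → Lat n}
    (hv : ∀ i k, v i k ∈ J k) (j : Fin c) :
    ∑ r : V, multiplicity V v r * indicator V (J j) r = Fintype.card ι := by
  have h1 := sum_multiplicity_smul (fun i k => h.nef.subset k (hv i k))
    (fun r => if r ∈ J j then 1 else 0)
  simp only [h.nef.mem_part_iff (hv _ _), Finset.sum_ite_eq', Finset.mem_univ, if_true,
    Finset.sum_const, Finset.card_univ, smul_eq_mul, mul_one] at h1
  exact h1

theorem IsNefFan.sum_multiplicity_sectionExponent (h : IsNefFan V J) {v : ι → Fin c → Lat n}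
    (hv : ∀ i k, v i k ∈ J k) {j : Fin c} {α : Lat n} (hα : α ∈ divSections V (J j)) :
    ((∑ r : V, multiplicity V v r * sectionExponent V (J j) α r : ℕ) : ℤ) =
      Fintype.card ι + ∑ i, α ⬝ᵥ ∑ k, v i k := by
  rw [← h.sum_multiplicity_indicator hv j]
  simp only [dotProduct_sum]
  rw [← sum_multiplicity_smul (fun i k => h.nef.subset k (hv i k)) (fun r => α ⬝ᵥ r)]
  push_cast
  rw [← Finset.sum_add_distrib]
  refine Finset.sum_congr rfl fun r _ => ?_
  rw [sectionExponent_apply hα, nsmul_eq_mul, mul_add, indicator,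
    Finsupp.coe_equivFunOnFinite_symm]
  push_cast
  rfl

/-- With t = s^N, take x_r = s^{E_r} z_r times corrections, where E_r counts the occurrences of r
among the v i k. The unknown unit L_k is attached to the single ray v i₀ k ∈ J_k: then m_j acquires
exactly the factor L_j, while the lowest order terms of g_j have exponent 0 at these rays and do not
involve L. -/
theorem IsNefFan.mem_bergmanFan [Nonempty ι] (h : IsNefFan V J) {a : Lat n → ℂ}
    (ha : ∀ j, ∀ u ∈ freeSections V J j, a u ≠ 0) {v : ι → Fin c → Lat n}
    (hv : ∀ i k, v i k ∈ J k)
    (hfree : ∀ j, ∃ α ∈ freeSections V J j, ∀ i, α ⬝ᵥ ∑ k, v i k = -1) :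
    ((1, (Fintype.card ι : ℝ)⁻¹ • ∑ i, toVec (∑ k, v i k)) : ℝ × Vec n) ∈
      bergmanFan V (degenerationIdeal V J a) := by
  set N := Fintype.card ι with hN
  have : NeZero N := ⟨Fintype.card_ne_zero⟩
  have hN0 : (N : ℝ) ≠ 0 := NeZero.ne _
  have hvV : ∀ i k, v i k ∈ V := fun i k => h.nef.subset k (hv i k)
  obtain ⟨i₀⟩ := ‹Nonempty ι›
  set E : V → ℕ := multiplicity V v with hE
  have hval : ∀ j, ∀ α ∈ divSections V (J j), ∀ i k,
      (if j = k then -1 else 0 : ℤ) ≤ α ⬝ᵥ v i k := by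
    intro j α hα i k
    have := hα (v i k) (hvV i k)
    simp only [h.nef.mem_part_iff (hv i k), eq_comm (a := k)] at this
    exact this
  have hval1 : ∀ j, ∀ α ∈ divSections V (J j), ∀ i, -1 ≤ α ⬝ᵥ ∑ k, v i k := by
    intro j α hα i
    rw [dotProduct_sum]
    refine le_trans ?_ (Finset.sum_le_sum fun k _ => hval j α hα i k)
    simp
  set s : Lat n → ℤ := fun α => ∑ i, α ⬝ᵥ ∑ k, v i k with hs
  have hs1 : ∀ j, ∀ α ∈ divSections V (J j), -(N : ℤ) ≤ s α := by
    intro j α hα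
    refine le_trans ?_ (Finset.sum_le_sum fun i _ => hval1 j α hα i)
    simp [hN]
  set d : Lat n → ℕ := fun α => (N + s α).toNat with hd
  -- If d α = 0, then α is tight at every point ∑_k v i k, hence at each v i₀ k, which makes the
  -- exponent there vanish.
  have hd0 : ∀ j, ∀ α ∈ divSections V (J j), d α = 0 → ∀ k,
      sectionExponent V (J j) α ⟨v i₀ k, hvV i₀ k⟩ = 0 := by
    intro j α hα hdα k
    have h1 : ∑ i : ι, (-1 : ℤ) = s α := by
      have := hs1 j α hα
      have h2 := Int.toNat_eq_zero.1 hdα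
      simp only [Finset.sum_const, Finset.card_univ, mul_neg, mul_one, nsmul_eq_mul]
      omega
    have h2 := (Finset.sum_eq_sum_iff_of_le fun i _ => hval1 j α hα i).1 h1 i₀ (Finset.mem_univ _)
    rw [dotProduct_sum] at h2
    have h3 : ∑ k, (if j = k then -1 else 0 : ℤ) = ∑ k, α ⬝ᵥ v i₀ k := by rw [← h2]; simp
    have h4 := (Finset.sum_eq_sum_iff_of_le fun k _ => hval j α hα i₀ k).1 h3 k (Finset.mem_univ _)
    have h5 := sectionExponent_apply hα ⟨v i₀ k, hvV i₀ k⟩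
    simp only [h.nef.mem_part_iff (hv i₀ k), eq_comm (a := k), ← h4] at h5
    split_ifs at h5 <;> omega
  have hfree0 : ∀ j, ((freeFinset V J j).filter fun α => d α = 0).Nonempty := by
    intro j
    obtain ⟨α, hα, h1⟩ := hfree j
    refine ⟨α, Finset.mem_filter.2 ⟨h.mem_freeFinset.2 hα, ?_⟩⟩
    simp [hd, hs, h1, hN]
  have hmemF : ∀ j, ∀ α ∈ freeFinset V J j, α ∈ divSections V (J j) := fun j α hα =>
    (h.mem_freeFinset.1 hα).1
  obtain ⟨z, hz, hzF⟩ := exists_torus_point (J := J) h.interior _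
    (fun j α hα => hmemF j α (Finset.mem_filter.1 hα).1) hfree0
    (fun j α hα => ha j α (h.mem_freeFinset.1 (Finset.mem_filter.1 hα).1))
  obtain ⟨L, hL0, hL⟩ := exists_powerSeries_solution (freeFinset V J)
    (c := fun j => ∏ r, z r ^ indicator V (J j) r)
    (fun j => Finset.prod_ne_zero_iff.2 fun r _ => pow_ne_zero _ (hz r))
    (fun j α => a α * ∏ r, z r ^ sectionExponent V (J j) α r) (fun _ α => d α)
    (fun j α k => sectionExponent V (J j) α ⟨v i₀ k, hvV i₀ k⟩)
    (fun j α hα => hd0 j α (hmemF j α hα)) hzF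
  set u : V → PowerSeries ℂ := fun r =>
    PowerSeries.C (z r) * ∏ k, if v i₀ k = (r : Lat n) then L k else 1 with hu
  have hu0 : ∀ r, PowerSeries.constantCoeff (u r) ≠ 0 := by
    intro r
    rw [hu, map_mul, PowerSeries.constantCoeff_C, map_prod]
    refine mul_ne_zero (hz r) (Finset.prod_ne_zero_iff.2 fun k _ => ?_)
    split_ifs
    · exact hL0 k
    · simp
  set x : V → PuiseuxField := fun r => toPuiseux N (PowerSeries.X ^ E r * u r) with hx
  have hprod : ∀ e : V → ℕ, ∏ r, x r ^ e r = toPuiseux N (PowerSeries.X ^ (∑ r, E r * e r) *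
      (PowerSeries.C (∏ r, z r ^ e r) * ∏ k, L k ^ e ⟨v i₀ k, hvV i₀ k⟩)) := by
    intro e
    simp only [hx, ← map_pow, ← map_prod]
    congr 1
    simp only [mul_pow, Finset.prod_mul_distrib, hu, ← pow_mul, Finset.prod_pow_eq_pow_sum,
      map_prod, map_pow]
    congr 2
    simp only [← Finset.prod_pow]
    rw [Finset.prod_comm]
    refine Finset.prod_congr rfl fun k _ => ?_
    rw [Finset.prod_eq_single_of_mem (⟨v i₀ k, hvV i₀ k⟩ : V) (Finset.mem_univ _), if_pos rfl]
    intro r _ hr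
    rw [if_neg (fun h => hr (Subtype.ext h.symm)), one_pow]
  have hxorder : ∀ r, (x r).order = (E r : ℝ) / N := fun r => order_toPuiseux N (E r) (hu0 r)
  have ht : HahnSeries.single (1 : ℝ) (1 : ℂ) = toPuiseux N (PowerSeries.X ^ N) := by
    have := toPuiseux_C_mul_X_pow N 1 N
    rw [map_one, one_mul, div_self hN0] at this
    exact this.symm
  have hC : ∀ y : ℂ, HahnSeries.C y = toPuiseux N (PowerSeries.C y) := by
    intro y
    have := toPuiseux_C_mul_X_pow N y 0
    rw [pow_zero, mul_one, Nat.cast_zero, zero_div] at this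
    exact this.symm
  refine ⟨HahnSeries.single 1 1, x, ?_, fun r => ?_, fun f hf => ?_, ?_, ?_⟩
  · exact HahnSeries.single_ne_zero one_ne_zero
  · rw [hx]
    intro h0
    have := coeff_toPuiseux N (PowerSeries.X ^ E r * u r) (E r)
    rw [show toPuiseux N (PowerSeries.X ^ E r * u r) = 0 from h0, HahnSeries.coeff_zero,
      PowerSeries.coeff_X_pow_mul', if_pos le_rfl, Nat.sub_self,
      PowerSeries.coeff_zero_eq_constantCoeff_apply] at this
    exact hu0 r this.symm
  · have hker : degenerationIdeal V J a ≤ RingHom.ker (evalAt (HahnSeries.single 1 1) x) := by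
      rw [h.degenerationIdeal_eq_span_degEq, Ideal.span_le]
      rintro _ ⟨j, rfl⟩
      rw [SetLike.mem_coe, RingHom.mem_ker, evalAt_degEq]
      simp only [ht, hC, hprod, ← map_mul, ← map_sum, ← map_add]
      rw [← map_zero (toPuiseux N)]
      congr 1
      rw [← mul_zero (PowerSeries.X ^ N), ← hL j, mul_add, Finset.mul_sum,
        h.sum_multiplicity_indicator hv]
      congr 1
      · congr 2
        have hind : ∀ k, indicator V (J j) ⟨v i₀ k, hvV i₀ k⟩ = if j = k then 1 else 0 := by
          intro k
          simp only [indicator, Finsupp.coe_equivFunOnFinite_symm, h.nef.mem_part_iff (hv i₀ k),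
            eq_comm (a := k)]
        simp only [hind, pow_ite, pow_one, pow_zero]
        rw [Finset.prod_ite_eq, if_pos (Finset.mem_univ j)]
      · refine Finset.sum_congr rfl fun α hα => ?_
        have h1 : ∑ r : V, E r * sectionExponent V (J j) α r = d α := by
          have : ((∑ r : V, E r * sectionExponent V (J j) α r : ℕ) : ℤ) = N + s α :=
            h.sum_multiplicity_sectionExponent hv (hmemF j α hα)
          rw [hd]
          dsimp only
          omega
        rw [h1, map_mul]
        ring
    exact hker hf
  · rw [HahnSeries.order_single one_ne_zero]
  · simp only [hxorder]
    rw [Finset.smul_sum]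
    have h1 := sum_multiplicity_smul hvV (fun r => (N : ℝ)⁻¹ • toVec r)
    simp only [toVec_sum, Finset.smul_sum]
    rw [← h1]
    refine Finset.sum_congr rfl fun r _ => ?_
    rw [div_eq_mul_inv, mul_smul, Nat.cast_smul_eq_nsmul]

end BergmanFan

/-! ### Points of T on prescribed faces and the ideal of X₀° -/

section TropSupport
variable {n c : ℕ} {V : Finset (Lat n)} {J : Fin c → Finset (Lat n)}

open Topology in
theorem not_mem_interior_of_dotProduct_eq {Q : Set (Vec n)} {r w : Vec n}
    (hr : ∀ x ∈ Q, -1 ≤ r ⬝ᵥ x) (hw : r ⬝ᵥ w = -1) : w ∉ interior Q := by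
  intro hi
  have hc : Filter.Tendsto (fun e : ℝ => (1 + e) • w) (𝓝[>] 0) (𝓝 w) := by
    have : Continuous fun e : ℝ => (1 + e) • w := by fun_prop
    simpa using (this.tendsto 0).mono_left nhdsWithin_le_nhds
  obtain ⟨e, he, he0⟩ := ((hc.eventually (mem_interior_iff_mem_nhds.1 hi)).and
    self_mem_nhdsWithin).exists
  have h1 := hr _ he
  rw [dotProduct_smul, hw, smul_eq_mul] at h1
  linarith

/-- A face of the cone `τ` that is cut out by `g`. -/
theorem IsCone.exists_face {W τ : Finset (Lat n)} (hτ : IsCone W τ) {g : Lat n}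
    (hg : g ∈ dualMonoid τ) : ∃ w : Vec n, (∀ r ∈ W, -1 ≤ toVec r ⬝ᵥ w) ∧
      ∀ r ∈ W, toVec r ⬝ᵥ w = -1 ↔ r ∈ τ ∧ g ⬝ᵥ r = 0 := by
  obtain ⟨w, hw, rfl⟩ := hτ
  have hτ0 : ∀ r ∈ W, toVec r ⬝ᵥ w = -1 → 0 ≤ g ⬝ᵥ r := fun r hr h1 =>
    hg r (Finset.mem_filter.2 ⟨hr, h1⟩)
  -- Perturb w by a small multiple of g: tight rays stay tight only if g vanishes on them, and the
  -- other rays stay strict.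
  have hev : ∀ᶠ e : ℝ in nhdsWithin 0 (Set.Ioi 0), ∀ r ∈ W, toVec r ⬝ᵥ w ≠ -1 →
      -1 < toVec r ⬝ᵥ w + e * (toVec r ⬝ᵥ toVec g) := by
    rw [Filter.eventually_all_finset]
    intro r hr
    by_cases h1 : toVec r ⬝ᵥ w = -1
    · simp [h1]
    · have hlt : -1 < toVec r ⬝ᵥ w := lt_of_le_of_ne (hw r hr) (Ne.symm h1)
      have hc : Continuous fun e : ℝ => toVec r ⬝ᵥ w + e * (toVec r ⬝ᵥ toVec g) := by fun_prop
      have := (hc.tendsto 0).mono_left (nhdsWithin_le_nhds (s := Set.Ioi 0))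
      rw [zero_mul, add_zero] at this
      filter_upwards [this.eventually_const_lt hlt] with e he _ using he
  obtain ⟨e, he, he0⟩ := (hev.and self_mem_nhdsWithin).exists
  have hval : ∀ r, toVec r ⬝ᵥ (w + e • toVec g) =
      toVec r ⬝ᵥ w + e * (toVec r ⬝ᵥ toVec g) := by
    intro r
    rw [dotProduct_add, dotProduct_smul, smul_eq_mul]
  have hcast : ∀ r, toVec r ⬝ᵥ toVec g = ((g ⬝ᵥ r : ℤ) : ℝ) := fun r => by
    rw [toVec_dotProduct, dotProduct_comm]
  refine ⟨w + e • toVec g, fun r hr => ?_, fun r hr => ?_⟩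
  · rw [hval]
    by_cases h1 : toVec r ⬝ᵥ w = -1
    · rw [h1, hcast]
      have := hτ0 r hr h1
      have : (0 : ℝ) ≤ ((g ⬝ᵥ r : ℤ) : ℝ) := by exact_mod_cast this
      have := mul_nonneg he0.le this
      linarith
    · exact (he r hr h1).le
  · rw [hval, Finset.mem_filter]
    by_cases h1 : toVec r ⬝ᵥ w = -1
    · rw [h1, hcast]
      simp [hr, he0.ne']
    · simp [h1, (he r hr h1).ne']

/-- As g is not special, each J_j° has a ray ρ_j of τ with ⟨g, ρ_j⟩ = 0, and some w ∈ ∇ is tight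
exactly on the rays of τ killed by g. Write w as a convex combination of generators of ∇. Those that
occur are tight at all ρ_j, so they are sums ∑ v_k with every v_k in J_k and none equal to 0. Their
plain average y has the same tight functionals as w, and `mem_bergmanFan` makes it tropical. -/
theorem IsNefFan.exists_mem_tropSupport (h : IsNefFan V J) (hfull : HasFullNewtonPolytopes V J)
    {a : Lat n → ℂ} (ha : ∀ j, ∀ u ∈ freeSections V J j, a u ≠ 0) {τ : Finset (Lat n)}
    (hτ : IsCone (dualRays V J) τ) {g : Lat n} (hg : g ∈ dualMonoid τ)
    (hns : ¬ IsSpecialExponent (dualParts V J) τ g) (j₀ : Fin c) :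
    ∃ w ∈ tropSupport V (degenerationIdeal V J a) (TropMirror.dual (nablaDual V J)),
      ∀ r ∈ dualRays V J, toVec r ⬝ᵥ w = -1 → r ∈ τ ∧ g ⬝ᵥ r = 0 := by
  have hr0 : ∀ j, ∃ r ∈ dualParts V J j, r ∈ τ ∧ g ⬝ᵥ r = 0 := by
    intro j
    by_contra! hcon
    refine hns ⟨j, fun r hr hrτ => ?_⟩
    have := hg r hrτ
    have := hcon r hr hrτ
    omega
  choose ρ hρK hρτ hρg using hr0
  obtain ⟨w, hw, hface⟩ := hτ.exists_face hg
  have hρw : ∀ j, toVec (ρ j) ⬝ᵥ w = -1 := fun j =>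
    (hface _ (dualParts_subset j (hρK j))).2 ⟨hρτ j, hρg j⟩
  have hwQ := h.mem_dual_of_le hw
  rw [h.dual_nablaDual_eq, mem_convexHull_toVec] at hwQ
  obtain ⟨b, hb0, hb1, hbw⟩ := hwQ
  set P := (nablaGenerators J).filter fun q => b q ≠ 0 with hP
  have hPQ : ∀ q ∈ nablaGenerators J, toVec q ∈ TropMirror.dual (nablaDual V J) := by
    intro q hq
    rw [h.dual_nablaDual_eq]
    exact subset_convexHull ℝ _ ⟨q, hq, rfl⟩
  have hxw : ∀ x : Vec n, x ⬝ᵥ w = ∑ q ∈ nablaGenerators J, b q * (x ⬝ᵥ toVec q) := by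
    intro x
    rw [← hbw, dotProduct_sum]
    simp only [dotProduct_smul, smul_eq_mul]
  have htight : ∀ x : Vec n, (∀ q ∈ nablaGenerators J, -1 ≤ x ⬝ᵥ toVec q) →
      (x ⬝ᵥ w = -1 ↔ ∀ q ∈ P, x ⬝ᵥ toVec q = -1) := by
    intro x hx
    have h1 : ∑ q ∈ nablaGenerators J, b q * (-1) = -1 := by
      rw [← Finset.sum_mul, hb1, one_mul]
    have h2 := Finset.sum_eq_sum_iff_of_le fun q hq =>
      mul_le_mul_of_nonneg_left (hx q hq) (hb0 q)
    rw [h1, ← hxw, eq_comm] at h2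
    rw [h2]
    simp only [hP, Finset.mem_filter, and_imp]
    refine forall₂_congr fun q hq => ?_
    rw [mul_eq_mul_left_iff, or_iff_not_imp_right, eq_comm (a := (-1 : ℝ))]
  have hW : ∀ r ∈ dualRays V J, ∀ q ∈ nablaGenerators J, -1 ≤ toVec r ⬝ᵥ toVec q :=
    fun r hr q hq => h.le_of_mem_dual (hPQ q hq) hr
  have hPne : P.Nonempty := by
    rw [Finset.nonempty_iff_ne_empty]
    intro hemp
    have : ∑ q ∈ nablaGenerators J, b q = 0 := Finset.sum_eq_zero fun q hq => by
      by_contra hbq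
      have : q ∈ P := Finset.mem_filter.2 ⟨hq, hbq⟩
      rw [hemp] at this
      exact Finset.notMem_empty _ this
    rw [hb1] at this
    exact one_ne_zero this
  have hv : ∀ q : P, ∃ v : Fin c → Lat n, (∀ k, v k ∈ J k) ∧ ∑ k, v k = (q : Lat n) := by
    intro q
    have hq := (Finset.mem_filter.1 q.2).1
    obtain ⟨v, hv, hvq⟩ := Finset.mem_image.1 hq
    rw [Fintype.mem_piFinset] at hv
    refine ⟨v, fun k => ?_, hvq⟩
    have h1 : toVec (ρ k) ⬝ᵥ ∑ i, toVec (v i) = -1 := by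
      rw [← toVec_sum, hvq]
      exact (htight _ (hW _ (dualParts_subset k (hρK k)))).1 (hρw k) q q.2
    have h2 := values_of_eq_neg_one h.nef
      (fun i => subset_convexHull ℝ _ ⟨v i, hv i, rfl⟩)
      (toVec_mem_sectionPolytope (h.mem_dualParts.1 (hρK k)).2) h1 k
    rcases Finset.mem_insert.1 (hv k) with h3 | h3
    · rw [h3] at h2
      simp at h2
    · exact h3
  choose v hvJ hvq using hv
  have : Nonempty P := hPne.to_subtype
  set N : ℝ := (Fintype.card P : ℝ) with hN
  have hN0 : 0 < N := Nat.cast_pos.2 Fintype.card_pos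
  set y : Vec n := N⁻¹ • ∑ q : P, toVec (∑ k, v q k) with hy
  have hxy : ∀ x : Vec n, N * (x ⬝ᵥ y) = ∑ q : P, x ⬝ᵥ toVec (q : Lat n) := by
    intro x
    rw [hy, dotProduct_smul, smul_eq_mul, mul_inv_cancel_left₀ hN0.ne', dotProduct_sum]
    simp only [hvq]
  have hcard : ∑ _q : P, (-1 : ℝ) = N * -1 := by
    rw [Finset.sum_const, Finset.card_univ, nsmul_eq_mul]
  have hPg : ∀ q : P, (q : Lat n) ∈ nablaGenerators J := fun q => (Finset.mem_filter.1 q.2).1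
  have hyle : ∀ x : Vec n, (∀ q ∈ nablaGenerators J, -1 ≤ x ⬝ᵥ toVec q) → -1 ≤ x ⬝ᵥ y := by
    intro x hx
    rw [← mul_le_mul_iff_right₀ hN0, hxy, ← hcard]
    exact Finset.sum_le_sum fun q _ => hx q (hPg q)
  have hyeq : ∀ x : Vec n, (∀ q ∈ nablaGenerators J, -1 ≤ x ⬝ᵥ toVec q) →
      (x ⬝ᵥ y = -1 ↔ x ⬝ᵥ w = -1) := by
    intro x hx
    have h2 := Finset.sum_eq_sum_iff_of_le (s := Finset.univ) fun (q : P) _ => hx q (hPg q)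
    rw [hcard, ← hxy, mul_right_inj' hN0.ne', eq_comm] at h2
    rw [htight x hx, h2]
    exact ⟨fun h1 q hq => (h1 ⟨q, hq⟩ (Finset.mem_univ _)).symm, fun h1 q _ => (h1 q q.2).symm⟩
  refine ⟨y, ⟨⟨subset_closure (h.mem_dual_of_le fun r hr => hyle _ (hW r hr)), ?_⟩, ?_⟩, ?_⟩
  · exact not_mem_interior_of_dotProduct_eq
      (fun x hx => h.le_of_mem_dual hx (dualParts_subset j₀ (hρK j₀)))
      ((hyeq _ (hW _ (dualParts_subset j₀ (hρK j₀)))).2 (hρw j₀))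
  · refine h.mem_bergmanFan ha hvJ fun j => ?_
    have h1 := toVec_mem_sectionPolytope (h.mem_dualParts.1 (hρK j)).2
    rw [← hfull j] at h1
    have hQ : ∀ α ∈ freeSections V J j, ∀ q ∈ nablaGenerators J, -1 ≤ toVec α ⬝ᵥ toVec q :=
      fun α hα q hq => mem_dual_nablaDual.1 (hPQ q hq) j α hα.1
    obtain ⟨s, hs, hsw⟩ := exists_mem_face (w := w) (c := -1) (by
      rintro _ (rfl | ⟨α, hα, rfl⟩)
      · simp
      · refine mem_dual_nablaDual.1 (h.mem_dual_of_le hw) j α hα.1) h1 (hρw j)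
    rcases hs with rfl | ⟨α, hα, rfl⟩
    · simp at hsw
    · refine ⟨α, hα, fun q => ?_⟩
      have := (htight _ (hQ α hα)).1 hsw q q.2
      rw [hvq]
      rw [toVec_dotProduct] at this
      exact_mod_cast this
  · intro r hr h1
    exact (hface r hr).1 ((hyeq _ (hW r hr)).1 h1)

/-- The ideal of `X_0°` is the ideal of the special fiber of the mirror degeneration. -/
theorem IsNefFan.mem_chartIdeal_iff (h : IsNefFan V J) (hfull : HasFullNewtonPolytopes V J)
    {a : Lat n → ℂ} (ha : ∀ j, ∀ u ∈ freeSections V J j, a u ≠ 0) {τ : Finset (Lat n)}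
    (hτ : IsCone (dualRays V J) τ) (j₀ : Fin c) (x : ChartRing ℂ τ) :
    x ∈ chartIdeal (dualRays V J) τ (mirrorSpecialIdeal (dualRays V J)
      (TropMirror.dual (nablaDual V J))
      (tropSupport V (degenerationIdeal V J a) (TropMirror.dual (nablaDual V J)))) ↔
      ∀ g ∈ x.coeff.support, IsSpecialExponent (dualParts V J) τ (g : dualMonoid τ) := by
  rw [mem_chartIdeal_mirrorSpecialIdeal (h.interior_verts j₀)]
  refine forall₂_congr fun g _ => ?_
  constructor
  · rintro ⟨A, hA, hgA⟩
    by_contra hns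
    obtain ⟨w, hw, hface⟩ := h.exists_mem_tropSupport hfull ha hτ g.2 hns j₀
    obtain ⟨r, hr, -, hrw⟩ := Set.mem_iUnion₂.1 (hA hw)
    obtain ⟨hrτ, hgr⟩ := hface r r.2 hrw
    have := hgA r hr hrτ
    omega
  · rintro ⟨j, hj⟩
    refine ⟨Finset.univ.filter fun r => (r : Lat n) ∈ dualParts V J j, fun w hw => ?_,
      fun r hr hrτ => hj r (Finset.mem_filter.1 hr).2 hrτ⟩
    obtain ⟨r, hr, hrw⟩ := h.exists_dualPart_of_mem_tropSupport hw j
    exact Set.mem_iUnion₂.2 ⟨⟨r, dualParts_subset j hr⟩,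
      Finset.mem_filter.2 ⟨Finset.mem_univ _, hr⟩, h.isClosed_dual.frontier_subset hw.1, hrw⟩

end TropSupport

end TropMirror

end

/-! ### Mirror duality of canonical degenerations -/

theorem mainTheorem3 (n c : ℕ) (Δ : Set (Vec n)) (hΔ : IsReflexive Δ)
    (J : Fin c → Finset (Lat n))
    (hJ : IsNefPartition (verts (dual Δ)) J)
    (hX₀ : ∃ τ, IsCone (verts (dual Δ)) τ ∧ ∀ j, (τ ∩ J j).Nonempty)
    (hfull : HasFullNewtonPolytopes (verts (dual Δ)) J)
    (hfull' : HasFullNewtonPolytopes (verts (nablaDual (verts (dual Δ)) J))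
      (dualPartition (verts (dual Δ)) J (verts (nablaDual (verts (dual Δ)) J))))
    (ord : LocalMonomialOrder (verts (dual Δ)))
    (a : Lat n → ℂ) (ha : ∀ j, ∀ u ∈ freeSections (verts (dual Δ)) J j, a u ≠ 0) :
    let V := verts (dual Δ)
    let I₀ := specialIdeal V J
    let I := degenerationIdeal V J a
    let Q := specialFiberPolytope V ord I₀ I
    let V' := verts (dual Q)
    let J' := dualPartition V J V'
    let I₀' := mirrorSpecialIdeal V' Q (tropSupport V I Q)
    let Ξ := deformationPoints V I₀
    dual Q = nablaDual V J ∧ IsReflexive Q ∧ IsNefPartition V' J' ∧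
    (∀ α ∈ Ξ, IsDeformation V' I₀' α) ∧
    ∃ P : MvPolynomial (Lat n) ℂ, P ≠ 0 ∧ ∀ b : Lat n → ℂ, MvPolynomial.eval b P ≠ 0 →
      ∀ τ, IsCone V' τ →
        Module.Flat ℂ[X] (ChartRing ℂ[X] τ ⧸ chartIdeal V' τ (degenerationIdeal V' J' b)) ∧
        (chartIdeal V' τ (degenerationIdeal V' J' b)).map (toFirstOrder τ) =
          firstOrderIdeal V' I₀' Ξ b τ := by
  intro V I₀ I
  have hverts : convexHull ℝ (toVec '' (V : Set (Lat n))) = dual Δ :=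
    convexHull_verts hΔ.dual_lattice
  have h : IsNefFan V J := ⟨by rw [hverts]; exact hΔ.zero_mem_dual, hJ⟩
  obtain ⟨j₀⟩ : Nonempty (Fin c) := by
    obtain ⟨v, hv⟩ : V.Nonempty := by
      rw [Finset.nonempty_iff_ne_empty]
      intro hV
      have := h.interior
      simp [hV] at this
    obtain ⟨j, -⟩ := hJ.exists_part hv
    exact ⟨j⟩
  -- For n = 0 every pairing is 0, so no cone contains a ray, contrary to the special fiber being
  -- non-empty.
  have hn : 0 < n := by
    rw [Nat.pos_iff_ne_zero]
    rintro rfl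
    obtain ⟨τ, ⟨w, -, rfl⟩, hτ⟩ := hX₀
    obtain ⟨r, hr⟩ := hτ j₀
    simp [dotProduct] at hr
  have hQ : specialFiberPolytope V ord I₀ I = dual (nablaDual V J) :=
    h.specialFiberPolytope_eq hfull ord ha
  dsimp only
  rw [hQ, h.dual_dual_nablaDual j₀]
  have hN : IsNefPartition (dualRays V J) (dualParts V J) := h.isNefPartition_dual hn hX₀
  have hdual : IsNefFan (dualRays V J) (dualParts V J) := h.dual hn hX₀ j₀
  have hideal := fun τ hτ => h.mem_chartIdeal_iff hfull ha (τ := τ) hτ j₀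
  obtain ⟨P, hP, hflat⟩ := exists_flat hdual hfull' (h.exists_dual_cone hX₀)
  refine ⟨rfl, h.isReflexive j₀, hN, fun α hα => ?_, P, hP, fun b hb τ hτ => ⟨hflat b hb τ hτ, ?_⟩⟩
  · obtain ⟨j, hj⟩ := h.mem_freeSections_of_mem_deformationPoints hn hα hN
    exact hdual.isDeformation hideal hj.1
  · obtain ⟨u, hu⟩ := exists_isGenerators hdual hfull' hτ
    refine hu.firstOrder_eq hdual hτ _ (fun g => ?_) _
      (fun α hα => h.mem_freeSections_of_mem_deformationPoints hn hα hN)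
      (fun j α hα hr => h.mem_deformationPoints hn hτ hα hr) b
    rw [hideal τ hτ]
    simp
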